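/- **Setting.** Let $1\le N\le 3$, let $\Omega\subset\mathbb R^N$ be a bounded open set with $C^\infty$ boundary $\Gamma$, and put $H=L^2(\Omega)$, $V=H^1(\Omega)$ (with $\|v\|_V^2=\|v\|_H^2+\|\nabla v\|_H^2$), $V'$ the dual of $V$, where $H\subset V'$ through $\langle u,v\rangle=(u,v)_H$. Let $\mu>0$, $\gamma>0$, and let $h\in C^2(\mathbb R)\cap W^{2,\infty}(\mathbb R)$ satisfy, for some constant $c_h>1$, $$\|h\|_{W^{2,\infty}(\mathbb R)}+\sup_{r\in\mathbb R}|rh'(r)|\le c_h,\qquad \tfrac1{c_h}\le 1+rh''(r)s\le c_h\quad (r\in\mathbb R,\ s\in[0,1]).$$ Here $\|h\|_{W^{2,\infty}(\mathbb R)}=\sup|h|+\sup|h'|+\sup|h''|$. Set $\psi(r,s)=r-s\,(h(r)-rh'(r))$, $$\langle A_\gamma v,w\rangle=\int_\Omega\nabla v\cdot\nabla w\,dx+\gamma\int_\Gamma v\,w\,d\sigma\quad(v,w\in V),\qquad \langle Av,w\rangle=\int_\Omega\nabla v\cdot\nabla w\,dx$$ (the latter for $v,w\in V$, and also for $v\in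 W^{1,q}(\Omega)$, $w\in W^{1,q'}(\Omega)$ with $\frac1q+\frac1{q'}=1$); $\hat\beta(r)=\int_0^r\log(1+s)\,ds$ if $0\le r\le1$ and $\hat\beta(r)=+\infty$ otherwise; $J(v)=\int_\Omega\hat\beta(v)\,dx\in[0,+\infty]$ for $v\in V$; and $\partial_{V,V'}J$ is its subdifferential. Let $(1*p)(t)=\int_0^tp(s)\,ds$. Let the initial data satisfy $e_0\in L^1(\Omega)$; $\chi_0\in V$ with $\hat\beta(\chi_0)\in L^1(\Omega)$; $u_0\in L^1(\Omega)\cap V'$ with $u_0>0$ a.e. and $\log u_0\in L^1(\Omega)$. **Weak solutions.** For $T>0$ and $Q=\Omega\times(0,T)$, a sextuple $(e,\theta,\chi,\xi,u,p)$ is a weak solution on $(0,T)$ if, for some $q$ with $1<q<\frac{N+2}{N+1}$ and $q'=\frac q{q-1}$, * $e,\theta\in L^q(0,T;W^{1,q}(\Omega))$, $\ \partial_te\in L^1(0,T;W^{1,q'}(\Omega)')$, $\ \chi\in H^1(0,T;H)\cap L^2(0,T;V)$, $\ \xi\in L^2(0,T;V')$, * $u\in L^\infty(0,T;V')\cap L^2(0,T;H)$,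 $u>0$ a.e. in $Q$, $\ p\in L^2(0,T;H)$, $\ 1*p\in L^\infty(0,T;V)$, * $\partial_te+A\theta=-h(\theta)\,\partial_t\chi+\mu(\partial_t\chi)^2$ in $W^{1,q'}(\Omega)'$, a.e. in $(0,T)$, * $e=\psi(\theta,\chi)$ and $p=u(1+\chi)$ a.e. in $Q$, * $\mu\,\partial_t\chi+A\chi+\xi=h(\theta)-\log u$ in $V'$, a.e. in $(0,T)$, and $\xi(t)\in\partial_{V,V'}J(\chi(t))$ for a.e. $t\in(0,T)$, * $u+A_\gamma(1*p)=u_0$ in $V'$, a.e. in $(0,T)$, * $e(0)=e_0$ in $W^{1,q'}(\Omega)'$ and $\chi(0)=\chi_0$ in $H$. A locally integrable function $f$ on $\Omega$ is identified with $L\in W^{1,r}(\Omega)'$ ($1\le r<\infty$; in particular $L\in V'$ for $r=2$) if $\langle L,w\rangle=\int_\Omega fw\,dx$ for all $w\in W^{1,r}(\Omega)$ with $fw\in L^1(\Omega)$. **Theorem.** Let $(e,\theta,\chi,\xi,u,p)$ be defined on $\Omega\times(0,\infty)$ (with $\xi$ being $V'$-valued on $(0,\infty)$) and be a weak solution on $(0,T)$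 for every $T>0$. Then $$u\in L^2(0,+\infty;L^2(\Omega)),$$ and $u$ (after modification on a null set of times) belongs to $C^0([0,+\infty);V')$ and decays exponentially in $V'$: there are constants $C$ and $\alpha>0$ such that $$\|u(t)\|_{V'}\le C\,e^{-\alpha t}\qquad\text{for all }t\ge0 .$$ -/

import Mathlib

open MeasureTheory Set Filter Topology
open scoped ENNReal ContDiff

noncomputable section

/-- The Euclidean space `ℝ^N`. -/
abbrev Eucl (N : ℕ) : Type := EuclideanSpace ℝ (Fin N)

/-- A bounded open set of class `C^∞`: near each boundary point it is the sublevel set of a smooth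
function with nonvanishing differential (so it lies on one side of its boundary). -/
structure IsBoundedSmoothOpen {N : ℕ} (Ω : Set (Eucl N)) : Prop where
  isOpen : IsOpen Ω
  isBounded : Bornology.IsBounded Ω
  smooth_boundary : ∀ x ∈ frontier Ω, ∃ (U : Set (Eucl N)) (ρ : Eucl N → ℝ),
    IsOpen U ∧ x ∈ U ∧ ContDiff ℝ ∞ ρ ∧ (∀ y ∈ U, fderiv ℝ ρ y ≠ 0) ∧
      Ω ∩ U = {y | ρ y < 0} ∩ U

/-- The Lebesgue space `L^p(Ω)`. -/
abbrev LpOn {N : ℕ} (Ω : Set (Eucl N)) (p : ℝ≥0∞) : Type :=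
  Lp ℝ p (volume.restrict Ω)

/-- The Lebesgue space `L^p(Ω; ℝ^N)` of vector fields. -/
abbrev LpVec {N : ℕ} (Ω : Set (Eucl N)) (p : ℝ≥0∞) : Type :=
  Lp (Eucl N) p (volume.restrict Ω)

/-- `g` is the weak gradient of `v` on `Ω`: integration by parts holds against every test function
in `C_c^∞(Ω)`. -/
def IsWeakGradient {N : ℕ} (Ω : Set (Eucl N)) (v : Eucl N → ℝ) (g : Eucl N → Eucl N) : Prop :=
  ∀ φ : Eucl N → ℝ, ContDiff ℝ ∞ φ → HasCompactSupport φ → tsupport φ ⊆ Ω → ∀ i : Fin N,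
    ∫ x in Ω, v x * fderiv ℝ φ x (EuclideanSpace.single i 1) = -∫ x in Ω, g x i * φ x

/-- The Sobolev space `W^{1,p}(Ω)`, realized as the space of pairs `(v, ∇v)` in
`L^p(Ω) × L^p(Ω; ℝ^N)`, with the norm `(‖v‖_p^p + ‖∇v‖_p^p)^{1/p}`. -/
def W1p {N : ℕ} (Ω : Set (Eucl N)) (p : ℝ≥0∞) [hp : Fact (1 ≤ p)] :
    Submodule ℝ (WithLp p (LpOn Ω p × LpVec Ω p)) where
  carrier := {w | IsWeakGradient Ω w.fst w.snd}
  zero_mem' := by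
    intro φ _ _ _ i
    have h1 : ∀ᵐ x ∂(volume.restrict Ω),
        ((0 : LpOn Ω p) : Eucl N → ℝ) x * fderiv ℝ φ x (EuclideanSpace.single i 1) = 0 := by
      filter_upwards [Lp.coeFn_zero ℝ p (volume.restrict Ω)] with x hx
      rw [hx, Pi.zero_apply, zero_mul]
    have h2 : ∀ᵐ x ∂(volume.restrict Ω),
        ((0 : LpVec Ω p) : Eucl N → Eucl N) x i * φ x = 0 := by
      filter_upwards [Lp.coeFn_zero (Eucl N) p (volume.restrict Ω)] with x hx
      rw [hx, Pi.zero_apply, PiLp.zero_apply, zero_mul]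
    change ∫ x in Ω, ((0 : LpOn Ω p) : Eucl N → ℝ) x * fderiv ℝ φ x (EuclideanSpace.single i 1) =
      -∫ x in Ω, ((0 : LpVec Ω p) : Eucl N → Eucl N) x i * φ x
    rw [integral_congr_ae h1, integral_congr_ae h2]
    simp
  add_mem' := by
    intro a b ha hb φ h1 h2 h3 i
    have hφ' : Continuous fun x => fderiv ℝ φ x (EuclideanSpace.single i 1) :=
      (h1.continuous_fderiv (by simp)).clm_apply continuous_const
    have hφ'c : HasCompactSupport fun x => fderiv ℝ φ x (EuclideanSpace.single i 1) :=
      h2.fderiv_apply ℝ _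
    have iv : ∀ v : LpOn Ω p, Integrable
        (fun x => v x * fderiv ℝ φ x (EuclideanSpace.single i 1)) (volume.restrict Ω) := by
      intro v
      simpa [mul_comm] using ((Lp.memLp v).locallyIntegrable
        hp.out).integrable_smul_left_of_hasCompactSupport hφ' hφ'c
    have ig : ∀ g : LpVec Ω p, Integrable (fun x => g x i * φ x) (volume.restrict Ω) := by
      intro g
      have := ((Lp.memLp g).locallyIntegrable
        hp.out).integrable_smul_left_of_hasCompactSupport h1.continuous h2
      simpa [mul_comm] using (EuclideanSpace.proj (𝕜 := ℝ) i).integrable_comp this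
    have e1 : ∀ᵐ x ∂(volume.restrict Ω),
        ((a.fst + b.fst : LpOn Ω p) : Eucl N → ℝ) x * fderiv ℝ φ x (EuclideanSpace.single i 1) =
          a.fst x * fderiv ℝ φ x (EuclideanSpace.single i 1) +
          b.fst x * fderiv ℝ φ x (EuclideanSpace.single i 1) := by
      filter_upwards [Lp.coeFn_add a.fst b.fst] with x hx
      rw [hx, Pi.add_apply, add_mul]
    have e2 : ∀ᵐ x ∂(volume.restrict Ω),
        ((a.snd + b.snd : LpVec Ω p) : Eucl N → Eucl N) x i * φ x =
          a.snd x i * φ x + b.snd x i * φ x := by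
      filter_upwards [Lp.coeFn_add a.snd b.snd] with x hx
      rw [hx, Pi.add_apply, PiLp.add_apply, add_mul]
    change ∫ x in Ω, ((a.fst + b.fst : LpOn Ω p) : Eucl N → ℝ) x *
        fderiv ℝ φ x (EuclideanSpace.single i 1) =
      -∫ x in Ω, ((a.snd + b.snd : LpVec Ω p) : Eucl N → Eucl N) x i * φ x
    rw [integral_congr_ae e1, integral_congr_ae e2, integral_add (iv _) (iv _),
      integral_add (ig _) (ig _), ha φ h1 h2 h3 i, hb φ h1 h2 h3 i]
    ring
  smul_mem' := by
    intro c a ha φ h1 h2 h3 i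
    have e1 : ∀ᵐ x ∂(volume.restrict Ω),
        ((c • a.fst : LpOn Ω p) : Eucl N → ℝ) x * fderiv ℝ φ x (EuclideanSpace.single i 1) =
          c * (a.fst x * fderiv ℝ φ x (EuclideanSpace.single i 1)) := by
      filter_upwards [Lp.coeFn_smul c a.fst] with x hx
      rw [hx, Pi.smul_apply, smul_eq_mul, mul_assoc]
    have e2 : ∀ᵐ x ∂(volume.restrict Ω),
        ((c • a.snd : LpVec Ω p) : Eucl N → Eucl N) x i * φ x = c * (a.snd x i * φ x) := by
      filter_upwards [Lp.coeFn_smul c a.snd] with x hx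
      rw [hx, Pi.smul_apply, PiLp.smul_apply, smul_eq_mul, mul_assoc]
    change ∫ x in Ω, ((c • a.fst : LpOn Ω p) : Eucl N → ℝ) x *
        fderiv ℝ φ x (EuclideanSpace.single i 1) =
      -∫ x in Ω, ((c • a.snd : LpVec Ω p) : Eucl N → Eucl N) x i * φ x
    rw [integral_congr_ae e1, integral_congr_ae e2, integral_const_mul, integral_const_mul,
      ha φ h1 h2 h3 i]
    ring

/-- The embedding `W^{1,p}(Ω) → L^p(Ω)`. -/
def W1p.toLp {N : ℕ} {Ω : Set (Eucl N)} {p : ℝ≥0∞} [Fact (1 ≤ p)] :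
    W1p Ω p →L[ℝ] LpOn Ω p :=
  (WithLp.fstL p ℝ (LpOn Ω p) (LpVec Ω p)).comp (W1p Ω p).subtypeL

/-- The weak gradient `W^{1,p}(Ω) → L^p(Ω; ℝ^N)`. -/
def W1p.grad {N : ℕ} {Ω : Set (Eucl N)} {p : ℝ≥0∞} [Fact (1 ≤ p)] :
    W1p Ω p →L[ℝ] LpVec Ω p :=
  (WithLp.sndL p ℝ (LpOn Ω p) (LpVec Ω p)).comp (W1p Ω p).subtypeL

/-- `∫_Ω ∇v · ∇w dx` for `v ∈ W^{1,p}(Ω)` and `w ∈ W^{1,q}(Ω)`; this is `⟨A v, w⟩`. -/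
def gradForm {N : ℕ} {Ω : Set (Eucl N)} {p q : ℝ≥0∞} [Fact (1 ≤ p)] [Fact (1 ≤ q)]
    (v : W1p Ω p) (w : W1p Ω q) : ℝ :=
  ∫ x in Ω, inner ℝ (W1p.grad v x) (W1p.grad w x)

/-- `H = L²(Ω)`. -/
abbrev SpaceH {N : ℕ} (Ω : Set (Eucl N)) : Type := LpOn Ω 2

/-- `V = H¹(Ω)`, a pre-Hilbert space with `‖v‖_V² = ‖v‖_H² + ‖∇v‖_H²`. -/
abbrev SpaceV {N : ℕ} (Ω : Set (Eucl N)) : Type := W1p Ω 2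

/-- The dual `V'` of `V`, with the dual norm. -/
abbrev DualV {N : ℕ} (Ω : Set (Eucl N)) : Type := StrongDual ℝ (SpaceV Ω)

/-- The embedding `H → V'`, `⟨u, v⟩ = (u, v)_H`. -/
def embHV' {N : ℕ} {Ω : Set (Eucl N)} (u : SpaceH Ω) : DualV Ω :=
  (innerSL ℝ u).comp W1p.toLp

/-- The function `f`, as a distribution on `Ω`, belongs to `W^{1,p}(Ω)'` and is the functional `L`:
the pairing is integration against `f` whenever that makes sense. -/
def IsFunctionalOf {N : ℕ} {Ω : Set (Eucl N)} {p : ℝ≥0∞} [Fact (1 ≤ p)]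
    (f : Eucl N → ℝ) (L : StrongDual ℝ (W1p Ω p)) : Prop :=
  LocallyIntegrableOn f Ω ∧
    ∀ w : W1p Ω p, IntegrableOn (fun x => f x * W1p.toLp w x) Ω →
      L w = ∫ x in Ω, f x * W1p.toLp w x

/-- The surface measure on the boundary `Γ = ∂Ω`. -/
def surfaceMeasure {N : ℕ} (Ω : Set (Eucl N)) : Measure (Eucl N) :=
  (Measure.euclideanHausdorffMeasure (N - 1)).restrict (frontier Ω)

/-- `τ ∈ L²(Γ)` is the trace of `v ∈ H¹(Ω)`: there are smooth functions on `ℝ^N` whose restrictions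
converge to `v` in `H¹(Ω)` and to `τ` in `L²(Γ)`. -/
def IsTrace {N : ℕ} {Ω : Set (Eucl N)} (v : SpaceV Ω) (τ : Lp ℝ 2 (surfaceMeasure Ω)) : Prop :=
  ∃ φ : ℕ → Eucl N → ℝ, (∀ k, ContDiff ℝ ∞ (φ k)) ∧
    Tendsto (fun k => eLpNorm (fun x => φ k x - W1p.toLp v x) 2 (volume.restrict Ω))
      atTop (𝓝 0) ∧
    Tendsto (fun k => eLpNorm (fun x => gradient (φ k) x - W1p.grad v x) 2 (volume.restrict Ω))
      atTop (𝓝 0) ∧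
    Tendsto (fun k => eLpNorm (fun x => φ k x - τ x) 2 (surfaceMeasure Ω)) atTop (𝓝 0)

open Classical in
/-- The trace `H¹(Ω) → L²(Γ)`. By the trace theorem the trace of every `v ∈ H¹(Ω)` exists and is
unique if `Ω` is a bounded smooth open set; the other case of the definition does not occur. -/
def trace {N : ℕ} {Ω : Set (Eucl N)} (v : SpaceV Ω) : Lp ℝ 2 (surfaceMeasure Ω) :=
  if hv : ∃ τ, IsTrace v τ then hv.choose else 0

/-- `⟨A_γ v, w⟩ = ∫_Ω ∇v · ∇w dx + γ ∫_Γ v w dσ`. -/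
def robinForm {N : ℕ} {Ω : Set (Eucl N)} (γ : ℝ) (v w : SpaceV Ω) : ℝ :=
  gradForm v w + γ * ∫ x, trace v x * trace w x ∂(surfaceMeasure Ω)

/-- `h ∈ C²(ℝ) ∩ W^{2,∞}(ℝ)`, `‖h‖_{W^{2,∞}} + sup |r h'(r)| ≤ c` and
`1/c ≤ 1 + r h''(r) s ≤ c` for `r ∈ ℝ`, `s ∈ [0,1]`. -/
structure IsAdmissible (h : ℝ → ℝ) (c : ℝ) : Prop where
  one_lt : 1 < c
  contDiff : ContDiff ℝ 2 h
  bound : ∀ r₀ r₁ r₂ r₃ : ℝ,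
    |h r₀| + |deriv h r₁| + |deriv (deriv h) r₂| + |r₃ * deriv h r₃| ≤ c
  lower : ∀ r : ℝ, ∀ s ∈ Icc (0 : ℝ) 1, 1 / c ≤ 1 + r * deriv (deriv h) r * s
  upper : ∀ r : ℝ, ∀ s ∈ Icc (0 : ℝ) 1, 1 + r * deriv (deriv h) r * s ≤ c

/-- `ψ(r, s) = r - s (h(r) - r h'(r))`. -/
def psi (h : ℝ → ℝ) (r s : ℝ) : ℝ := r - s * (h r - r * deriv h r)

open Classical in
/-- `β̂(r) = ∫₀^r log(1+s) ds` for `0 ≤ r ≤ 1`, and `+∞` elsewhere. -/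
def betaHat (r : ℝ) : ℝ≥0∞ :=
  if 0 ≤ r ∧ r ≤ 1 then ENNReal.ofReal (∫ s in (0 : ℝ)..r, Real.log (1 + s)) else ⊤

/-- `J(v) = ∫_Ω β̂(v) dx` for `v ∈ V`, which is `+∞` if `β̂(v)` is not in `L¹(Ω)`. -/
def funJ {N : ℕ} {Ω : Set (Eucl N)} (v : SpaceV Ω) : ℝ≥0∞ :=
  ∫⁻ x in Ω, betaHat (W1p.toLp v x)

/-- `ξ ∈ ∂_{V,V'} J(v)`. -/
def IsSubgradientJ {N : ℕ} {Ω : Set (Eucl N)} (ξ : DualV Ω) (v : SpaceV Ω) : Prop :=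
  funJ v ≠ ⊤ ∧
    ∀ w : SpaceV Ω, ((funJ v : ℝ≥0∞) : EReal) + ((ξ (w - v) : ℝ) : EReal) ≤ (funJ w : EReal)

/-- Lebesgue measure on the time interval `(0, T)`. -/
abbrev timeMeasure (T : ℝ) : Measure ℝ := volume.restrict (Ioo 0 T)

/-- `g` is the weak derivative of the vector-valued function `f` on `(0, T)`. -/
def HasWeakTimeDeriv {X : Type*} [NormedAddCommGroup X] [NormedSpace ℝ X]
    (T : ℝ) (f g : ℝ → X) : Prop :=
  ∀ φ : ℝ → ℝ, ContDiff ℝ ∞ φ → HasCompactSupport φ → tsupport φ ⊆ Ioo 0 T →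
    ∫ t, deriv φ t • f t ∂(timeMeasure T) = -∫ t, φ t • g t ∂(timeMeasure T)

/-- The function `f : (0, T) → L^r(Ω)` belongs to `L^s(0, T; W^{1,p}(Ω))`, and `F` is `f` seen as a
function with values in `W^{1,p}(Ω)`. -/
def IsSobolevLift {N : ℕ} {Ω : Set (Eucl N)} {p r : ℝ≥0∞} [Fact (1 ≤ p)]
    (T : ℝ) (s : ℝ≥0∞) (f : ℝ → LpOn Ω r) (F : ℝ → W1p Ω p) : Prop :=
  MemLp F s (timeMeasure T) ∧
    ∀ᵐ t ∂(timeMeasure T), ∀ᵐ x ∂(volume.restrict Ω), W1p.toLp (F t) x = f t x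

/-- `(e, θ, χ, ξ, u, p)` is a weak solution on `(0, T)`, for the exponents `q`, `q'`, where
`E, Θ` are `e, θ` as functions with values in `W^{1,q}(Ω)`,
`E'` is the continuous representative of `e` with values in `W^{1,q'}(Ω)'`, and `dE` is `∂_t e`,
`X` is `χ` as a function with values in `V`, `χc` is its continuous representative with values in
`H`, and `dχ` is `∂_t χ`,
`Λ` is `log u` as a function with values in `V'`,
`P` is `1 * p` as a function with values in `V`. -/
structure IsWeakSolutionWith {N : ℕ} {Ω : Set (Eucl N)} (μ γ : ℝ) (h : ℝ → ℝ)
    (e₀ : LpOn Ω 1) (χ₀ : SpaceV Ω) (u₀ : DualV Ω) (T : ℝ)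
    (e θ : ℝ → LpOn Ω 1) (χ : ℝ → SpaceH Ω) (ξ : ℝ → DualV Ω) (u p : ℝ → SpaceH Ω)
    (q q' : ℝ≥0∞) [Fact (1 ≤ q)] [Fact (1 ≤ q')]
    (E Θ : ℝ → W1p Ω q) (E' dE : ℝ → StrongDual ℝ (W1p Ω q'))
    (X : ℝ → SpaceV Ω) (χc dχ : ℝ → SpaceH Ω) (Λ : ℝ → DualV Ω) (P : ℝ → SpaceV Ω) : Prop where
  one_lt_q : 1 < q
  q_lt : q < ((N : ℝ≥0∞) + 2) / ((N : ℝ≥0∞) + 1)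
  conj : q⁻¹ + q'⁻¹ = 1
  e_mem : IsSobolevLift T q e E
  θ_mem : IsSobolevLift T q θ Θ
  e_dual : ∀ᵐ t ∂(timeMeasure T), IsFunctionalOf (e t) (E' t)
  e_cont : ContinuousOn E' (Icc 0 T)
  e_deriv : HasWeakTimeDeriv T E' dE
  e_deriv_mem : MemLp dE 1 (timeMeasure T)
  χ_mem : MemLp χ 2 (timeMeasure T)
  χ_deriv : HasWeakTimeDeriv T χ dχ
  χ_deriv_mem : MemLp dχ 2 (timeMeasure T)
  χ_memV : IsSobolevLift T 2 χ X
  χ_cont : ContinuousOn χc (Icc 0 T)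
  χ_cont_eq : ∀ᵐ t ∂(timeMeasure T), χc t = χ t
  ξ_mem : MemLp ξ 2 (timeMeasure T)
  u_mem : MemLp u 2 (timeMeasure T)
  u_memV' : MemLp (fun t => embHV' (u t)) ⊤ (timeMeasure T)
  u_pos : ∀ᵐ t ∂(timeMeasure T), ∀ᵐ x ∂(volume.restrict Ω), 0 < u t x
  p_mem : MemLp p 2 (timeMeasure T)
  p_conv : IsSobolevLift T ⊤ (fun t => ∫ s in (0 : ℝ)..t, p s) P
  eq_energy : ∀ᵐ t ∂(timeMeasure T), ∀ w : W1p Ω q',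
    dE t w + gradForm (Θ t) w =
      ∫ x in Ω, (-h (θ t x) * dχ t x + μ * dχ t x ^ 2) * W1p.toLp w x
  eq_e : ∀ᵐ t ∂(timeMeasure T), ∀ᵐ x ∂(volume.restrict Ω), e t x = psi h (θ t x) (χ t x)
  log_u_dual : ∀ᵐ t ∂(timeMeasure T), IsFunctionalOf (fun x => Real.log (u t x)) (Λ t)
  eq_phase : ∀ᵐ t ∂(timeMeasure T), ∀ w : SpaceV Ω,
    μ * embHV' (dχ t) w + gradForm (X t) w + ξ t w =
      (∫ x in Ω, h (θ t x) * W1p.toLp w x) - Λ t w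
  eq_ξ : ∀ᵐ t ∂(timeMeasure T), IsSubgradientJ (ξ t) (X t)
  eq_u : ∀ᵐ t ∂(timeMeasure T), ∀ w : SpaceV Ω,
    embHV' (u t) w + robinForm γ (P t) w = u₀ w
  eq_p : ∀ᵐ t ∂(timeMeasure T), ∀ᵐ x ∂(volume.restrict Ω), p t x = u t x * (1 + χ t x)
  init_e : IsFunctionalOf e₀ (E' 0)
  init_χ : χc 0 = W1p.toLp χ₀

/-- `(e, θ, χ, ξ, u, p)` is a weak solution on `(0, T)` with initial data `e₀, χ₀, u₀`. -/
def IsWeakSolution {N : ℕ} {Ω : Set (Eucl N)} (μ γ : ℝ) (h : ℝ → ℝ)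
    (e₀ : LpOn Ω 1) (χ₀ : SpaceV Ω) (u₀ : DualV Ω) (T : ℝ)
    (e θ : ℝ → LpOn Ω 1) (χ : ℝ → SpaceH Ω) (ξ : ℝ → DualV Ω) (u p : ℝ → SpaceH Ω) : Prop :=
  ∃ (q q' : ℝ≥0∞) (_ : Fact (1 ≤ q)) (_ : Fact (1 ≤ q'))
    (E Θ : ℝ → W1p Ω q) (E' dE : ℝ → StrongDual ℝ (W1p Ω q'))
    (X : ℝ → SpaceV Ω) (χc dχ : ℝ → SpaceH Ω) (Λ : ℝ → DualV Ω) (P : ℝ → SpaceV Ω),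
    IsWeakSolutionWith μ γ h e₀ χ₀ u₀ T e θ χ ξ u p q q' E Θ E' dE X χc dχ Λ P

end

/-!
The decay is an energy estimate in `V'` for the equation `u' + A_γ p = 0`. All that it uses about `p`
is `p ≥ u ≥ 0`: finiteness of `J(χ)` forces `0 ≤ χ ≤ 1`, so that `p = u (1 + χ) ≥ u`.

*The energy estimate.* By Lax–Milgram let `w₀ ∈ V` solve `A_γ w₀ = u₀`. For almost every `t` the
equation `u + A_γ (1 * p) = u₀` says that `u(t) = A_γ W(t)` with `W(t) = w₀ - (1 * p)(t)`. The
energy `y(t) = ⟨A_γ W(t), W(t)⟩` is equivalent to `‖u(t)‖²_{V'}`, and for such times `s ≤ t`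
`y(s) - y(t) = (u(s), ∫_s^t p) + (u(t), ∫_s^t p)` with both terms nonnegative. Hence the energy is
nonincreasing, and it controls the increments of `W`, because
`⟨A_γ (W(s) - W(t)), W(s) - W(t)⟩ ≤ y(s) - y(t)`. As `y` has no jumps at positive times, and the
limit of `W` at time `0` can be identified in `H`, `W` extends to a continuous function on `[0, ∞)`
(`exists_continuous_extension`). Moreover `y(s) - y(t) ≥ (u(s), ∫_s^t p)`, so that almost everywhere
`-y' ≥ (u, p) ≥ ‖u‖²_H`; since a monotone function decreases at least by the integral of its
derivative, `∫_s^t ‖u‖²_H ≤ y(s) - y(t)` (`integral_norm_sq_le`). This bounds `u` in `L²(0, ∞; H)`,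
and with `y ≤ K ‖u‖²_H` it gives `y(t + 1) ≤ K / (1 + K) y(t)`, hence exponential decay.

*Coercivity of `A_γ`.* The form `∫_Ω ∇v · ∇w + γ ∫_Γ v w` has to be bounded and coercive on `V`:
`v ↦ (‖∇v‖² + ‖v|_Γ‖²)^{1/2}` is an equivalent norm. For functions smooth on `ℝ^N` the two estimates
follow from the fundamental theorem of calculus along segments parallel to a coordinate axis. The
Friedrichs inequality (`friedrichs_lintegral`) compares `v(x)`, `x ∈ Ω`, with a boundary value on
the same line, and integrates over the lines; projection along the axis does not increase the
`(N - 1)`-dimensional Hausdorff measure. The trace inequality (`trace_lintegral_le`) compares the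
value at a boundary point with those on a segment entering `Ω`; locally `Γ` is a Lipschitz graph
over a coordinate hyperplane, so that its surface measure is controlled by the Lebesgue measure of
the projection. Restrictions of smooth functions are dense in `H¹(Ω)`, by a partition of unity, a
translation into `Ω`, and mollification (`IsBoundedSmoothOpen.isSmoothLimit`). Therefore traces
exist and are unique, and both inequalities hold on `V` (`isCoercive_robinL`).
-/

noncomputable section

/-! ### Slices of Euclidean space and Hausdorff measure of projections -/

/-- The point of `ℝ^(n+1)` whose `i`-th coordinate is `t` and whose other coordinates form `y`. -/
def insertCoord {n : ℕ} (i : Fin (n + 1)) (t : ℝ) (y : Eucl n) : Eucl (n + 1) :=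
  WithLp.toLp 2 (i.insertNth (α := fun _ => ℝ) t y.ofLp)

/-- The projection `ℝ^(n+1) → ℝ^n` that drops the `i`-th coordinate. -/
def dropCoord {n : ℕ} (i : Fin (n + 1)) (x : Eucl (n + 1)) : Eucl n :=
  WithLp.toLp 2 fun j => x (i.succAbove j)

@[simp] lemma insertCoord_same {n : ℕ} (i : Fin (n + 1)) (t : ℝ) (y : Eucl n) :
    insertCoord i t y i = t := by simp [insertCoord]

@[simp] lemma insertCoord_succAbove {n : ℕ} (i : Fin (n + 1)) (t : ℝ) (y : Eucl n) (j : Fin n) :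
    insertCoord i t y (i.succAbove j) = y j := by simp [insertCoord]

@[simp] lemma dropCoord_apply {n : ℕ} (i : Fin (n + 1)) (x : Eucl (n + 1)) (j : Fin n) :
    dropCoord i x j = x (i.succAbove j) := rfl

@[simp] lemma dropCoord_insertCoord {n : ℕ} (i : Fin (n + 1)) (t : ℝ) (y : Eucl n) :
    dropCoord i (insertCoord i t y) = y := by
  ext j; simp

@[simp] lemma insertCoord_dropCoord {n : ℕ} (i : Fin (n + 1)) (x : Eucl (n + 1)) :
    insertCoord i (x i) (dropCoord i x) = x := by
  ext j
  rcases Fin.eq_self_or_eq_succAbove i j with rfl | ⟨k, rfl⟩ <;> simp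

lemma insertCoord_eq_add {n : ℕ} (i : Fin (n + 1)) (s t : ℝ) (y : Eucl n) :
    insertCoord i t y = insertCoord i s y + (t - s) • EuclideanSpace.single i (1 : ℝ) := by
  ext j
  rcases Fin.eq_self_or_eq_succAbove i j with rfl | ⟨k, rfl⟩ <;> simp

lemma measurePreserving_insertCoord {n : ℕ} (i : Fin (n + 1)) :
    MeasurePreserving (fun z : ℝ × Eucl n => insertCoord i z.1 z.2)
      ((volume : Measure ℝ).prod (volume : Measure (Eucl n))) volume :=
  ((PiLp.volume_preserving_toLp (Fin (n + 1))).comp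
    (volume_preserving_piFinSuccAbove (fun _ : Fin (n + 1) => ℝ) i).symm).comp
    ((MeasurePreserving.id volume).prod (PiLp.volume_preserving_ofLp (Fin n)))

lemma lintegral_slice {n : ℕ} (i : Fin (n + 1)) {F : Eucl (n + 1) → ℝ≥0∞} (hF : Measurable F) :
    ∫⁻ x, F x = ∫⁻ y : Eucl n, ∫⁻ t : ℝ, F (insertCoord i t y) := by
  rw [← (measurePreserving_insertCoord i).lintegral_comp hF, lintegral_prod_symm]
  exact (hF.comp (measurePreserving_insertCoord i).measurable).aemeasurable

lemma measurable_lintegral_slice {n : ℕ} (i : Fin (n + 1)) {F : Eucl (n + 1) → ℝ≥0∞}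
    (hF : Measurable F) : Measurable fun y : Eucl n => ∫⁻ t : ℝ, F (insertCoord i t y) :=
  Measurable.lintegral_prod_left' (f := fun z : ℝ × Eucl n => F (insertCoord i z.1 z.2))
    (hF.comp (measurePreserving_insertCoord i).measurable)

lemma norm_sq_eq_add_dropCoord {n : ℕ} (i : Fin (n + 1)) (x : Eucl (n + 1)) :
    ‖x‖ ^ 2 = |x i| ^ 2 + ‖dropCoord i x‖ ^ 2 := by
  simp [EuclideanSpace.norm_sq_eq, Fin.sum_univ_succAbove _ i]

lemma dropCoord_sub {n : ℕ} (i : Fin (n + 1)) (x y : Eucl (n + 1)) :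
    dropCoord i (x - y) = dropCoord i x - dropCoord i y := by
  ext j; simp

lemma norm_dropCoord_le {n : ℕ} (i : Fin (n + 1)) (x : Eucl (n + 1)) :
    ‖dropCoord i x‖ ≤ ‖x‖ := by
  have := norm_sq_eq_add_dropCoord i x
  nlinarith [norm_nonneg x, norm_nonneg (dropCoord i x), sq_nonneg |x i|]

lemma norm_le_add_dropCoord {n : ℕ} (i : Fin (n + 1)) (x : Eucl (n + 1)) :
    ‖x‖ ≤ |x i| + ‖dropCoord i x‖ := by
  have := norm_sq_eq_add_dropCoord i x
  nlinarith [norm_nonneg x, norm_nonneg (dropCoord i x), abs_nonneg (x i)]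

lemma lipschitzWith_dropCoord {n : ℕ} (i : Fin (n + 1)) :
    LipschitzWith 1 (dropCoord i : Eucl (n + 1) → Eucl n) :=
  LipschitzWith.of_dist_le_mul fun x y => by
    rw [dist_eq_norm, dist_eq_norm, ← dropCoord_sub]
    simpa using norm_dropCoord_le i (x - y)

lemma volume_dropCoord_image_le {n : ℕ} (i : Fin (n + 1)) (s : Set (Eucl (n + 1))) :
    volume (dropCoord i '' s) ≤ Measure.euclideanHausdorffMeasure n s := by
  rw [← EuclideanSpace.euclideanHausdorffMeasure_eq_volume,
    Measure.euclideanHausdorffMeasure_def, Measure.euclideanHausdorffMeasure_def,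
    Measure.smul_apply, Measure.smul_apply]
  have := (lipschitzWith_dropCoord i).hausdorffMeasure_image_le (d := (n : ℝ)) (by positivity) s
  simp only [ENNReal.coe_one, ENNReal.one_rpow, one_mul] at this
  gcongr

lemma euclideanHausdorffMeasure_le_of_antilipschitz {n : ℕ} (i : Fin (n + 1))
    {A : Set (Eucl (n + 1))} {K : NNReal}
    (hA : ∀ x ∈ A, ∀ y ∈ A, ‖x - y‖ ≤ K * ‖dropCoord i x - dropCoord i y‖) :
    Measure.euclideanHausdorffMeasure n A ≤ (K : ℝ≥0∞) ^ (n : ℝ) * volume (dropCoord i '' A) := by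
  have hinj : InjOn (dropCoord i) A := by
    intro x hx y hy hxy
    have := hA x hx y hy
    rw [hxy, sub_self, norm_zero, mul_zero] at this
    exact sub_eq_zero.1 (norm_le_zero_iff.1 this)
  have hg : LipschitzOnWith K (Function.invFunOn (dropCoord i) A) (dropCoord i '' A) := by
    refine LipschitzOnWith.of_dist_le_mul ?_
    rintro _ ⟨x, hx, rfl⟩ _ ⟨y, hy, rfl⟩
    rw [hinj.leftInvOn_invFunOn hx, hinj.leftInvOn_invFunOn hy, dist_eq_norm, dist_eq_norm]
    exact hA x hx y hy
  have himg : Function.invFunOn (dropCoord i) A '' (dropCoord i '' A) = A :=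
    hinj.invFunOn_image Subset.rfl
  have := hg.hausdorffMeasure_image_le (d := (n : ℝ)) (by positivity)
  rw [himg] at this
  rw [← EuclideanSpace.euclideanHausdorffMeasure_eq_volume,
    Measure.euclideanHausdorffMeasure_def, Measure.euclideanHausdorffMeasure_def,
    Measure.smul_apply, Measure.smul_apply, mul_smul_comm]
  gcongr

/-- If the projection along the `i`-th axis is injective on `A` with a Lipschitz inverse, then the
surface measure of `A` is controlled by the Lebesgue measure of the projection. -/
lemma lintegral_comp_dropCoord_le {n : ℕ} (i : Fin (n + 1))
    {A : Set (Eucl (n + 1))} {K : NNReal}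
    (hA : ∀ x ∈ A, ∀ y ∈ A, ‖x - y‖ ≤ K * ‖dropCoord i x - dropCoord i y‖)
    {G : Eucl n → ℝ≥0∞} (hG : Measurable G) :
    ∫⁻ x in A, G (dropCoord i x) ∂(Measure.euclideanHausdorffMeasure n) ≤
      (K : ℝ≥0∞) ^ (n : ℝ) * ∫⁻ y, G y := by
  have hm : Measurable (dropCoord i : Eucl (n + 1) → Eucl n) :=
    (lipschitzWith_dropCoord i).continuous.measurable
  rw [← lintegral_map hG hm, ← smul_eq_mul, ← lintegral_smul_measure]
  refine lintegral_mono' ?_ le_rfl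
  refine Measure.le_iff.2 fun T hT => ?_
  rw [Measure.map_apply hm hT, Measure.restrict_apply (hm hT), Measure.smul_apply, smul_eq_mul]
  refine (euclideanHausdorffMeasure_le_of_antilipschitz i (K := K) fun x hx y hy =>
    hA x hx.2 y hy.2).trans ?_
  gcongr
  rintro _ ⟨x, hx, rfl⟩
  exact hx.1

/-! ### One-dimensional estimates -/

lemma enorm_add_sq_le {E : Type*} [SeminormedAddGroup E] (a b : E) :
    ‖a + b‖ₑ ^ 2 ≤ 2 * (‖a‖ₑ ^ 2 + ‖b‖ₑ ^ 2) := by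
  have h1 : ‖a + b‖ ^ 2 ≤ 2 * (‖a‖ ^ 2 + ‖b‖ ^ 2) := by
    have := norm_add_le a b
    nlinarith [norm_nonneg (a + b), norm_nonneg a, norm_nonneg b, sq_nonneg (‖a‖ - ‖b‖)]
  have h2 := ENNReal.ofReal_le_ofReal h1
  rw [ENNReal.ofReal_mul (by positivity), ENNReal.ofReal_add (by positivity) (by positivity),
    ENNReal.ofReal_pow (norm_nonneg _), ENNReal.ofReal_pow (norm_nonneg _),
    ENNReal.ofReal_pow (norm_nonneg _)] at h2
  simpa using h2

lemma lintegral_sq_le {α : Type*} [MeasurableSpace α] {μ : Measure α} {f : α → ℝ≥0∞}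
    (hf : AEMeasurable f μ) : (∫⁻ x, f x ∂μ) ^ 2 ≤ μ univ * ∫⁻ x, f x ^ 2 ∂μ := by
  have h := ENNReal.lintegral_mul_le_Lp_mul_Lq μ Real.HolderConjugate.two_two hf
    (g := fun _ => 1) aemeasurable_const
  simp only [Pi.mul_apply, mul_one, ENNReal.one_rpow, lintegral_const, one_mul] at h
  calc (∫⁻ x, f x ∂μ) ^ 2
      ≤ ((∫⁻ a, f a ^ (2 : ℝ) ∂μ) ^ (1 / 2 : ℝ) * μ univ ^ (1 / 2 : ℝ)) ^ 2 := by gcongr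
    _ = μ univ * ∫⁻ x, f x ^ 2 ∂μ := by
        rw [mul_pow, ← ENNReal.rpow_natCast, ← ENNReal.rpow_natCast, ← ENNReal.rpow_mul,
          ← ENNReal.rpow_mul]
        norm_num
        rw [mul_comm]

lemma enorm_sub_sq_le_lintegral {f : ℝ → ℝ} (hf : ContDiff ℝ 1 f) {a b : ℝ} (hab : a ≤ b) :
    ‖f b - f a‖ₑ ^ 2 ≤ ENNReal.ofReal (b - a) * ∫⁻ t in Ioc a b, ‖deriv f t‖ₑ ^ 2 := by
  have hd : Continuous (deriv f) := hf.continuous_deriv le_rfl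
  rw [← intervalIntegral.integral_deriv_eq_sub (fun x _ => (hf.differentiable one_ne_zero) x)
    (hd.intervalIntegrable a b), intervalIntegral.integral_of_le hab]
  calc ‖∫ t in Ioc a b, deriv f t‖ₑ ^ 2 ≤ (∫⁻ t in Ioc a b, ‖deriv f t‖ₑ) ^ 2 := by
        gcongr; exact enorm_integral_le_lintegral_enorm _
    _ ≤ _ := by
        have := lintegral_sq_le (μ := volume.restrict (Ioc a b)) (f := fun t => ‖deriv f t‖ₑ)
          hd.enorm.measurable.aemeasurable
        simpa [Real.volume_Ioc] using this

lemma hasDerivAt_insertCoord {n : ℕ} (i : Fin (n + 1)) (t : ℝ) (y : Eucl n) :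
    HasDerivAt (fun s => insertCoord i s y) (EuclideanSpace.single i (1 : ℝ)) t := by
  have h : (fun s => insertCoord i s y) =
      fun s => insertCoord i 0 y + s • EuclideanSpace.single i (1 : ℝ) := by
    funext s
    rw [insertCoord_eq_add i 0 s y, sub_zero]
  rw [h]
  simpa using ((hasDerivAt_id t).smul_const (EuclideanSpace.single i (1 : ℝ))).const_add
    (insertCoord i 0 y)

lemma contDiff_insertCoord {n : ℕ} (i : Fin (n + 1)) (y : Eucl n) :
    ContDiff ℝ ∞ (fun s => insertCoord i s y) := by
  have h : (fun s => insertCoord i s y) =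
      fun s => insertCoord i 0 y + s • EuclideanSpace.single i (1 : ℝ) := by
    funext s
    rw [insertCoord_eq_add i 0 s y, sub_zero]
  rw [h]
  fun_prop

lemma norm_gradient {N : ℕ} (φ : Eucl N → ℝ) (x : Eucl N) :
    ‖gradient φ x‖ = ‖fderiv ℝ φ x‖ := by
  simp [gradient]

lemma continuous_gradient {N : ℕ} {φ : Eucl N → ℝ} (hφ : ContDiff ℝ ∞ φ) :
    Continuous (gradient φ) :=
  (InnerProductSpace.toDual ℝ (Eucl N)).symm.continuous.comp (hφ.continuous_fderiv (by simp))

lemma enorm_deriv_slice_le {n : ℕ} {φ : Eucl (n + 1) → ℝ} (hφ : ContDiff ℝ ∞ φ)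
    (i : Fin (n + 1)) (t : ℝ) (y : Eucl n) :
    ‖deriv (fun s => φ (insertCoord i s y)) t‖ₑ ≤ ‖gradient φ (insertCoord i t y)‖ₑ := by
  have h1 : HasDerivAt (fun s => φ (insertCoord i s y))
      (fderiv ℝ φ (insertCoord i t y) (EuclideanSpace.single i (1 : ℝ))) t :=
    ((hφ.differentiable (by simp)) _).hasFDerivAt.comp_hasDerivAt t (hasDerivAt_insertCoord i t y)
  rw [h1.deriv, enorm_le_iff_norm_le, norm_gradient]
  refine (ContinuousLinearMap.le_opNorm _ _).trans ?_
  simp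

lemma enorm_slice_sub_sq_le {n : ℕ} {φ : Eucl (n + 1) → ℝ} (hφ : ContDiff ℝ ∞ φ)
    (i : Fin (n + 1)) (y : Eucl n) (a b : ℝ) :
    ‖φ (insertCoord i b y) - φ (insertCoord i a y)‖ₑ ^ 2 ≤
      ENNReal.ofReal |b - a| * ∫⁻ t in uIoo a b, ‖gradient φ (insertCoord i t y)‖ₑ ^ 2 := by
  have hf : ContDiff ℝ 1 (fun s => φ (insertCoord i s y)) :=
    (hφ.comp (contDiff_insertCoord i y)).of_le (by simp)
  wlog hab : a ≤ b generalizing a b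
  · have := this b a (le_of_not_ge hab)
    rwa [uIoo_comm, abs_sub_comm, ← neg_sub, enorm_neg] at this
  refine (enorm_sub_sq_le_lintegral hf hab).trans ?_
  rw [abs_of_nonneg (sub_nonneg.2 hab), uIoo_of_le hab, restrict_Ioo_eq_restrict_Ioc]
  gcongr with t
  exact enorm_deriv_slice_le hφ i t y

/-! ### The Friedrichs inequality -/

/-- The supremum of a function over the fibres of a coordinate projection has smaller integral than
the function itself over the surface, since superlevel sets of the supremum are projections of
superlevel sets of the function. -/
lemma lintegral_sSup_fiber_le {n : ℕ} (i : Fin (n + 1)) {Γ : Set (Eucl (n + 1))}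
    (hΓ : IsCompact Γ) {g : Eucl (n + 1) → ℝ} (hg : Continuous g) (hg0 : ∀ x, 0 ≤ g x) :
    Measurable (fun y => sSup (g '' (Γ ∩ dropCoord i ⁻¹' {y}))) ∧
    ∫⁻ y, ENNReal.ofReal (sSup (g '' (Γ ∩ dropCoord i ⁻¹' {y}))) ≤
      ∫⁻ x in Γ, ENNReal.ofReal (g x) ∂(Measure.euclideanHausdorffMeasure n) := by
  set M : Eucl n → ℝ := fun y => sSup (g '' (Γ ∩ dropCoord i ⁻¹' {y})) with hM
  have hcont : Continuous (dropCoord i : Eucl (n + 1) → Eucl n) :=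
    (lipschitzWith_dropCoord i).continuous
  have hM0 : ∀ y, 0 ≤ M y := fun y => Real.sSup_nonneg (by rintro _ ⟨x, _, rfl⟩; exact hg0 x)
  have hlt : ∀ t : ℝ, 0 ≤ t → {y | t < M y} = dropCoord i '' (Γ ∩ {x | t < g x}) := by
    intro t ht
    ext y
    constructor
    · intro hy
      have hne : (g '' (Γ ∩ dropCoord i ⁻¹' {y})).Nonempty := by
        by_contra hne
        rw [not_nonempty_iff_eq_empty] at hne
        have : M y = 0 := by simp only [hM, hne, Real.sSup_empty]
        have hy' : t < M y := hy
        linarith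
      obtain ⟨_, ⟨x, hx, rfl⟩, hlt⟩ := exists_lt_of_lt_csSup hne hy
      exact ⟨x, ⟨hx.1, hlt⟩, hx.2⟩
    · rintro ⟨x, ⟨hx, hxt⟩, rfl⟩
      refine lt_of_lt_of_le (show t < g x from hxt) (le_csSup ?_ ⟨x, ⟨hx, rfl⟩, rfl⟩)
      exact (hΓ.bddAbove_image hg.continuousOn).mono (image_mono inter_subset_left)
  have hmeas : ∀ t : ℝ, MeasurableSet (dropCoord i '' (Γ ∩ {x | t < g x})) := by
    intro t
    have : dropCoord i '' (Γ ∩ {x | t < g x}) =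
        ⋃ k : ℕ, dropCoord i '' (Γ ∩ {x | t + 1 / ((k : ℝ) + 1) ≤ g x}) := by
      rw [← image_iUnion, ← inter_iUnion]
      congr 2
      ext x
      simp only [mem_ofPred_eq, mem_iUnion]
      constructor
      · intro h
        obtain ⟨k, hk⟩ := exists_nat_one_div_lt (sub_pos.2 h)
        exact ⟨k, by linarith⟩
      · rintro ⟨k, hk⟩
        have : (0 : ℝ) < 1 / ((k : ℝ) + 1) := Nat.one_div_pos_of_nat
        linarith
    rw [this]
    refine MeasurableSet.iUnion fun k => IsCompact.measurableSet ?_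
    exact (hΓ.inter_right (isClosed_le continuous_const hg)).image hcont
  have hMm : Measurable M := by
    refine measurable_of_Ioi fun t => ?_
    rcases lt_or_ge t 0 with ht | ht
    · have : M ⁻¹' Ioi t = univ := eq_univ_of_forall fun y => ht.trans_le (hM0 y)
      rw [this]; exact MeasurableSet.univ
    · have : M ⁻¹' Ioi t = {y | t < M y} := rfl
      rw [this, hlt t ht]; exact hmeas t
  refine ⟨hMm, ?_⟩
  rw [lintegral_eq_lintegral_meas_lt _ (ae_of_all _ hM0) hMm.aemeasurable,
    lintegral_eq_lintegral_meas_lt _ (ae_of_all _ hg0) hg.measurable.aemeasurable]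
  refine setLIntegral_mono_ae' measurableSet_Ioi (ae_of_all _ fun t ht => ?_)
  rw [hlt t (le_of_lt ht)]
  refine (volume_dropCoord_image_le i _).trans ?_
  rw [Measure.restrict_apply (measurableSet_lt measurable_const hg.measurable), inter_comm]

/-- The value at a point of `Ω` is controlled by the value at a boundary point on the same line
and the gradient along the segment between them. -/
lemma exists_frontier_enorm_sq_le {n : ℕ} {Ω : Set (Eucl (n + 1))} (hΩ : IsOpen Ω) {R : ℝ}
    (hR : Ω ⊆ Metric.ball 0 R) {φ : Eucl (n + 1) → ℝ} (hφ : ContDiff ℝ ∞ φ) (i : Fin (n + 1))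
    (y : Eucl n) (t : ℝ) (ht : insertCoord i t y ∈ Ω) :
    ∃ b, insertCoord i b y ∈ frontier Ω ∧
      ‖φ (insertCoord i t y)‖ₑ ^ 2 ≤ 2 * (‖φ (insertCoord i b y)‖ₑ ^ 2 +
        ENNReal.ofReal (2 * R) *
          ∫⁻ s, Ω.indicator (fun x => ‖gradient φ x‖ₑ ^ 2) (insertCoord i s y)) := by
  have hc : Continuous fun s => insertCoord i s y := (contDiff_insertCoord i y).continuous
  have habs : ∀ s, insertCoord i s y ∈ Ω → |s| < R := by
    intro s hs
    have h1 := hR hs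
    rw [mem_ball_zero_iff] at h1
    refine lt_of_le_of_lt ?_ h1
    have := EuclideanSpace.norm_sq_eq (insertCoord i s y)
    have h2 := PiLp.norm_apply_le (insertCoord i s y) i
    simpa using h2
  have htR := abs_lt.1 (habs t ht)
  set S : Set ℝ := Icc (-R) t ∩ {s | insertCoord i s y ∉ Ω} with hS
  have hSc : IsClosed S := isClosed_Icc.inter (hΩ.preimage hc).isClosed_compl
  have hne : S.Nonempty := ⟨-R, ⟨le_rfl, by linarith⟩, fun h => by
    have := habs _ h
    rw [abs_neg] at this
    exact (le_abs_self R).not_gt this⟩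
  have hbdd : BddAbove S := ⟨t, fun s hs => hs.1.2⟩
  have hb := hSc.csSup_mem hne hbdd
  set b := sSup S with hbdef
  have hbt : b < t := lt_of_le_of_ne hb.1.2 fun h => hb.2 (h ▸ ht)
  have hin : ∀ s ∈ Ioc b t, insertCoord i s y ∈ Ω := by
    intro s hs
    by_contra hns
    exact (le_csSup hbdd (show s ∈ S from ⟨⟨hb.1.1.trans hs.1.le, hs.2⟩, hns⟩)).not_gt hs.1
  refine ⟨b, ?_, ?_⟩
  · rw [hΩ.frontier_eq]
    refine ⟨?_, hb.2⟩
    have h1 : Tendsto (fun s => insertCoord i s y) (𝓝[>] b) (𝓝 (insertCoord i b y)) :=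
      (hc.tendsto b).mono_left nhdsWithin_le_nhds
    refine mem_closure_of_tendsto h1 ?_
    filter_upwards [Ioc_mem_nhdsGT hbt] with s hs using hin s hs
  · have h1 := enorm_add_sq_le (φ (insertCoord i b y))
      (φ (insertCoord i t y) - φ (insertCoord i b y))
    rw [add_sub_cancel] at h1
    refine h1.trans ?_
    gcongr
    refine (enorm_slice_sub_sq_le hφ i y b t).trans ?_
    have hb1 := hb.1.1
    refine mul_le_mul' (ENNReal.ofReal_le_ofReal ?_) ?_
    · rw [abs_of_pos (sub_pos.2 hbt)]; linarith
    · rw [uIoo_of_le hbt.le, ← lintegral_indicator measurableSet_Ioo]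
      refine lintegral_mono fun s => ?_
      by_cases hs : s ∈ Ioo b t
      · rw [indicator_of_mem hs, indicator_of_mem (hin s ⟨hs.1, hs.2.le⟩)]
      · rw [indicator_of_notMem hs]; exact zero_le

/-- The Friedrichs inequality for smooth functions. It needs no regularity of the boundary: every
line parallel to the first axis that meets `Ω` leaves it through `frontier Ω`. -/
lemma friedrichs_lintegral {n : ℕ} {Ω : Set (Eucl (n + 1))} (hΩ : IsOpen Ω)
    (hb : Bornology.IsBounded Ω) :
    ∃ C : ℝ≥0∞, C ≠ ⊤ ∧ ∀ φ : Eucl (n + 1) → ℝ, ContDiff ℝ ∞ φ →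
      ∫⁻ x in Ω, ‖φ x‖ₑ ^ 2 ≤ C * ((∫⁻ x in Ω, ‖gradient φ x‖ₑ ^ 2) +
        ∫⁻ x, ‖φ x‖ₑ ^ 2 ∂(surfaceMeasure Ω)) := by
  obtain ⟨R, hR⟩ := hb.subset_ball 0
  set A : ℝ≥0∞ := ENNReal.ofReal (2 * R) with hA
  refine ⟨A * 2 * (1 + A), by finiteness, fun φ hφ => ?_⟩
  let i : Fin (n + 1) := 0
  have hΓ : IsCompact (frontier Ω) :=
    Metric.isCompact_of_isClosed_isBounded isClosed_frontier
      (hb.closure.subset frontier_subset_closure)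
  have hgc : Continuous fun x => ‖gradient φ x‖ₑ ^ 2 :=
    (ENNReal.continuous_pow 2).comp (continuous_gradient hφ).enorm
  have hfc : Continuous fun x => ‖φ x‖ₑ ^ 2 :=
    (ENNReal.continuous_pow 2).comp hφ.continuous.enorm
  obtain ⟨hMm, hMle⟩ := lintegral_sSup_fiber_le i hΓ (g := fun x => ‖φ x‖ ^ 2)
    (by have := hφ.continuous; fun_prop) (fun x => by positivity)
  set M : Eucl n → ℝ := fun y => sSup ((fun x => ‖φ x‖ ^ 2) '' (frontier Ω ∩ dropCoord i ⁻¹' {y}))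
  set D : Eucl n → ℝ≥0∞ :=
    fun y => ∫⁻ s, Ω.indicator (fun x => ‖gradient φ x‖ₑ ^ 2) (insertCoord i s y) with hD
  have hDm : Measurable D :=
    measurable_lintegral_slice i (hgc.measurable.indicator hΩ.measurableSet)
  have hDint : ∫⁻ y, D y = ∫⁻ x in Ω, ‖gradient φ x‖ₑ ^ 2 := by
    rw [← lintegral_indicator hΩ.measurableSet,
      lintegral_slice i (hgc.measurable.indicator hΩ.measurableSet)]
  have hMint : ∫⁻ y, ENNReal.ofReal (M y) ≤ ∫⁻ x, ‖φ x‖ₑ ^ 2 ∂(surfaceMeasure Ω) := by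
    refine hMle.trans (le_of_eq ?_)
    refine lintegral_congr fun x => ?_
    rw [ENNReal.ofReal_pow (norm_nonneg _), ofReal_norm]
  have hpt : ∀ y t, Ω.indicator (fun x => ‖φ x‖ₑ ^ 2) (insertCoord i t y) ≤
      (Ioo (-R) R).indicator (fun _ => 2 * (ENNReal.ofReal (M y) + A * D y)) t := by
    intro y t
    by_cases ht : insertCoord i t y ∈ Ω
    · have htR : t ∈ Ioo (-R) R := by
        have h1 := hR ht
        rw [mem_ball_zero_iff] at h1
        have h2 := PiLp.norm_apply_le (insertCoord i t y) i
        rw [insertCoord_same] at h2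
        exact abs_lt.1 (h2.trans_lt h1)
      rw [indicator_of_mem ht, indicator_of_mem htR]
      obtain ⟨b, hbf, hle⟩ := exists_frontier_enorm_sq_le hΩ hR hφ i y t ht
      refine hle.trans ?_
      gcongr
      rw [← ofReal_norm, ← ENNReal.ofReal_pow (norm_nonneg _)]
      refine ENNReal.ofReal_le_ofReal (le_csSup ?_ ⟨_, ⟨hbf, by simp⟩, rfl⟩)
      refine (hΓ.bddAbove_image (f := fun x => ‖φ x‖ ^ 2) ?_).mono (image_mono inter_subset_left)
      have := hφ.continuous
      fun_prop
    · rw [indicator_of_notMem ht]; exact zero_le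
  calc ∫⁻ x in Ω, ‖φ x‖ₑ ^ 2
      = ∫⁻ y, ∫⁻ t, Ω.indicator (fun x => ‖φ x‖ₑ ^ 2) (insertCoord i t y) := by
        rw [← lintegral_indicator hΩ.measurableSet,
          lintegral_slice i (hfc.measurable.indicator hΩ.measurableSet)]
    _ ≤ ∫⁻ y, A * (2 * (ENNReal.ofReal (M y) + A * D y)) := by
        refine lintegral_mono fun y => (lintegral_mono (hpt y)).trans (le_of_eq ?_)
        rw [lintegral_indicator measurableSet_Ioo, setLIntegral_const, Real.volume_Ioo, mul_comm, hA]
        congr 2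
        ring
    _ = A * (2 * ((∫⁻ y, ENNReal.ofReal (M y)) + A * ∫⁻ y, D y)) := by
        rw [lintegral_const_mul _ (by fun_prop), lintegral_const_mul _ (by fun_prop),
          lintegral_add_left (by fun_prop), lintegral_const_mul _ hDm]
    _ ≤ A * 2 * (1 + A) * ((∫⁻ x in Ω, ‖gradient φ x‖ₑ ^ 2) +
          ∫⁻ x, ‖φ x‖ₑ ^ 2 ∂(surfaceMeasure Ω)) := by
        rw [hDint, mul_assoc A 2, mul_assoc A, mul_assoc 2]
        gcongr
        calc _ ≤ (∫⁻ x, ‖φ x‖ₑ ^ 2 ∂(surfaceMeasure Ω)) + A * ∫⁻ x in Ω, ‖gradient φ x‖ₑ ^ 2 := by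
              gcongr
          _ ≤ _ := by
              rw [add_mul, one_mul, mul_add]
              generalize ∫⁻ x in Ω, ‖gradient φ x‖ₑ ^ 2 = a
              generalize ∫⁻ x, ‖φ x‖ₑ ^ 2 ∂(surfaceMeasure Ω) = c
              calc c + A * a ≤ (c + A * a) + (a + A * c) := le_self_add
                _ = a + c + (A * a + A * c) := by ring

/-! ### The boundary in local coordinates -/

/-- Near a boundary point, some coordinate direction points into `Ω`, uniformly, and the boundary
is a Lipschitz graph over the orthogonal hyperplane. -/
lemma IsBoundedSmoothOpen.exists_chart {n : ℕ} {Ω : Set (Eucl (n + 1))}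
    (hΩ : IsBoundedSmoothOpen Ω) {x₀ : Eucl (n + 1)} (hx₀ : x₀ ∈ frontier Ω) :
    ∃ (i : Fin (n + 1)) (c r : ℝ) (K : NNReal), (c = 1 ∨ c = -1) ∧ 0 < r ∧
      (∀ x ∈ closure Ω ∩ Metric.ball x₀ r, ∀ s ∈ Ioo 0 r,
        x - (s * c) • EuclideanSpace.single i (1 : ℝ) ∈ Ω) ∧
      ∀ x ∈ frontier Ω ∩ Metric.ball x₀ r, ∀ y ∈ frontier Ω ∩ Metric.ball x₀ r,
        ‖x - y‖ ≤ K * ‖dropCoord i x - dropCoord i y‖ := by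
  obtain ⟨U, ρ, hU, hxU, hρ, hne, hUΩ⟩ := hΩ.smooth_boundary x₀ hx₀
  set D := fderiv ℝ ρ x₀ with hD
  obtain ⟨i, hi⟩ : ∃ i, D (EuclideanSpace.single i (1 : ℝ)) ≠ 0 := by
    by_contra hcon
    push Not at hcon
    refine hne x₀ hxU ?_
    ext v
    have hv : v = ∑ j, v j • EuclideanSpace.single j (1 : ℝ) := by
      ext k
      simp [Finset.sum_apply, Pi.single_apply]
    rw [hv, map_sum]
    simp only [map_smul]
    exact Finset.sum_eq_zero fun j _ => by rw [show fderiv ℝ ρ x₀ = D from rfl, hcon j, smul_zero]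
  set d := D (EuclideanSpace.single i (1 : ℝ)) with hd
  have hdpos : 0 < |d| := abs_pos.2 hi
  -- Near `x₀` the Lipschitz constant of `ρ - D` is at most half of the nonzero partial derivative
  -- `d`; both claims follow from this.
  have hstrict : HasStrictFDerivAt ρ D x₀ :=
    hρ.contDiffAt.hasStrictFDerivAt (by simp)
  have hev := (hasStrictFDerivAt_iff_isLittleO.1 hstrict).def (half_pos hdpos)
  rw [nhds_prod_eq] at hev
  obtain ⟨V, hV, hVs⟩ := eventually_prod_self_iff'.1 hev
  obtain ⟨r, hr, hrs⟩ := Metric.mem_nhds_iff.1 (inter_mem hV (hU.mem_nhds hxU))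
  have hest : ∀ x ∈ Metric.ball x₀ r, ∀ y ∈ Metric.ball x₀ r,
      |ρ x - ρ y - D (x - y)| ≤ |d| / 2 * ‖x - y‖ := fun x hx y hy => by
    simpa using hVs x (hrs hx).1 y (hrs hy).1
  have hmem : ∀ x ∈ Metric.ball x₀ r, (x ∈ Ω ↔ ρ x < 0) := fun x hx => by
    have hxU := (hrs hx).2
    have : x ∈ Ω ∩ U ↔ x ∈ {y | ρ y < 0} ∩ U := by rw [hUΩ]
    simpa [hxU] using this
  have hcl : ∀ x ∈ closure Ω ∩ Metric.ball x₀ r, ρ x ≤ 0 := by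
    rintro x ⟨hx, hxr⟩
    have h1 : x ∈ closure (Ω ∩ Metric.ball x₀ r) :=
      Metric.isOpen_ball.closure_inter ⟨hx, hxr⟩
    exact closure_minimal (fun z hz => ((hmem z hz.2).1 hz.1).le)
      (isClosed_le hρ.continuous continuous_const) h1
  have hfr : ∀ x ∈ frontier Ω ∩ Metric.ball x₀ r, ρ x = 0 := by
    rintro x ⟨hx, hxr⟩
    refine le_antisymm (hcl x ⟨frontier_subset_closure hx, hxr⟩) ?_
    by_contra hlt
    rw [hΩ.isOpen.frontier_eq] at hx
    exact hx.2 ((hmem x hxr).2 (not_le.1 hlt))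
  obtain ⟨c, hc, hcd⟩ : ∃ c : ℝ, (c = 1 ∨ c = -1) ∧ c * d = |d| := by
    rcases abs_choice d with h | h
    · exact ⟨1, Or.inl rfl, by rw [h, one_mul]⟩
    · exact ⟨-1, Or.inr rfl, by rw [h]; ring⟩
  have hc1 : |c| = 1 := by rcases hc with rfl | rfl <;> simp
  set K : NNReal := ⟨2 * ‖D‖ / |d| + 2, by positivity⟩ with hK
  refine ⟨i, c, r / 2, K, hc, half_pos hr, ?_, ?_⟩
  · rintro x ⟨hx, hxr⟩ s hs
    rw [Metric.mem_ball] at hxr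
    have hxr' : x ∈ Metric.ball x₀ r := by rw [Metric.mem_ball]; linarith
    have hnorm : ‖(s * c) • EuclideanSpace.single i (1 : ℝ)‖ = s := by
      rw [norm_smul, Real.norm_eq_abs, abs_mul, hc1, abs_of_pos hs.1]; simp
    have hzr : x - (s * c) • EuclideanSpace.single i (1 : ℝ) ∈ Metric.ball x₀ r := by
      rw [Metric.mem_ball]
      have h1 : dist (x - (s * c) • EuclideanSpace.single i (1 : ℝ)) x = s := by
        rw [dist_eq_norm, sub_sub_cancel_left, norm_neg, hnorm]
      have h2 := dist_triangle (x - (s * c) • EuclideanSpace.single i (1 : ℝ)) x x₀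
      have := hs.2
      linarith
    rw [hmem _ hzr]
    have h1 := hest _ hzr x hxr'
    rw [sub_sub_cancel_left, norm_neg, hnorm, map_neg, map_smul, ← hd, smul_eq_mul, mul_assoc,
      hcd] at h1
    have h2 := hcl x ⟨hx, hxr'⟩
    have h3 := (abs_le.1 h1).2
    nlinarith [mul_pos hs.1 hdpos]
  · rintro x ⟨hx, hxr⟩ y ⟨hy, hyr⟩
    have hsub := Metric.ball_subset_ball (x := x₀) (half_le_self hr.le)
    have h1 := hest x (hsub hxr) y (hsub hyr)
    rw [hfr x ⟨hx, hsub hxr⟩, hfr y ⟨hy, hsub hyr⟩, sub_self, zero_sub, abs_neg] at h1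
    rw [← dropCoord_sub]
    set z := x - y with hz
    have hzdec : z = insertCoord i 0 (dropCoord i z) + z i • EuclideanSpace.single i (1 : ℝ) := by
      have := insertCoord_eq_add i 0 (z i) (dropCoord i z)
      rwa [insertCoord_dropCoord, sub_zero] at this
    have h2 : D z = D (insertCoord i 0 (dropCoord i z)) + z i * d := by
      conv_lhs => rw [hzdec]
      rw [map_add, map_smul, smul_eq_mul]
    have h3 : |D (insertCoord i 0 (dropCoord i z))| ≤ ‖D‖ * ‖dropCoord i z‖ := by
      have h4 := D.le_opNorm (insertCoord i 0 (dropCoord i z))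
      have h5 := norm_le_add_dropCoord i (insertCoord i 0 (dropCoord i z))
      rw [insertCoord_same, dropCoord_insertCoord, abs_zero, zero_add] at h5
      exact h4.trans (by gcongr)
    have h6 : |z i| * |d| ≤ |D z| + |D (insertCoord i 0 (dropCoord i z))| := by
      rw [← abs_mul, show z i * d = D z - D (insertCoord i 0 (dropCoord i z)) by rw [h2]; ring]
      exact abs_sub _ _
    have h7 := norm_le_add_dropCoord i z
    have hKv : (K : ℝ) = 2 * ‖D‖ / |d| + 2 := rfl
    have h8 : |z i| ≤ (2 * ‖D‖ / |d| + 1) * ‖dropCoord i z‖ := by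
      have h9 : |z i| * |d| ≤ |d| / 2 * (|z i| + ‖dropCoord i z‖) + ‖D‖ * ‖dropCoord i z‖ := by
        have : |d| / 2 * ‖z‖ ≤ |d| / 2 * (|z i| + ‖dropCoord i z‖) := by gcongr
        linarith
      have h10 : |z i| * |d| ≤ ((2 * ‖D‖ / |d| + 1) * ‖dropCoord i z‖) * |d| := by
        have : ((2 * ‖D‖ / |d| + 1) * ‖dropCoord i z‖) * |d| =
          2 * ‖D‖ * ‖dropCoord i z‖ + |d| * ‖dropCoord i z‖ := by
          field_simp
        rw [this]
        linarith
      exact le_of_mul_le_mul_right h10 hdpos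
    rw [hKv]
    linarith

/-! ### The trace inequality -/

/-- The trace inequality in one chart: the value at a boundary point is compared with the values on
the segment of length `r` that enters `Ω` from it, and averaged over the segment. -/
lemma lintegral_frontier_ball_le {n : ℕ} {Ω : Set (Eucl (n + 1))} (hΩ : IsOpen Ω)
    {x₀ : Eucl (n + 1)} {i : Fin (n + 1)} {c r : ℝ} {K : NNReal} (hc : c = 1 ∨ c = -1)
    (hin : ∀ x ∈ closure Ω ∩ Metric.ball x₀ r, ∀ s ∈ Ioo 0 r,
        x - (s * c) • EuclideanSpace.single i (1 : ℝ) ∈ Ω)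
    (hK : ∀ x ∈ frontier Ω ∩ Metric.ball x₀ r, ∀ y ∈ frontier Ω ∩ Metric.ball x₀ r,
        ‖x - y‖ ≤ K * ‖dropCoord i x - dropCoord i y‖)
    {φ : Eucl (n + 1) → ℝ} (hφ : ContDiff ℝ ∞ φ) :
    ENNReal.ofReal r * ∫⁻ x in Metric.ball x₀ r, ‖φ x‖ₑ ^ 2 ∂(surfaceMeasure Ω) ≤
      (K : ℝ≥0∞) ^ (n : ℝ) * (2 * ((∫⁻ x in Ω, ‖φ x‖ₑ ^ 2) +
        ENNReal.ofReal r * ENNReal.ofReal r * ∫⁻ x in Ω, ‖gradient φ x‖ₑ ^ 2)) := by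
  have hgc : Measurable (Ω.indicator fun x => ‖gradient φ x‖ₑ ^ 2) :=
    ((ENNReal.continuous_pow 2).comp (continuous_gradient hφ).enorm).measurable.indicator
      hΩ.measurableSet
  have hfc : Measurable (Ω.indicator fun x => ‖φ x‖ₑ ^ 2) :=
    ((ENNReal.continuous_pow 2).comp hφ.continuous.enorm).measurable.indicator hΩ.measurableSet
  set K0 : Eucl n → ℝ≥0∞ :=
    fun y => ∫⁻ s, Ω.indicator (fun x => ‖φ x‖ₑ ^ 2) (insertCoord i s y) with hK0
  set K1 : Eucl n → ℝ≥0∞ :=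
    fun y => ∫⁻ s, Ω.indicator (fun x => ‖gradient φ x‖ₑ ^ 2) (insertCoord i s y) with hK1
  have hK0m : Measurable K0 := measurable_lintegral_slice i hfc
  have hK1m : Measurable K1 := measurable_lintegral_slice i hgc
  have hpt : ∀ x ∈ frontier Ω ∩ Metric.ball x₀ r, ENNReal.ofReal r * ‖φ x‖ₑ ^ 2 ≤
      2 * (K0 (dropCoord i x) + ENNReal.ofReal r * ENNReal.ofReal r * K1 (dropCoord i x)) := by
    intro x hx
    set y := dropCoord i x with hy
    have hmem : ∀ s ∈ Ioo 0 r, insertCoord i (x i - s * c) y ∈ Ω := by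
      intro s hs
      have h1 := hin x ⟨frontier_subset_closure hx.1, hx.2⟩ s hs
      have h2 := insertCoord_eq_add i (x i) (x i - s * c) y
      rw [insertCoord_dropCoord, sub_sub_cancel_left, neg_smul, ← sub_eq_add_neg] at h2
      rwa [h2]
    have h1 : ∀ s ∈ Ioo 0 r, ‖φ x‖ₑ ^ 2 ≤
        2 * (Ω.indicator (fun x => ‖φ x‖ₑ ^ 2) (insertCoord i (x i - s * c) y) +
          ENNReal.ofReal r * K1 y) := by
      intro s hs
      have h2 := enorm_add_sq_le (φ (insertCoord i (x i - s * c) y))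
        (φ x - φ (insertCoord i (x i - s * c) y))
      rw [add_sub_cancel] at h2
      refine h2.trans ?_
      rw [indicator_of_mem (hmem s hs)]
      gcongr
      have h3 := enorm_slice_sub_sq_le hφ i y (x i - s * c) (x i)
      rw [insertCoord_dropCoord] at h3
      refine h3.trans ?_
      have hlen : |x i - (x i - s * c)| = s := by
        rw [sub_sub_cancel, abs_mul, abs_of_pos hs.1]
        rcases hc with rfl | rfl <;> simp
      rw [hlen]
      refine mul_le_mul' (ENNReal.ofReal_le_ofReal hs.2.le) ?_
      · rw [← lintegral_indicator (show MeasurableSet (uIoo _ _) from measurableSet_Ioo)]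
        refine lintegral_mono fun t => ?_
        by_cases ht : t ∈ uIoo (x i - s * c) (x i)
        · rw [indicator_of_mem ht]
          obtain ⟨s', hs', rfl⟩ : ∃ s' ∈ Ioo 0 r, t = x i - s' * c := by
            have hs1 := hs.1
            have hs2 := hs.2
            rcases hc with rfl | rfl
            · rw [uIoo_of_le (by linarith)] at ht
              exact ⟨x i - t, ⟨by linarith [ht.2], by linarith [ht.1]⟩, by ring⟩
            · rw [uIoo_of_ge (by linarith)] at ht
              exact ⟨t - x i, ⟨by linarith [ht.1], by linarith [ht.2]⟩, by ring⟩
          rw [indicator_of_mem (hmem s' hs')]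
        · rw [indicator_of_notMem ht]; exact zero_le
    have hcomp : ∫⁻ s, Ω.indicator (fun x => ‖φ x‖ₑ ^ 2) (insertCoord i (x i - s * c) y) = K0 y := by
      rcases hc with rfl | rfl
      · simp only [mul_one]
        exact lintegral_sub_left_eq_self
          (fun t => Ω.indicator (fun x => ‖φ x‖ₑ ^ 2) (insertCoord i t y)) (x i)
      · simp only [mul_neg, mul_one, sub_neg_eq_add]
        exact lintegral_add_left_eq_self
          (fun t => Ω.indicator (fun x => ‖φ x‖ₑ ^ 2) (insertCoord i t y)) (x i)
    have hmm : Measurable fun s => Ω.indicator (fun x => ‖φ x‖ₑ ^ 2)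
        (insertCoord i (x i - s * c) y) :=
      hfc.comp ((contDiff_insertCoord i y).continuous.comp (by fun_prop)).measurable
    calc ENNReal.ofReal r * ‖φ x‖ₑ ^ 2 = ∫⁻ s in Ioo 0 r, ‖φ x‖ₑ ^ 2 := by
          rw [setLIntegral_const, Real.volume_Ioo, sub_zero, mul_comm]
      _ ≤ ∫⁻ s in Ioo 0 r,
          2 * (Ω.indicator (fun x => ‖φ x‖ₑ ^ 2) (insertCoord i (x i - s * c) y) +
          ENNReal.ofReal r * K1 y) := setLIntegral_mono_ae' measurableSet_Ioo (ae_of_all _ h1)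
      _ = 2 * ((∫⁻ s in Ioo 0 r, Ω.indicator (fun x => ‖φ x‖ₑ ^ 2)
            (insertCoord i (x i - s * c) y)) + ENNReal.ofReal r * K1 y * ENNReal.ofReal r) := by
          rw [lintegral_const_mul _ (hmm.add_const _), lintegral_add_left hmm, setLIntegral_const,
            Real.volume_Ioo, sub_zero]
      _ ≤ 2 * (K0 y + ENNReal.ofReal r * K1 y * ENNReal.ofReal r) := by
          gcongr
          exact (setLIntegral_le_lintegral _ _).trans hcomp.le
      _ = _ := by ring_nf
  have hsurf : (surfaceMeasure Ω).restrict (Metric.ball x₀ r) =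
      (Measure.euclideanHausdorffMeasure n).restrict (frontier Ω ∩ Metric.ball x₀ r) := by
    rw [surfaceMeasure, Measure.restrict_restrict Metric.isOpen_ball.measurableSet, inter_comm]
    rfl
  rw [hsurf]
  calc ENNReal.ofReal r * ∫⁻ x in frontier Ω ∩ Metric.ball x₀ r, ‖φ x‖ₑ ^ 2
        ∂(Measure.euclideanHausdorffMeasure n)
      = ∫⁻ x in frontier Ω ∩ Metric.ball x₀ r, ENNReal.ofReal r * ‖φ x‖ₑ ^ 2
        ∂(Measure.euclideanHausdorffMeasure n) := by
        have hm : Measurable fun x => ‖φ x‖ₑ ^ 2 :=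
          ((ENNReal.continuous_pow 2).comp hφ.continuous.enorm).measurable
        rw [lintegral_const_mul _ hm]
    _ ≤ ∫⁻ x in frontier Ω ∩ Metric.ball x₀ r, 2 * (K0 (dropCoord i x) +
          ENNReal.ofReal r * ENNReal.ofReal r * K1 (dropCoord i x))
        ∂(Measure.euclideanHausdorffMeasure n) :=
        setLIntegral_mono_ae'
          (isClosed_frontier.measurableSet.inter Metric.isOpen_ball.measurableSet)
          (ae_of_all _ hpt)
    _ ≤ (K : ℝ≥0∞) ^ (n : ℝ) *
          ∫⁻ y, 2 * (K0 y + ENNReal.ofReal r * ENNReal.ofReal r * K1 y) :=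
        lintegral_comp_dropCoord_le i hK
          (G := fun y => 2 * (K0 y + ENNReal.ofReal r * ENNReal.ofReal r * K1 y)) (by fun_prop)
    _ = _ := by
        rw [lintegral_const_mul _ (by fun_prop), lintegral_add_left hK0m,
          lintegral_const_mul _ hK1m, ← lintegral_slice i hfc, ← lintegral_slice i hgc,
          lintegral_indicator hΩ.measurableSet, lintegral_indicator hΩ.measurableSet]

/-- The trace inequality for smooth functions. -/
lemma trace_lintegral_le {n : ℕ} {Ω : Set (Eucl (n + 1))} (hΩ : IsBoundedSmoothOpen Ω) :
    ∃ C : ℝ≥0∞, C ≠ ⊤ ∧ ∀ φ : Eucl (n + 1) → ℝ, ContDiff ℝ ∞ φ →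
      ∫⁻ x, ‖φ x‖ₑ ^ 2 ∂(surfaceMeasure Ω) ≤
        C * ((∫⁻ x in Ω, ‖φ x‖ₑ ^ 2) + ∫⁻ x in Ω, ‖gradient φ x‖ₑ ^ 2) := by
  have hΓ : IsCompact (frontier Ω) :=
    Metric.isCompact_of_isClosed_isBounded isClosed_frontier
      (hΩ.isBounded.closure.subset frontier_subset_closure)
  have key : ∃ C : ℝ≥0∞, C ≠ ⊤ ∧ ∀ φ : Eucl (n + 1) → ℝ, ContDiff ℝ ∞ φ →
      ∫⁻ x in frontier Ω, ‖φ x‖ₑ ^ 2 ∂(surfaceMeasure Ω) ≤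
        C * ((∫⁻ x in Ω, ‖φ x‖ₑ ^ 2) + ∫⁻ x in Ω, ‖gradient φ x‖ₑ ^ 2) := by
    refine hΓ.induction_on (p := fun s => ∃ C : ℝ≥0∞, C ≠ ⊤ ∧ ∀ φ : Eucl (n + 1) → ℝ,
      ContDiff ℝ ∞ φ → ∫⁻ x in s, ‖φ x‖ₑ ^ 2 ∂(surfaceMeasure Ω) ≤
        C * ((∫⁻ x in Ω, ‖φ x‖ₑ ^ 2) + ∫⁻ x in Ω, ‖gradient φ x‖ₑ ^ 2)) ?_ ?_ ?_ ?_
    · exact ⟨0, by simp, fun φ _ => by simp⟩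
    · rintro s t hst ⟨C, hC, h⟩
      exact ⟨C, hC, fun φ hφ => (lintegral_mono_set hst).trans (h φ hφ)⟩
    · rintro s t ⟨C, hC, h⟩ ⟨C', hC', h'⟩
      refine ⟨C + C', by finiteness, fun φ hφ => ?_⟩
      rw [add_mul]
      exact (lintegral_union_le _ _ _).trans (add_le_add (h φ hφ) (h' φ hφ))
    · intro x₀ hx₀
      obtain ⟨i, c, r, K, hc, hr, hin, hK⟩ := hΩ.exists_chart hx₀
      refine ⟨Metric.ball x₀ r, mem_nhdsWithin_of_mem_nhds (Metric.ball_mem_nhds _ hr),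
        (ENNReal.ofReal r)⁻¹ * ((K : ℝ≥0∞) ^ (n : ℝ) *
          (2 * (1 + ENNReal.ofReal r * ENNReal.ofReal r))), ?_, fun φ hφ => ?_⟩
      · have h1 : (ENNReal.ofReal r)⁻¹ ≠ ⊤ := by simpa using hr
        have h2 : (K : ℝ≥0∞) ^ (n : ℝ) ≠ ⊤ := ENNReal.rpow_ne_top_of_nonneg (by positivity) (by simp)
        finiteness
      · have h := lintegral_frontier_ball_le hΩ.isOpen hc hin hK hφ
        rw [mul_comm, ← ENNReal.le_div_iff_mul_le (by left; simpa using hr) (by left; simp),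
          div_eq_mul_inv, mul_comm] at h
        refine h.trans ?_
        rw [mul_assoc _ _ (_ + _), mul_assoc _ _ (_ + _), mul_assoc 2 _ (_ + _)]
        refine mul_le_mul' le_rfl (mul_le_mul' le_rfl (mul_le_mul' le_rfl ?_))
        generalize ∫⁻ x in Ω, ‖gradient φ x‖ₑ ^ 2 = a
        generalize ∫⁻ x in Ω, ‖φ x‖ₑ ^ 2 = b
        calc b + ENNReal.ofReal r * ENNReal.ofReal r * a
            ≤ (b + ENNReal.ofReal r * ENNReal.ofReal r * a) +
              (a + ENNReal.ofReal r * ENNReal.ofReal r * b) := le_self_add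
          _ = _ := by ring
  obtain ⟨C, hC, h⟩ := key
  refine ⟨C, hC, fun φ hφ => ?_⟩
  have := h φ hφ
  rwa [surfaceMeasure, Measure.restrict_restrict isClosed_frontier.measurableSet, inter_self] at this

/-! ### Mollification -/

lemma eLpNorm_two_sq {α F : Type*} [MeasurableSpace α] {μ : Measure α} [NormedAddCommGroup F]
    (f : α → F) : eLpNorm f 2 μ ^ 2 = ∫⁻ x, ‖f x‖ₑ ^ 2 ∂μ := by
  have := eLpNorm_nnreal_pow_eq_lintegral (f := f) (μ := μ) (p := 2) (by norm_num)
  simpa using this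

lemma eLpNorm_two_le_iff {α F : Type*} [MeasurableSpace α] {μ : Measure α} [NormedAddCommGroup F]
    (f : α → F) (ε : ℝ≥0∞) : eLpNorm f 2 μ ≤ ε ↔ ∫⁻ x, ‖f x‖ₑ ^ 2 ∂μ ≤ ε ^ 2 := by
  rw [← eLpNorm_two_sq, ENNReal.pow_le_pow_left_iff two_ne_zero]

lemma exists_eLpNorm_translate_sub_le {N : ℕ} {F : Type*} [NormedAddCommGroup F]
    {f : Eucl N → F} (hf : MemLp f 2) {ε : ℝ≥0∞} (hε : 0 < ε) :
    ∃ δ > 0, ∀ z : Eucl N, ‖z‖ < δ → eLpNorm (fun x => f (x - z) - f x) 2 volume ≤ ε := by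
  let f' : Lp F 2 (volume : Measure (Eucl N)) := hf.toLp f
  have : Fact ((2 : ℝ≥0∞) ≠ ⊤) := ⟨by simp⟩
  have hc : Continuous fun z : Eucl N => (DomAddAct.mk (-z)) +ᵥ f' := by
    have : Continuous fun z : Eucl N => DomAddAct.mk (-z) :=
      DomAddAct.continuous_mk.comp continuous_neg
    exact this.vadd continuous_const
  have h0 := hc.tendsto 0
  simp only [neg_zero, DomAddAct.mk_zero, zero_vadd] at h0
  have h1 : ∀ᶠ z in 𝓝 (0 : Eucl N), edist ((DomAddAct.mk (-z : Eucl N)) +ᵥ f') f' ≤ ε :=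
    (EMetric.tendsto_nhds.1 h0 ε hε).mono fun z hz => hz.le
  obtain ⟨δ, hδ, hδs⟩ := Metric.eventually_nhds_iff.1 h1
  refine ⟨δ, hδ, fun z hz => ?_⟩
  refine le_trans (le_of_eq ?_) (hδs (y := z) (by simpa using hz))
  rw [Lp.edist_def]
  refine eLpNorm_congr_ae ?_
  have h2 := DomAddAct.vadd_Lp_ae_eq (DomAddAct.mk (-z)) f'
  have h3 : f' =ᵐ[volume] f := hf.coeFn_toLp
  have h4 : (fun x => f' (-z + x)) =ᵐ[volume] fun x => f (-z + x) :=
    (measurePreserving_add_left volume (-z)).quasiMeasurePreserving.ae_eq_comp h3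
  filter_upwards [h2, h3, h4] with x hx2 hx3 hx4
  simp only [Pi.sub_apply, hx2, hx3]
  change f (x - z) - f x = f' (-z + x) - f x
  rw [hx4, neg_add_eq_sub]

/-- The convolution of `f` with the kernel `k`. -/
def mollify {N : ℕ} {F : Type*} [NormedAddCommGroup F] [NormedSpace ℝ F] (k : Eucl N → ℝ)
    (f : Eucl N → F) (x : Eucl N) : F :=
  ∫ y, k (x - y) • f y

section Mollify

variable {N : ℕ} {F : Type*} [NormedAddCommGroup F] [NormedSpace ℝ F]

lemma mollify_eq_convolution (k : Eucl N → ℝ) (f : Eucl N → F) :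
    mollify k f = convolution f k (ContinuousLinearMap.lsmul ℝ ℝ).flip volume := rfl

lemma contDiff_mollify [CompleteSpace F] {k : Eucl N → ℝ} (hk : ContDiff ℝ ∞ k)
    (hkc : HasCompactSupport k) {f : Eucl N → F} (hf : LocallyIntegrable f) :
    ContDiff ℝ ∞ (mollify k f) := by
  rw [mollify_eq_convolution]
  exact hkc.contDiff_convolution_right _ hf hk

/-- Mollification with any kernel of small support is close to the identity in `L²`. The kernel need
not be centred at the origin. -/
lemma exists_eLpNorm_mollify_sub_le [CompleteSpace F] {f : Eucl N → F} (hf : MemLp f 2)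
    (hfm : StronglyMeasurable f) {ε : ℝ≥0∞} (hε : 0 < ε) :
    ∃ δ > 0, ∀ k : Eucl N → ℝ, ContDiff ℝ ∞ k → HasCompactSupport k → (∀ z, 0 ≤ k z) →
      ∫ z, k z = 1 → Function.support k ⊆ Metric.ball 0 δ →
      eLpNorm (fun x => mollify k f x - f x) 2 volume ≤ ε := by
  obtain ⟨δ, hδ, h⟩ := exists_eLpNorm_translate_sub_le hf hε
  refine ⟨δ, hδ, fun k hk hkc hk0 hk1 hks => ?_⟩
  have hki : Integrable k := hk.continuous.integrable_of_hasCompactSupport hkc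
  have hkm : Measurable fun z => ‖k z‖ₑ := hk.continuous.enorm.measurable
  have hk1' : ∫⁻ z, ‖k z‖ₑ = 1 := by
    rw [← ofReal_integral_norm_eq_lintegral_enorm hki]
    simp [abs_of_nonneg (hk0 _), hk1]
  have hloc : LocallyIntegrable f volume := hf.locallyIntegrable one_le_two
  have heq : ∀ x, mollify k f x - f x = ∫ z, k z • (f (x - z) - f x) := by
    intro x
    have h1 : mollify k f x = ∫ z, k z • f (x - z) := by
      rw [mollify, ← integral_sub_left_eq_self (fun y => k (x - y) • f y) volume x]
      simp
    have h2 : Integrable fun z => k z • f (x - z) := by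
      have := (hkc.convolutionExists_left (ContinuousLinearMap.lsmul ℝ ℝ) hk.continuous hloc) x
      exact this
    simp_rw [smul_sub]
    rw [integral_sub h2 (hki.smul_const _), integral_smul_const, hk1, one_smul, h1]
  have hfm2 : Measurable fun p : Eucl N × Eucl N => ‖f (p.1 - p.2) - f p.1‖ₑ :=
    ((hfm.comp_measurable (measurable_fst.sub measurable_snd)).sub
      (hfm.comp_measurable measurable_fst)).enorm
  rw [eLpNorm_two_le_iff]
  calc ∫⁻ x, ‖mollify k f x - f x‖ₑ ^ 2
      ≤ ∫⁻ x, ∫⁻ z, ‖k z‖ₑ * ‖f (x - z) - f x‖ₑ ^ 2 := by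
        refine lintegral_mono fun x => ?_
        have hmx : Measurable fun z => ‖f (x - z) - f x‖ₑ := hfm2.comp measurable_prodMk_left
        rw [heq]
        calc ‖∫ z, k z • (f (x - z) - f x)‖ₑ ^ 2
            ≤ (∫⁻ z, ‖k z‖ₑ * ‖f (x - z) - f x‖ₑ) ^ 2 := by
              gcongr
              refine (enorm_integral_le_lintegral_enorm _).trans (le_of_eq ?_)
              simp_rw [enorm_smul]
          _ = (∫⁻ z, ‖f (x - z) - f x‖ₑ ∂(volume.withDensity fun z => ‖k z‖ₑ)) ^ 2 := by
              rw [lintegral_withDensity_eq_lintegral_mul _ hkm hmx]; rfl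
          _ ≤ _ := lintegral_sq_le hmx.aemeasurable
          _ = _ := by
              rw [withDensity_apply _ MeasurableSet.univ, Measure.restrict_univ, hk1', one_mul,
                lintegral_withDensity_eq_lintegral_mul _ hkm (hmx.pow_const 2)]; rfl
    _ = ∫⁻ z, ∫⁻ x, ‖k z‖ₑ * ‖f (x - z) - f x‖ₑ ^ 2 := by
        refine lintegral_lintegral_swap (Measurable.aemeasurable ?_)
        exact (hkm.comp measurable_snd).mul (hfm2.pow_const 2)
    _ ≤ ∫⁻ z, ‖k z‖ₑ * ε ^ 2 := by
        refine lintegral_mono fun z => ?_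
        have hmz : Measurable fun x => ‖f (x - z) - f x‖ₑ ^ 2 :=
          (hfm2.comp measurable_prodMk_right).pow_const 2
        rw [lintegral_const_mul _ hmz]
        by_cases hz : k z = 0
        · simp [hz]
        · gcongr
          rw [← eLpNorm_two_le_iff]
          exact h z (by simpa using hks hz)
    _ = ε ^ 2 := by rw [lintegral_mul_const _ hkm, hk1', one_mul]

end Mollify

lemma gradient_apply {N : ℕ} (φ : Eucl N → ℝ) (x : Eucl N) (i : Fin N) :
    gradient φ x i = fderiv ℝ φ x (EuclideanSpace.single i 1) := by
  rw [gradient, ← InnerProductSpace.toDual_symm_apply, EuclideanSpace.inner_single_right]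
  simp

/-- Where the reflected and translated kernel is an admissible test function, mollification
commutes with the weak gradient. -/
lemma gradient_mollify {N : ℕ} {Ω : Set (Eucl N)} (hΩ : IsOpen Ω) {v : Eucl N → ℝ}
    {g : Eucl N → Eucl N} (hv : LocallyIntegrable (Ω.indicator v))
    (hg : LocallyIntegrable (Ω.indicator g)) (hvg : IsWeakGradient Ω v g)
    {k : Eucl N → ℝ} (hk : ContDiff ℝ ∞ k) (hkc : HasCompactSupport k) {x : Eucl N}
    (hx : ∀ z ∈ tsupport k, x - z ∈ Ω) :
    gradient (mollify k (Ω.indicator v)) x = mollify k (Ω.indicator g) x := by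
  set φ : Eucl N → ℝ := fun y => k (x - y) with hφ
  have hφd : ContDiff ℝ ∞ φ := hk.comp (contDiff_const.sub contDiff_id)
  have hφc : HasCompactSupport φ := hkc.comp_homeomorph (Homeomorph.subLeft x)
  have hφs : tsupport φ ⊆ Ω := by
    intro y hy
    have h1 : tsupport φ = (Homeomorph.subLeft x) ⁻¹' tsupport k := by
      rw [tsupport, tsupport, Homeomorph.preimage_closure]; rfl
    rw [h1] at hy
    simpa using hx _ hy
  ext i
  have hF := (hkc.hasFDerivAt_convolution_right (ContinuousLinearMap.lsmul ℝ ℝ).flip hv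
    (hk.of_le (by simp)) x).fderiv
  have hkd : Continuous (fderiv ℝ k) := hk.continuous_fderiv (by simp)
  rw [gradient_apply, mollify_eq_convolution, hF,
    convolution_precompR_apply _ hv (hkc.fderiv ℝ) hkd]
  have hint : Integrable fun y => φ y • Ω.indicator g y :=
    hg.integrable_smul_left_of_hasCompactSupport hφd.continuous hφc
  have e1 : mollify k (Ω.indicator g) x i = ∫ y in Ω, g y i * φ y := by
    change (EuclideanSpace.proj (𝕜 := ℝ) i) (∫ y, φ y • Ω.indicator g y) = _
    rw [← ContinuousLinearMap.integral_comp_comm _ hint, ← integral_indicator hΩ.measurableSet]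
    refine integral_congr_ae (ae_of_all _ fun y => ?_)
    by_cases hy : y ∈ Ω <;> simp [hy, mul_comm]
  have hder : ∀ y, fderiv ℝ φ y (EuclideanSpace.single i 1) =
      -fderiv ℝ k (x - y) (EuclideanSpace.single i 1) := by
    intro y
    have h1 : HasFDerivAt φ ((fderiv ℝ k (x - y)).comp
        (-ContinuousLinearMap.id ℝ (Eucl N))) y := by
      have h2 : HasFDerivAt (fun y => x - y) (-ContinuousLinearMap.id ℝ (Eucl N)) y :=
        (hasFDerivAt_id y).const_sub x
      exact ((hk.differentiable (by simp)) (x - y)).hasFDerivAt.comp y h2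
    rw [h1.fderiv]
    simp
  rw [e1]
  have := hvg φ hφd hφc hφs i
  have h2 : ∫ y in Ω, v y * fderiv ℝ φ y (EuclideanSpace.single i 1) =
      -convolution (Ω.indicator v) (fun a => fderiv ℝ k a (EuclideanSpace.single i 1))
        (ContinuousLinearMap.lsmul ℝ ℝ).flip volume x := by
    rw [convolution, ← integral_neg, ← integral_indicator hΩ.measurableSet]
    refine integral_congr_ae (ae_of_all _ fun y => ?_)
    by_cases hy : y ∈ Ω <;> simp [hy, hder, mul_comm]
  rw [h2] at this
  linarith

/-! ### Density of smooth functions in `H¹(Ω)` -/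

/-- Near every point of `closure Ω` there is a translation direction into `Ω`. -/
lemma IsBoundedSmoothOpen.exists_inward {n : ℕ} {Ω : Set (Eucl (n + 1))}
    (hΩ : IsBoundedSmoothOpen Ω) {x₀ : Eucl (n + 1)} (hx₀ : x₀ ∈ closure Ω) :
    ∃ (ν : Eucl (n + 1)) (r : ℝ), 0 < r ∧
      ∀ x ∈ closure Ω ∩ Metric.ball x₀ r, ∀ s ∈ Ioo 0 r, x - s • ν ∈ Ω := by
  by_cases hx : x₀ ∈ Ω
  · obtain ⟨r, hr, hrs⟩ := Metric.isOpen_iff.1 hΩ.isOpen x₀ hx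
    exact ⟨0, r, hr, fun x hx s _ => by simpa using hrs hx.2⟩
  · obtain ⟨i, c, r, K, _, hr, h, _⟩ :=
      hΩ.exists_chart (x₀ := x₀) (by rw [hΩ.isOpen.frontier_eq]; exact ⟨hx₀, hx⟩)
    exact ⟨c • EuclideanSpace.single i (1 : ℝ), r, hr, fun x hx s hs => by
      rw [smul_smul]; exact h x hx s hs⟩

/-- Simultaneous approximation of a function and its weak gradient near a point of `closure Ω`. The
mollification kernel is centred at `s • ν`, which translates and smooths in one step; near `x₀` it
then sees only values inside `Ω`, so that the extension by zero leaves the gradient intact. -/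
lemma exists_local_approx {N : ℕ} {Ω : Set (Eucl N)} (hΩ : IsOpen Ω)
    (hb : Bornology.IsBounded Ω) {v : Eucl N → ℝ} {g : Eucl N → Eucl N}
    (hvm : StronglyMeasurable v) (hgm : StronglyMeasurable g)
    (hv : MemLp v 2 (volume.restrict Ω)) (hg : MemLp g 2 (volume.restrict Ω))
    (hvg : IsWeakGradient Ω v g) {x₀ ν : Eucl N} {r : ℝ} (hr : 0 < r)
    (hin : ∀ x ∈ closure Ω ∩ Metric.ball x₀ r, ∀ s ∈ Ioo 0 r, x - s • ν ∈ Ω)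
    {ε : ℝ≥0∞} (hε : 0 < ε) :
    ∃ (ψ : Eucl N → ℝ) (G : Eucl N → Eucl N), ContDiff ℝ ∞ ψ ∧ ContDiff ℝ ∞ G ∧
      (∀ x ∈ Ω ∩ Metric.ball x₀ (r / 2), gradient ψ x = G x) ∧
      eLpNorm (fun x => ψ x - v x) 2 (volume.restrict Ω) ≤ ε ∧
      eLpNorm (fun x => G x - g x) 2 (volume.restrict Ω) ≤ ε := by
  have hv' : MemLp (Ω.indicator v) 2 := (memLp_indicator_iff_restrict hΩ.measurableSet).2 hv
  have hg' : MemLp (Ω.indicator g) 2 := (memLp_indicator_iff_restrict hΩ.measurableSet).2 hg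
  obtain ⟨δ₁, hδ₁, h₁⟩ := exists_eLpNorm_mollify_sub_le hv' (hvm.indicator hΩ.measurableSet) hε
  obtain ⟨δ₂, hδ₂, h₂⟩ := exists_eLpNorm_mollify_sub_le hg' (hgm.indicator hΩ.measurableSet) hε
  set δ := min δ₁ δ₂ with hδdef
  have hδ : 0 < δ := lt_min hδ₁ hδ₂
  obtain ⟨s, hs, hsδ⟩ : ∃ s ∈ Ioo 0 r, s * ‖ν‖ < δ / 2 := by
    refine ⟨min (r / 2) (δ / (4 * (‖ν‖ + 1))), ⟨by positivity, ?_⟩, ?_⟩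
    · exact (min_le_left _ _).trans_lt (half_lt_self hr)
    · calc min (r / 2) (δ / (4 * (‖ν‖ + 1))) * ‖ν‖ ≤ δ / (4 * (‖ν‖ + 1)) * (‖ν‖ + 1) := by
            gcongr
            · exact min_le_right _ _
            · linarith
        _ = δ / 4 := by field_simp
        _ < δ / 2 := by linarith
  set S : Set (Eucl N) := (fun x => x - s • ν) '' (closure Ω ∩ Metric.closedBall x₀ (r / 2)) with hS
  have hSc : IsCompact S :=
    ((Metric.isCompact_of_isClosed_isBounded isClosed_closure hb.closure).inter_right
      Metric.isClosed_closedBall).image (by fun_prop)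
  have hSΩ : S ⊆ Ω := by
    rintro _ ⟨x, hx, rfl⟩
    exact hin x ⟨hx.1, Metric.closedBall_subset_ball (half_lt_self hr) hx.2⟩ s hs
  obtain ⟨η, hη, hηΩ⟩ := hSc.exists_cthickening_subset_open hΩ hSΩ
  set R := min η (δ / 2) with hR
  have hRpos : 0 < R := lt_min hη (half_pos hδ)
  let f : ContDiffBump (s • ν) := ⟨R / 2, R, half_pos hRpos, half_lt_self hRpos⟩
  set k := f.normed volume with hk
  have hkd : ContDiff ℝ ∞ k := f.contDiff_normed
  have hkc : HasCompactSupport k := f.hasCompactSupport_normed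
  have hsupp : Function.support k ⊆ Metric.ball 0 δ := by
    rw [hk, f.support_normed_eq]
    intro z hz
    rw [Metric.mem_ball, dist_eq_norm] at hz
    rw [mem_ball_zero_iff]
    have h1 : ‖z‖ ≤ ‖z - s • ν‖ + ‖s • ν‖ := by simpa using norm_add_le (z - s • ν) (s • ν)
    rw [norm_smul, Real.norm_eq_abs, abs_of_pos hs.1] at h1
    have h2 : f.rOut ≤ δ / 2 := min_le_right _ _
    linarith
  have hvl := hv'.locallyIntegrable one_le_two
  have hgl := hg'.locallyIntegrable one_le_two
  refine ⟨mollify k (Ω.indicator v), mollify k (Ω.indicator g), contDiff_mollify hkd hkc hvl,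
    contDiff_mollify hkd hkc hgl, ?_, ?_, ?_⟩
  · rintro x ⟨hxΩ, hxr⟩
    refine gradient_mollify hΩ hvl hgl hvg hkd hkc fun z hz => hηΩ ?_
    rw [hk, f.tsupport_normed_eq, Metric.mem_closedBall] at hz
    refine Metric.mem_cthickening_of_dist_le _ (x - s • ν) _ _
      ⟨x, ⟨subset_closure hxΩ, Metric.ball_subset_closedBall hxr⟩, rfl⟩ ?_
    rw [dist_sub_left]
    exact hz.trans (min_le_left _ _)
  · have h := h₁ k hkd hkc f.nonneg_normed f.integral_normed
      (hsupp.trans (Metric.ball_subset_ball (min_le_left _ _)))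
    refine le_trans (le_of_eq ?_)
      ((eLpNorm_mono_measure _ (Measure.restrict_le_self (s := Ω))).trans h)
    refine eLpNorm_congr_ae ?_
    filter_upwards [ae_restrict_mem hΩ.measurableSet] with x hx
    rw [indicator_of_mem hx]
  · have h := h₂ k hkd hkc f.nonneg_normed f.integral_normed
      (hsupp.trans (Metric.ball_subset_ball (min_le_right _ _)))
    refine le_trans (le_of_eq ?_)
      ((eLpNorm_mono_measure _ (Measure.restrict_le_self (s := Ω))).trans h)
    refine eLpNorm_congr_ae ?_
    filter_upwards [ae_restrict_mem hΩ.measurableSet] with x hx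
    rw [indicator_of_mem hx]

/-- The pair `(v, g)` is a limit, in `L²(Ω) × L²(Ω; ℝ^N)`, of pairs `(φ, ∇φ)` with `φ` smooth on the
whole space. -/
def IsSmoothLimit {N : ℕ} (Ω : Set (Eucl N)) (v : Eucl N → ℝ) (g : Eucl N → Eucl N) : Prop :=
  ∀ ε : ℝ≥0∞, 0 < ε → ∃ φ : Eucl N → ℝ, ContDiff ℝ ∞ φ ∧
    eLpNorm (fun x => φ x - v x) 2 (volume.restrict Ω) ≤ ε ∧
    eLpNorm (fun x => gradient φ x - g x) 2 (volume.restrict Ω) ≤ ε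

lemma gradient_add' {N : ℕ} {φ ψ : Eucl N → ℝ} (hφ : ContDiff ℝ ∞ φ) (hψ : ContDiff ℝ ∞ ψ)
    (x : Eucl N) : gradient (fun x => φ x + ψ x) x = gradient φ x + gradient ψ x := by
  ext i
  rw [PiLp.add_apply, gradient_apply, gradient_apply, gradient_apply,
    fderiv_fun_add (hφ.differentiable (by simp) x) (hψ.differentiable (by simp) x)]
  rfl

lemma gradient_mul' {N : ℕ} {φ ψ : Eucl N → ℝ} (hφ : ContDiff ℝ ∞ φ) (hψ : ContDiff ℝ ∞ ψ)
    (x : Eucl N) : gradient (fun x => φ x * ψ x) x = φ x • gradient ψ x + ψ x • gradient φ x := by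
  ext i
  rw [PiLp.add_apply, PiLp.smul_apply, PiLp.smul_apply, gradient_apply, gradient_apply,
    gradient_apply, fderiv_fun_mul (hφ.differentiable (by simp) x) (hψ.differentiable (by simp) x)]
  rfl

lemma IsSmoothLimit.zero {N : ℕ} (Ω : Set (Eucl N)) : IsSmoothLimit Ω 0 0 := fun ε _ =>
  ⟨0, contDiff_const, by simp, by
    have : gradient (0 : Eucl N → ℝ) = 0 := by
      funext x; ext i; rw [gradient_apply]; simp
    simp [this]⟩

lemma IsSmoothLimit.add {N : ℕ} {Ω : Set (Eucl N)} {v v' : Eucl N → ℝ} {g g' : Eucl N → Eucl N}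
    (hvm : AEStronglyMeasurable v (volume.restrict Ω))
    (hgm : AEStronglyMeasurable g (volume.restrict Ω))
    (hvm' : AEStronglyMeasurable v' (volume.restrict Ω))
    (hgm' : AEStronglyMeasurable g' (volume.restrict Ω))
    (h : IsSmoothLimit Ω v g) (h' : IsSmoothLimit Ω v' g') : IsSmoothLimit Ω (v + v') (g + g') := by
  intro ε hε
  obtain ⟨φ, hφ, h1, h2⟩ := h (ε / 2) (ENNReal.half_pos hε.ne')
  obtain ⟨φ', hφ', h1', h2'⟩ := h' (ε / 2) (ENNReal.half_pos hε.ne')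
  refine ⟨fun x => φ x + φ' x, hφ.add hφ', ?_, ?_⟩
  · have : (fun x => φ x + φ' x - (v + v') x) =
        (fun x => φ x - v x) + fun x => φ' x - v' x := by
      funext x; simp only [Pi.add_apply]; ring
    rw [this, ← ENNReal.add_halves ε]
    exact (eLpNorm_add_le (hφ.continuous.aestronglyMeasurable.sub hvm)
      (hφ'.continuous.aestronglyMeasurable.sub hvm') one_le_two).trans (add_le_add h1 h1')
  · have : (fun x => gradient (fun x => φ x + φ' x) x - (g + g') x) =
        (fun x => gradient φ x - g x) + fun x => gradient φ' x - g' x := by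
      funext x; simp only [Pi.add_apply, gradient_add' hφ hφ']; abel
    rw [this, ← ENNReal.add_halves ε]
    exact (eLpNorm_add_le ((continuous_gradient hφ).aestronglyMeasurable.sub hgm)
      ((continuous_gradient hφ').aestronglyMeasurable.sub hgm') one_le_two).trans
      (add_le_add h2 h2')

lemma IsSmoothLimit.sum {N : ℕ} {Ω : Set (Eucl N)} {ι : Type*} (s : Finset ι)
    {v : ι → Eucl N → ℝ} {g : ι → Eucl N → Eucl N}
    (hvm : ∀ i, AEStronglyMeasurable (v i) (volume.restrict Ω))
    (hgm : ∀ i, AEStronglyMeasurable (g i) (volume.restrict Ω))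
    (h : ∀ i, IsSmoothLimit Ω (v i) (g i)) :
    IsSmoothLimit Ω (∑ i ∈ s, v i) (∑ i ∈ s, g i) := by
  classical
  induction s using Finset.induction_on with
  | empty => simpa using IsSmoothLimit.zero Ω
  | insert a s ha ih =>
    rw [Finset.sum_insert ha, Finset.sum_insert ha]
    exact (h a).add (hvm a) (hgm a) (Finset.aestronglyMeasurable_sum _ fun i _ => hvm i)
      (Finset.aestronglyMeasurable_sum _ fun i _ => hgm i) ih

lemma eLpNorm_bdd_smul_le {N : ℕ} {F : Type*} [NormedAddCommGroup F] [NormedSpace ℝ F]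
    {μ : Measure (Eucl N)} {η : Eucl N → ℝ} {C : ℝ} (hC : ∀ x, ‖η x‖ ≤ C) (f : Eucl N → F) :
    eLpNorm (fun x => η x • f x) 2 μ ≤ ENNReal.ofReal C * eLpNorm f 2 μ := by
  refine eLpNorm_le_mul_eLpNorm_of_ae_le_mul (ae_of_all _ fun x => ?_) 2
  rw [norm_smul]
  gcongr
  exact hC x

lemma eLpNorm_smul_bdd_le {N : ℕ} {F : Type*} [NormedAddCommGroup F] [NormedSpace ℝ F]
    {μ : Measure (Eucl N)} {η : Eucl N → F} {C : ℝ} (hC : ∀ x, ‖η x‖ ≤ C) (f : Eucl N → ℝ) :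
    eLpNorm (fun x => f x • η x) 2 μ ≤ ENNReal.ofReal C * eLpNorm f 2 μ := by
  refine eLpNorm_le_mul_eLpNorm_of_ae_le_mul (ae_of_all _ fun x => ?_) 2
  rw [norm_smul, mul_comm]
  gcongr
  exact hC x

/-- A cut-off of an element of `H¹(Ω)` near a point of `closure Ω` is a limit of smooth functions. -/
lemma isSmoothLimit_cutoff {N : ℕ} {Ω : Set (Eucl N)} (hΩ : IsOpen Ω)
    (hb : Bornology.IsBounded Ω) {v : Eucl N → ℝ} {g : Eucl N → Eucl N}
    (hvm : StronglyMeasurable v) (hgm : StronglyMeasurable g)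
    (hv : MemLp v 2 (volume.restrict Ω)) (hg : MemLp g 2 (volume.restrict Ω))
    (hvg : IsWeakGradient Ω v g) {x₀ ν : Eucl N} {r : ℝ} (hr : 0 < r)
    (hin : ∀ x ∈ closure Ω ∩ Metric.ball x₀ r, ∀ s ∈ Ioo 0 r, x - s • ν ∈ Ω)
    {η : Eucl N → ℝ} (hη : ContDiff ℝ ∞ η) (hηs : tsupport η ⊆ Metric.ball x₀ (r / 2)) :
    IsSmoothLimit Ω (fun x => η x * v x) (fun x => η x • g x + v x • gradient η x) := by
  have hηc : HasCompactSupport η :=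
    HasCompactSupport.of_support_subset_isCompact (isCompact_closedBall x₀ (r / 2))
      ((subset_tsupport η).trans (hηs.trans Metric.ball_subset_closedBall))
  obtain ⟨C₁, hC₁⟩ := hηc.exists_bound_of_continuous hη.continuous
  obtain ⟨C₂, hC₂⟩ := (hηc.fderiv ℝ).exists_bound_of_continuous (hη.continuous_fderiv (by simp))
  set A : ℝ≥0∞ := ENNReal.ofReal C₁ + ENNReal.ofReal C₂ + 1 with hA
  have hA0 : A ≠ 0 := by simp [hA]
  have hAt : A ≠ ⊤ := by simp [hA]
  intro ε hε
  obtain ⟨ψ, G, hψ, hG, hgrad, h1, h2⟩ := exists_local_approx hΩ hb hvm hgm hv hg hvg hr hin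
    (ε := ε / A) (ENNReal.div_pos hε.ne' hAt)
  have hAε : A * (ε / A) = ε := ENNReal.mul_div_cancel hA0 hAt
  refine ⟨fun x => η x * ψ x, hη.mul hψ, ?_, ?_⟩
  · calc eLpNorm (fun x => η x * ψ x - η x * v x) 2 (volume.restrict Ω)
        = eLpNorm (fun x => η x • (ψ x - v x)) 2 (volume.restrict Ω) := by
          congr 1; funext x; rw [smul_eq_mul, mul_sub]
      _ ≤ ENNReal.ofReal C₁ * eLpNorm (fun x => ψ x - v x) 2 (volume.restrict Ω) :=
          eLpNorm_bdd_smul_le hC₁ _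
      _ ≤ A * (ε / A) := by
          gcongr
          rw [hA, add_assoc]; exact le_self_add
      _ = ε := hAε
  · have heq : eLpNorm (fun x => gradient (fun x => η x * ψ x) x -
          (η x • g x + v x • gradient η x)) 2 (volume.restrict Ω) =
        eLpNorm ((fun x => η x • (G x - g x)) + fun x => (ψ x - v x) • gradient η x) 2
          (volume.restrict Ω) := by
      refine eLpNorm_congr_ae ?_
      filter_upwards [ae_restrict_mem hΩ.measurableSet] with x hx
      rw [gradient_mul' hη hψ, Pi.add_apply]
      have h3 : η x • gradient ψ x = η x • G x := by
        by_cases hηx : η x = 0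
        · simp [hηx]
        · rw [hgrad x ⟨hx, hηs (subset_tsupport η hηx)⟩]
      rw [h3, smul_sub, sub_smul]
      abel
    rw [heq]
    refine (eLpNorm_add_le ?_ ?_ one_le_two).trans ?_
    · exact hη.continuous.aestronglyMeasurable.smul
        (hG.continuous.aestronglyMeasurable.sub hgm.aestronglyMeasurable)
    · exact (hψ.continuous.aestronglyMeasurable.sub hvm.aestronglyMeasurable).smul
        (continuous_gradient hη).aestronglyMeasurable
    · calc _ ≤ ENNReal.ofReal C₁ * (ε / A) + ENNReal.ofReal C₂ * (ε / A) := by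
            refine add_le_add ((eLpNorm_bdd_smul_le hC₁ _).trans (by gcongr))
              ((eLpNorm_smul_bdd_le (C := C₂) (fun x => ?_) _).trans (by gcongr))
            rw [norm_gradient]; exact hC₂ x
        _ ≤ A * (ε / A) := by
            rw [← add_mul]
            gcongr
            exact le_self_add
        _ = ε := hAε

/-- Restrictions of smooth functions on the whole space are dense in `H¹(Ω)`. -/
lemma IsBoundedSmoothOpen.isSmoothLimit {n : ℕ} {Ω : Set (Eucl (n + 1))}
    (hΩ : IsBoundedSmoothOpen Ω) {v : Eucl (n + 1) → ℝ} {g : Eucl (n + 1) → Eucl (n + 1)}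
    (hvm : StronglyMeasurable v) (hgm : StronglyMeasurable g)
    (hv : MemLp v 2 (volume.restrict Ω)) (hg : MemLp g 2 (volume.restrict Ω))
    (hvg : IsWeakGradient Ω v g) : IsSmoothLimit Ω v g := by
  classical
  have hcl : IsCompact (closure Ω) :=
    Metric.isCompact_of_isClosed_isBounded isClosed_closure hΩ.isBounded.closure
  choose! ν r hr hin using fun (x₀ : Eucl (n + 1)) (hx₀ : x₀ ∈ closure Ω) =>
    hΩ.exists_inward hx₀
  obtain ⟨t, ht, hcov⟩ := hcl.elim_nhds_subcover (fun x => Metric.ball x (r x / 2))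
    fun x hx => Metric.ball_mem_nhds x (half_pos (hr x hx))
  obtain ⟨f, hf⟩ := SmoothPartitionOfUnity.exists_isSubordinate (modelWithCornersSelf ℝ (Eucl (n + 1)))
    (isClosed_closure (s := Ω)) (fun x : t => Metric.ball (x : Eucl (n + 1)) (r x / 2))
    (fun _ => Metric.isOpen_ball) (by
      intro x hx
      obtain ⟨y, hy, hxy⟩ := mem_iUnion₂.1 (hcov hx)
      exact mem_iUnion.2 ⟨⟨y, hy⟩, hxy⟩)
  have hfd : ∀ i, ContDiff ℝ ∞ (f i) := fun i => contMDiff_iff_contDiff.1 (f i).contMDiff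
  have hsum : ∀ x ∈ Ω, ∑ i, f i x = 1 := fun x hx => by
    rw [← finsum_eq_sum_of_fintype]
    exact f.sum_eq_one (subset_closure hx)
  -- The terms `v ∇f_i` of the localized gradients cancel, since `∑ f_i = 1` near `x`.
  have hgsum : ∀ x ∈ Ω, ∑ i, gradient (f i) x = 0 := by
    intro x hx
    have h1 : (fun y => ∑ i, f i y) =ᶠ[𝓝 x] fun _ => 1 := by
      filter_upwards [hΩ.isOpen.mem_nhds hx] with y hy using hsum y hy
    ext j
    have h2 := h1.fderiv_eq (𝕜 := ℝ)
    rw [fderiv_fun_sum fun i _ => (hfd i).differentiable (by simp) x, fderiv_fun_const] at h2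
    have h3 := congrArg (fun L : Eucl (n + 1) →L[ℝ] ℝ => L (EuclideanSpace.single j 1)) h2
    simp only [sum_apply] at h3
    simp only [WithLp.ofLp_sum, Finset.sum_apply, gradient_apply]
    rw [h3]
    simp
  have key := IsSmoothLimit.sum (Ω := Ω) (Finset.univ : Finset t)
    (v := fun i x => f i x * v x) (g := fun i x => f i x • g x + v x • gradient (f i) x)
    (fun i => (hfd i).continuous.aestronglyMeasurable.mul hvm.aestronglyMeasurable)
    (fun i => ((hfd i).continuous.aestronglyMeasurable.smul hgm.aestronglyMeasurable).add
      (hvm.aestronglyMeasurable.smul (continuous_gradient (hfd i)).aestronglyMeasurable))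
    (fun i => isSmoothLimit_cutoff hΩ.isOpen hΩ.isBounded hvm hgm hv hg hvg (hr i (ht i i.2))
      (hin i (ht i i.2)) (hfd i) (hf i))
  intro ε hε
  obtain ⟨φ, hφ, h1, h2⟩ := key ε hε
  refine ⟨φ, hφ, le_trans (le_of_eq (eLpNorm_congr_ae ?_)) h1,
    le_trans (le_of_eq (eLpNorm_congr_ae ?_)) h2⟩
  · filter_upwards [ae_restrict_mem hΩ.isOpen.measurableSet] with x hx
    rw [Finset.sum_apply, ← Finset.sum_mul, hsum x hx, one_mul]
  · filter_upwards [ae_restrict_mem hΩ.isOpen.measurableSet] with x hx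
    rw [Finset.sum_apply, Finset.sum_add_distrib, ← Finset.sum_smul, hsum x hx, one_smul,
      ← Finset.smul_sum, hgsum x hx, smul_zero, add_zero]

/-! ### `H¹(Ω)` as a Hilbert space -/

lemma isClosed_W1p_two {N : ℕ} (Ω : Set (Eucl N)) :
    IsClosed (W1p Ω 2 : Set (WithLp 2 (LpOn Ω 2 × LpVec Ω 2))) := by
  have hset : (W1p Ω 2 : Set (WithLp 2 (LpOn Ω 2 × LpVec Ω 2))) =
      {w | IsWeakGradient Ω w.fst w.snd} := rfl
  rw [hset]
  simp only [IsWeakGradient, ofPred_forall]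
  refine isClosed_iInter fun φ => isClosed_iInter fun h1 => isClosed_iInter fun h2 =>
    isClosed_iInter fun _ => isClosed_iInter fun i => ?_
  have hd : Continuous fun x => fderiv ℝ φ x (EuclideanSpace.single i 1) :=
    (h1.continuous_fderiv (by simp)).clm_apply continuous_const
  have hm1 : MemLp (fun x => fderiv ℝ φ x (EuclideanSpace.single i 1)) 2 (volume.restrict Ω) :=
    hd.memLp_of_hasCompactSupport (h2.fderiv_apply ℝ _)
  have hm2 : MemLp (fun x => φ x • (EuclideanSpace.single i 1 : Eucl N)) 2 (volume.restrict Ω) :=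
    (h1.continuous.smul continuous_const).memLp_of_hasCompactSupport h2.smul_right
  have e1 : ∀ v : LpOn Ω 2, ∫ x in Ω, v x * fderiv ℝ φ x (EuclideanSpace.single i 1) =
      inner ℝ (hm1.toLp _) v := by
    intro v
    rw [L2.inner_def]
    refine integral_congr_ae ?_
    filter_upwards [hm1.coeFn_toLp] with x hx
    rw [hx]; simp
  have e2 : ∀ g : LpVec Ω 2, ∫ x in Ω, g x i * φ x = inner ℝ (hm2.toLp _) g := by
    intro g
    rw [L2.inner_def]
    refine integral_congr_ae ?_
    filter_upwards [hm2.coeFn_toLp] with x hx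
    rw [hx, inner_smul_left, EuclideanSpace.inner_single_left]; simp [mul_comm]
  simp_rw [e1, e2]
  exact isClosed_eq (continuous_const.inner (WithLp.fstL 2 ℝ _ _).continuous)
    (continuous_const.inner (WithLp.sndL 2 ℝ _ _).continuous).neg

instance completeSpace_spaceV {N : ℕ} (Ω : Set (Eucl N)) : CompleteSpace (SpaceV Ω) :=
  (isClosed_W1p_two Ω).completeSpace_coe

lemma SpaceV.norm_sq_eq {N : ℕ} {Ω : Set (Eucl N)} (v : SpaceV Ω) :
    ‖v‖ ^ 2 = ‖W1p.toLp v‖ ^ 2 + ‖W1p.grad v‖ ^ 2 :=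
  WithLp.prod_norm_sq_eq_of_L2 (v : WithLp 2 (LpOn Ω 2 × LpVec Ω 2))

/-- The weak gradient is unique. -/
lemma SpaceV.toLp_injective {N : ℕ} {Ω : Set (Eucl N)} (hΩ : IsOpen Ω) :
    Function.Injective (W1p.toLp : SpaceV Ω → LpOn Ω 2) := by
  refine (injective_iff_map_eq_zero _).2 fun v hv => ?_
  have hg : W1p.grad v = 0 := by
    rw [Lp.eq_zero_iff_ae_eq_zero]
    have key : ∀ i : Fin N, ∀ᵐ x ∂(volume.restrict Ω), W1p.grad v x i = 0 := by
      intro i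
      rw [ae_restrict_iff' hΩ.measurableSet]
      have hloc : LocallyIntegrable (fun x => W1p.grad v x i) (volume.restrict Ω) := by
        have := (Lp.memLp (W1p.grad v)).locallyIntegrable one_le_two
        intro x
        obtain ⟨s, hs, hi⟩ := this x
        exact ⟨s, hs, (EuclideanSpace.proj (𝕜 := ℝ) i).integrable_comp hi⟩
      have hloc' : LocallyIntegrableOn (fun x => W1p.grad v x i) Ω volume := by
        rw [locallyIntegrableOn_iff hΩ.isLocallyClosed]
        intro K hK hKc
        have := hloc.integrableOn_isCompact hKc
        rwa [IntegrableOn, Measure.restrict_restrict hKc.measurableSet,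
          inter_eq_self_of_subset_left hK] at this
      refine hΩ.ae_eq_zero_of_integral_contDiff_smul_eq_zero hloc' fun φ hφ hφc hφs => ?_
      have h1 := v.2 φ hφ hφc hφs i
      have h2 : ∫ x in Ω, W1p.toLp v x * fderiv ℝ φ x (EuclideanSpace.single i 1) = 0 := by
        rw [hv]
        refine integral_eq_zero_of_ae ?_
        filter_upwards [Lp.coeFn_zero ℝ 2 (volume.restrict Ω)] with x hx
        rw [hx]; simp
      have h3 : ∫ x in Ω, W1p.grad v x i * φ x = 0 := by
        have h4 := h2.symm.trans h1
        exact (neg_eq_zero.1 h4.symm)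
      rw [← h3, ← setIntegral_eq_integral_of_forall_compl_eq_zero (s := Ω)]
      · simp_rw [smul_eq_mul, mul_comm]
      · intro x hx
        rw [image_eq_zero_of_notMem_tsupport fun h => hx (hφs h), zero_smul]
    filter_upwards [ae_all_iff.2 key] with x hx
    ext i
    exact hx i
  have h := SpaceV.norm_sq_eq v
  rw [hv, hg] at h
  simpa using h

/-! ### The trace operator -/

lemma ENNReal.le_of_sq_le_mul_add_sq {X Y Z C : ℝ≥0∞} (h : X ^ 2 ≤ C * (Y ^ 2 + Z ^ 2)) :
    X ≤ (C + 1) * (Y + Z) := by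
  rw [← ENNReal.pow_le_pow_left_iff two_ne_zero]
  refine h.trans ?_
  rw [mul_pow]
  refine mul_le_mul' ?_ ?_
  · calc C ≤ C + (C ^ 2 + C + 1) := le_self_add
      _ = (C + 1) ^ 2 := by ring
  · calc Y ^ 2 + Z ^ 2 ≤ Y ^ 2 + Z ^ 2 + 2 * Y * Z := le_self_add
      _ = (Y + Z) ^ 2 := by ring

lemma trace_eLpNorm_le {n : ℕ} {Ω : Set (Eucl (n + 1))} (hΩ : IsBoundedSmoothOpen Ω) :
    ∃ C : ℝ≥0∞, C ≠ ⊤ ∧ ∀ φ : Eucl (n + 1) → ℝ, ContDiff ℝ ∞ φ →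
      eLpNorm φ 2 (surfaceMeasure Ω) ≤
        C * (eLpNorm φ 2 (volume.restrict Ω) + eLpNorm (gradient φ) 2 (volume.restrict Ω)) := by
  obtain ⟨C, hC, h⟩ := trace_lintegral_le hΩ
  refine ⟨C + 1, by finiteness, fun φ hφ => ENNReal.le_of_sq_le_mul_add_sq ?_⟩
  simp_rw [eLpNorm_two_sq]
  exact h φ hφ

lemma friedrichs_eLpNorm_le {n : ℕ} {Ω : Set (Eucl (n + 1))} (hΩ : IsBoundedSmoothOpen Ω) :
    ∃ C : ℝ≥0∞, C ≠ ⊤ ∧ ∀ φ : Eucl (n + 1) → ℝ, ContDiff ℝ ∞ φ →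
      eLpNorm φ 2 (volume.restrict Ω) ≤
        C * (eLpNorm (gradient φ) 2 (volume.restrict Ω) + eLpNorm φ 2 (surfaceMeasure Ω)) := by
  obtain ⟨C, hC, h⟩ := friedrichs_lintegral hΩ.isOpen hΩ.isBounded
  refine ⟨C + 1, by finiteness, fun φ hφ => ENNReal.le_of_sq_le_mul_add_sq ?_⟩
  simp_rw [eLpNorm_two_sq]
  exact h φ hφ

lemma eLpNorm_le_sub_add {α F : Type*} [MeasurableSpace α] {μ : Measure α} [NormedAddCommGroup F]
    {f g : α → F} (hf : AEStronglyMeasurable f μ) (hg : AEStronglyMeasurable g μ) :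
    eLpNorm f 2 μ ≤ eLpNorm (fun x => f x - g x) 2 μ + eLpNorm g 2 μ := by
  have := eLpNorm_add_le (hf.sub hg) hg one_le_two
  rwa [sub_add_cancel] at this

lemma eLpNorm_le_sub_add' {α F : Type*} [MeasurableSpace α] {μ : Measure α} [NormedAddCommGroup F]
    {f g : α → F} (hf : AEStronglyMeasurable f μ) (hg : AEStronglyMeasurable g μ) :
    eLpNorm g 2 μ ≤ eLpNorm (fun x => f x - g x) 2 μ + eLpNorm f 2 μ := by
  have h := eLpNorm_le_sub_add hg hf
  have h2 := eLpNorm_sub_comm g f 2 μ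
  change eLpNorm (fun x => g x - f x) 2 μ = eLpNorm (fun x => f x - g x) 2 μ at h2
  rwa [h2] at h

lemma exists_isTrace {n : ℕ} {Ω : Set (Eucl (n + 1))} (hΩ : IsBoundedSmoothOpen Ω)
    (v : SpaceV Ω) : ∃ τ, IsTrace v τ := by
  obtain ⟨C, hC, htr⟩ := trace_eLpNorm_le hΩ
  have hlim := hΩ.isSmoothLimit (Lp.stronglyMeasurable (W1p.toLp v))
    (Lp.stronglyMeasurable (W1p.grad v)) (Lp.memLp _) (Lp.memLp _) v.2
  choose φ hφ h1 h2 using fun k : ℕ => hlim ((k : ℝ≥0∞) + 1)⁻¹ (by simp)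
  have hvm := (Lp.memLp (W1p.toLp v)).1
  have hgm := (Lp.memLp (W1p.grad v)).1
  have hm : ∀ k, MemLp (φ k) 2 (surfaceMeasure Ω) := by
    intro k
    refine ⟨(hφ k).continuous.aestronglyMeasurable, (htr _ (hφ k)).trans_lt ?_⟩
    have hk : ((k : ℝ≥0∞) + 1)⁻¹ < ⊤ := by simp
    have e1 := (eLpNorm_le_sub_add (hφ k).continuous.aestronglyMeasurable hvm).trans_lt
      (ENNReal.add_lt_top.2 ⟨(h1 k).trans_lt hk, (Lp.memLp (W1p.toLp v)).2⟩)
    have e2 := (eLpNorm_le_sub_add (continuous_gradient (hφ k)).aestronglyMeasurable hgm).trans_lt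
      (ENNReal.add_lt_top.2 ⟨(h2 k).trans_lt hk, (Lp.memLp (W1p.grad v)).2⟩)
    exact ENNReal.mul_lt_top hC.lt_top (ENNReal.add_lt_top.2 ⟨e1, e2⟩)
  have hinv : Tendsto (fun k : ℕ => ((k : ℝ≥0∞) + 1)⁻¹) atTop (𝓝 0) := by
    have := (tendsto_add_atTop_iff_nat 1).2 ENNReal.tendsto_inv_nat_nhds_zero
    simpa using this
  have hcau : CauchySeq fun k => (hm k).toLp (φ k) := by
    refine EMetric.cauchySeq_iff_le_tendsto_0.2
      ⟨fun k : ℕ => C * (4 * ((k : ℝ≥0∞) + 1)⁻¹), ?_, ?_⟩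
    · intro k l K hk hl
      rw [Lp.edist_toLp_toLp]
      have hmon : ∀ m : ℕ, K ≤ m → ((m : ℝ≥0∞) + 1)⁻¹ ≤ ((K : ℝ≥0∞) + 1)⁻¹ := fun m hm => by
        gcongr
      refine (htr (φ k - φ l) ((hφ k).sub (hφ l))).trans (mul_le_mul' le_rfl ?_)
      have e1 : eLpNorm (φ k - φ l) 2 (volume.restrict Ω) ≤
          ((K : ℝ≥0∞) + 1)⁻¹ + ((K : ℝ≥0∞) + 1)⁻¹ := by
        have : φ k - φ l = (fun x => φ k x - W1p.toLp v x) - fun x => φ l x - W1p.toLp v x := by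
          funext x; simp
        rw [this]
        exact (eLpNorm_sub_le ((hφ k).continuous.aestronglyMeasurable.sub hvm)
          ((hφ l).continuous.aestronglyMeasurable.sub hvm) one_le_two).trans
          (add_le_add ((h1 k).trans (hmon k hk)) ((h1 l).trans (hmon l hl)))
      have e2 : eLpNorm (gradient (φ k - φ l)) 2 (volume.restrict Ω) ≤
          ((K : ℝ≥0∞) + 1)⁻¹ + ((K : ℝ≥0∞) + 1)⁻¹ := by
        have : gradient (φ k - φ l) =
            (fun x => gradient (φ k) x - W1p.grad v x) -
              fun x => gradient (φ l) x - W1p.grad v x := by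
          funext x
          ext i
          simp only [Pi.sub_apply, PiLp.sub_apply, gradient_apply]
          rw [fderiv_sub ((hφ k).differentiable (by simp) x) ((hφ l).differentiable (by simp) x)]
          simp
        rw [this]
        exact (eLpNorm_sub_le ((continuous_gradient (hφ k)).aestronglyMeasurable.sub hgm)
          ((continuous_gradient (hφ l)).aestronglyMeasurable.sub hgm) one_le_two).trans
          (add_le_add ((h2 k).trans (hmon k hk)) ((h2 l).trans (hmon l hl)))
      refine (add_le_add e1 e2).trans (le_of_eq ?_)
      ring
    · have h3 := ENNReal.Tendsto.const_mul (ENNReal.Tendsto.const_mul hinv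
        (Or.inr (by simp : (4 : ℝ≥0∞) ≠ ⊤))) (Or.inr hC)
      simpa using h3
  obtain ⟨τ, hτ⟩ := cauchySeq_tendsto_of_complete hcau
  refine ⟨τ, φ, hφ, tendsto_of_tendsto_of_tendsto_of_le_of_le tendsto_const_nhds hinv
    (fun _ => zero_le) h1, tendsto_of_tendsto_of_tendsto_of_le_of_le tendsto_const_nhds hinv
    (fun _ => zero_le) h2, ?_⟩
  have h4 := (tendsto_iff_edist_tendsto_0).1 hτ
  refine h4.congr fun k => ?_
  rw [Lp.edist_def]
  refine eLpNorm_congr_ae ?_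
  filter_upwards [(hm k).coeFn_toLp] with x hx
  rw [Pi.sub_apply, hx]

lemma tendsto_eLpNorm_add_zero {α F : Type*} [MeasurableSpace α] {μ : Measure α}
    [NormedAddCommGroup F] {f g : ℕ → α → F} (hf : ∀ k, AEStronglyMeasurable (f k) μ)
    (hg : ∀ k, AEStronglyMeasurable (g k) μ)
    (h1 : Tendsto (fun k => eLpNorm (f k) 2 μ) atTop (𝓝 0))
    (h2 : Tendsto (fun k => eLpNorm (g k) 2 μ) atTop (𝓝 0)) :
    Tendsto (fun k => eLpNorm (f k + g k) 2 μ) atTop (𝓝 0) := by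
  have h3 := h1.add h2
  rw [add_zero] at h3
  exact tendsto_of_tendsto_of_tendsto_of_le_of_le tendsto_const_nhds h3
    (fun _ => zero_le) fun k => eLpNorm_add_le (hf k) (hg k) one_le_two

lemma IsTrace.add {N : ℕ} {Ω : Set (Eucl N)} {v v' : SpaceV Ω}
    {τ τ' : Lp ℝ 2 (surfaceMeasure Ω)} (h : IsTrace v τ) (h' : IsTrace v' τ') :
    IsTrace (v + v') (τ + τ') := by
  obtain ⟨φ, hφ, h1, h2, h3⟩ := h
  obtain ⟨φ', hφ', h1', h2', h3'⟩ := h'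
  refine ⟨fun k x => φ k x + φ' k x, fun k => (hφ k).add (hφ' k), ?_, ?_, ?_⟩
  · refine (tendsto_eLpNorm_add_zero (fun k => (hφ k).continuous.aestronglyMeasurable.sub
      (Lp.memLp _).1) (fun k => (hφ' k).continuous.aestronglyMeasurable.sub
      (Lp.memLp _).1) h1 h1').congr fun k => eLpNorm_congr_ae ?_
    rw [map_add]
    filter_upwards [Lp.coeFn_add (W1p.toLp v) (W1p.toLp v')] with x hx
    rw [hx]; simp only [Pi.add_apply, Pi.sub_apply]; ring
  · refine (tendsto_eLpNorm_add_zero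
      (fun k => (continuous_gradient (hφ k)).aestronglyMeasurable.sub
      (Lp.memLp _).1) (fun k => (continuous_gradient (hφ' k)).aestronglyMeasurable.sub
      (Lp.memLp _).1) h2 h2').congr fun k => eLpNorm_congr_ae ?_
    rw [map_add]
    filter_upwards [Lp.coeFn_add (W1p.grad v) (W1p.grad v')] with x hx
    rw [hx, gradient_add' (hφ k) (hφ' k)]; simp only [Pi.add_apply, Pi.sub_apply]; abel
  · refine (tendsto_eLpNorm_add_zero (fun k => (hφ k).continuous.aestronglyMeasurable.sub
      (Lp.memLp _).1) (fun k => (hφ' k).continuous.aestronglyMeasurable.sub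
      (Lp.memLp _).1) h3 h3').congr fun k => eLpNorm_congr_ae ?_
    filter_upwards [Lp.coeFn_add τ τ'] with x hx
    rw [hx]; simp only [Pi.add_apply, Pi.sub_apply]; ring

lemma IsTrace.smul {N : ℕ} {Ω : Set (Eucl N)} {v : SpaceV Ω}
    {τ : Lp ℝ 2 (surfaceMeasure Ω)} (c : ℝ) (h : IsTrace v τ) : IsTrace (c • v) (c • τ) := by
  obtain ⟨φ, hφ, h1, h2, h3⟩ := h
  have key : ∀ {F : Type} [NormedAddCommGroup F] [NormedSpace ℝ F] {μ : Measure (Eucl N)}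
      {f : ℕ → Eucl N → F}, Tendsto (fun k => eLpNorm (f k) 2 μ) atTop (𝓝 0) →
      Tendsto (fun k => eLpNorm (c • f k) 2 μ) atTop (𝓝 0) := by
    intro F _ _ μ f hf
    simp_rw [eLpNorm_const_smul]
    simpa using ENNReal.Tendsto.const_mul hf (Or.inr (by simp : ‖c‖ₑ ≠ ⊤))
  refine ⟨fun k x => c * φ k x, fun k => contDiff_const.mul (hφ k), ?_, ?_, ?_⟩
  · refine (key h1).congr fun k => eLpNorm_congr_ae ?_
    rw [map_smul]
    filter_upwards [Lp.coeFn_smul c (W1p.toLp v)] with x hx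
    rw [hx]; simp only [Pi.smul_apply, smul_eq_mul]; ring
  · refine (key h2).congr fun k => eLpNorm_congr_ae ?_
    rw [map_smul]
    filter_upwards [Lp.coeFn_smul c (W1p.grad v)] with x hx
    have : gradient (fun x => c * φ k x) x = c • gradient (φ k) x := by
      ext i
      rw [PiLp.smul_apply, gradient_apply, gradient_apply,
        fderiv_const_mul ((hφ k).differentiable (by simp) x)]
      rfl
    rw [hx, this]; simp only [Pi.smul_apply, smul_sub]
  · refine (key h3).congr fun k => eLpNorm_congr_ae ?_
    filter_upwards [Lp.coeFn_smul c τ] with x hx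
    rw [hx]; simp only [Pi.smul_apply, smul_eq_mul]; ring

lemma IsTrace.eLpNorm_le {n : ℕ} {Ω : Set (Eucl (n + 1))} {C : ℝ≥0∞} (hC : C ≠ ⊤)
    (htr : ∀ φ : Eucl (n + 1) → ℝ, ContDiff ℝ ∞ φ → eLpNorm φ 2 (surfaceMeasure Ω) ≤
        C * (eLpNorm φ 2 (volume.restrict Ω) + eLpNorm (gradient φ) 2 (volume.restrict Ω)))
    {v : SpaceV Ω} {τ : Lp ℝ 2 (surfaceMeasure Ω)} (h : IsTrace v τ) :
    eLpNorm τ 2 (surfaceMeasure Ω) ≤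
      C * (eLpNorm (W1p.toLp v) 2 (volume.restrict Ω) +
        eLpNorm (W1p.grad v) 2 (volume.restrict Ω)) := by
  obtain ⟨φ, hφ, h1, h2, h3⟩ := h
  have hlim := h3.add (ENNReal.Tendsto.const_mul
    ((h1.add_const (eLpNorm (W1p.toLp v) 2 (volume.restrict Ω))).add
      (h2.add_const (eLpNorm (W1p.grad v) 2 (volume.restrict Ω)))) (Or.inr hC))
  simp only [zero_add] at hlim
  refine ge_of_tendsto' hlim fun k => ?_
  refine (eLpNorm_le_sub_add' (hφ k).continuous.aestronglyMeasurable (Lp.memLp τ).1).trans ?_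
  gcongr
  refine (htr _ (hφ k)).trans ?_
  gcongr
  · exact eLpNorm_le_sub_add (hφ k).continuous.aestronglyMeasurable (Lp.memLp _).1
  · exact eLpNorm_le_sub_add (continuous_gradient (hφ k)).aestronglyMeasurable (Lp.memLp _).1

lemma IsTrace.friedrichs {n : ℕ} {Ω : Set (Eucl (n + 1))} {C : ℝ≥0∞} (hC : C ≠ ⊤)
    (hfr : ∀ φ : Eucl (n + 1) → ℝ, ContDiff ℝ ∞ φ → eLpNorm φ 2 (volume.restrict Ω) ≤
        C * (eLpNorm (gradient φ) 2 (volume.restrict Ω) + eLpNorm φ 2 (surfaceMeasure Ω)))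
    {v : SpaceV Ω} {τ : Lp ℝ 2 (surfaceMeasure Ω)} (h : IsTrace v τ) :
    eLpNorm (W1p.toLp v) 2 (volume.restrict Ω) ≤
      C * (eLpNorm (W1p.grad v) 2 (volume.restrict Ω) + eLpNorm τ 2 (surfaceMeasure Ω)) := by
  obtain ⟨φ, hφ, h1, h2, h3⟩ := h
  have hlim := h1.add (ENNReal.Tendsto.const_mul
    ((h2.add_const (eLpNorm (W1p.grad v) 2 (volume.restrict Ω))).add
      (h3.add_const (eLpNorm τ 2 (surfaceMeasure Ω)))) (Or.inr hC))
  simp only [zero_add] at hlim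
  refine ge_of_tendsto' hlim fun k => ?_
  refine (eLpNorm_le_sub_add' (hφ k).continuous.aestronglyMeasurable (Lp.memLp _).1).trans ?_
  gcongr
  refine (hfr _ (hφ k)).trans ?_
  gcongr
  · exact eLpNorm_le_sub_add (continuous_gradient (hφ k)).aestronglyMeasurable (Lp.memLp _).1
  · exact eLpNorm_le_sub_add (hφ k).continuous.aestronglyMeasurable (Lp.memLp _).1

lemma IsTrace.unique {n : ℕ} {Ω : Set (Eucl (n + 1))} (hΩ : IsBoundedSmoothOpen Ω)
    {v : SpaceV Ω} {τ τ' : Lp ℝ 2 (surfaceMeasure Ω)} (h : IsTrace v τ) (h' : IsTrace v τ') :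
    τ = τ' := by
  obtain ⟨C, hC, htr⟩ := trace_eLpNorm_le hΩ
  have h1 := (h.add (h'.smul (-1))).eLpNorm_le hC htr
  have hv : v + (-1 : ℝ) • v = 0 := by rw [neg_one_smul, add_neg_cancel]
  rw [hv, map_zero, map_zero, eLpNorm_congr_ae (Lp.coeFn_zero ℝ 2 _),
    eLpNorm_congr_ae (Lp.coeFn_zero (Eucl (n + 1)) 2 _), eLpNorm_zero, eLpNorm_zero, add_zero,
    mul_zero, nonpos_iff_eq_zero, ← Lp.enorm_def, enorm_eq_zero, neg_one_smul] at h1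
  exact add_neg_eq_zero.1 h1

lemma isTrace_trace {n : ℕ} {Ω : Set (Eucl (n + 1))} (hΩ : IsBoundedSmoothOpen Ω)
    (v : SpaceV Ω) : IsTrace v (trace v) := by
  have h := exists_isTrace hΩ v
  rw [trace, dif_pos h]
  exact h.choose_spec

lemma IsBoundedSmoothOpen.trace_add {n : ℕ} {Ω : Set (Eucl (n + 1))} (hΩ : IsBoundedSmoothOpen Ω)
    (v w : SpaceV Ω) : trace (v + w) = trace v + trace w :=
  (isTrace_trace hΩ (v + w)).unique hΩ ((isTrace_trace hΩ v).add (isTrace_trace hΩ w))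

lemma IsBoundedSmoothOpen.trace_smul {n : ℕ} {Ω : Set (Eucl (n + 1))}
    (hΩ : IsBoundedSmoothOpen Ω) (c : ℝ) (v : SpaceV Ω) : trace (c • v) = c • trace v :=
  (isTrace_trace hΩ (c • v)).unique hΩ ((isTrace_trace hΩ v).smul c)

lemma IsBoundedSmoothOpen.norm_trace_le {n : ℕ} {Ω : Set (Eucl (n + 1))}
    (hΩ : IsBoundedSmoothOpen Ω) : ∃ C : ℝ, ∀ v : SpaceV Ω, ‖trace v‖ ≤ C * ‖v‖ := by
  obtain ⟨C, hC, htr⟩ := trace_eLpNorm_le hΩ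
  refine ⟨C.toReal * 2, fun v => ?_⟩
  have h := (isTrace_trace hΩ v).eLpNorm_le hC htr
  have h' := ENNReal.toReal_mono (by finiteness [(Lp.memLp (W1p.toLp v)).2.ne,
    (Lp.memLp (W1p.grad v)).2.ne]) h
  rw [ENNReal.toReal_mul, ENNReal.toReal_add (Lp.memLp (W1p.toLp v)).2.ne
    (Lp.memLp (W1p.grad v)).2.ne, ← Lp.norm_def, ← Lp.norm_def, ← Lp.norm_def] at h'
  refine h'.trans ?_
  rw [mul_assoc]
  refine mul_le_mul_of_nonneg_left ?_ ENNReal.toReal_nonneg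
  have h1 := SpaceV.norm_sq_eq v
  nlinarith [norm_nonneg v, norm_nonneg (W1p.toLp v), norm_nonneg (W1p.grad v),
    sq_nonneg (‖W1p.toLp v‖ - ‖W1p.grad v‖)]

lemma IsBoundedSmoothOpen.norm_toLp_le {n : ℕ} {Ω : Set (Eucl (n + 1))}
    (hΩ : IsBoundedSmoothOpen Ω) :
    ∃ C : ℝ, ∀ v : SpaceV Ω, ‖W1p.toLp v‖ ≤ C * (‖W1p.grad v‖ + ‖trace v‖) := by
  obtain ⟨C, hC, hfr⟩ := friedrichs_eLpNorm_le hΩ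
  refine ⟨C.toReal, fun v => ?_⟩
  have h := (isTrace_trace hΩ v).friedrichs hC hfr
  have h' := ENNReal.toReal_mono (by finiteness [(Lp.memLp (W1p.grad v)).2.ne,
    (Lp.memLp (trace v)).2.ne]) h
  rwa [ENNReal.toReal_mul, ENNReal.toReal_add (Lp.memLp (W1p.grad v)).2.ne
    (Lp.memLp (trace v)).2.ne, ← Lp.norm_def, ← Lp.norm_def, ← Lp.norm_def] at h'

/-- The trace `H¹(Ω) → L²(Γ)` as a bounded operator. -/
def traceL {n : ℕ} {Ω : Set (Eucl (n + 1))} (hΩ : IsBoundedSmoothOpen Ω) :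
    SpaceV Ω →L[ℝ] Lp ℝ 2 (surfaceMeasure Ω) :=
  LinearMap.mkContinuousOfExistsBound
    { toFun := trace, map_add' := hΩ.trace_add, map_smul' := hΩ.trace_smul } hΩ.norm_trace_le

/-! ### The Robin form -/

/-- The bilinear form `(v, w) ↦ (G v, G w)`. -/
def innerComp {E F : Type*} [NormedAddCommGroup E] [InnerProductSpace ℝ E] [NormedAddCommGroup F]
    [InnerProductSpace ℝ F] (G : E →L[ℝ] F) : E →L[ℝ] E →L[ℝ] ℝ :=
  (innerSL ℝ).bilinearComp G G

/-- The form `a(v, w) = ∫_Ω ∇v · ∇w + γ ∫_Γ v w` as a bounded bilinear form on `H¹(Ω)`. -/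
def robinL {n : ℕ} {Ω : Set (Eucl (n + 1))} (hΩ : IsBoundedSmoothOpen Ω) (γ : ℝ) :
    SpaceV Ω →L[ℝ] SpaceV Ω →L[ℝ] ℝ :=
  innerComp W1p.grad + γ • innerComp (traceL hΩ)

lemma robinL_apply {n : ℕ} {Ω : Set (Eucl (n + 1))} (hΩ : IsBoundedSmoothOpen Ω) (γ : ℝ)
    (v w : SpaceV Ω) : robinL hΩ γ v w =
      inner ℝ (W1p.grad v) (W1p.grad w) + γ * inner ℝ (trace v) (trace w) := rfl

lemma robinForm_eq_robinL {n : ℕ} {Ω : Set (Eucl (n + 1))} (hΩ : IsBoundedSmoothOpen Ω) (γ : ℝ)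
    (v w : SpaceV Ω) : robinForm γ v w = robinL hΩ γ v w := by
  rw [robinL_apply, L2.inner_def, L2.inner_def, robinForm, gradForm]
  congr 2
  refine integral_congr_ae (ae_of_all _ fun x => ?_)
  simp [mul_comm]

lemma robinL_symm {n : ℕ} {Ω : Set (Eucl (n + 1))} (hΩ : IsBoundedSmoothOpen Ω) (γ : ℝ)
    (v w : SpaceV Ω) : robinL hΩ γ v w = robinL hΩ γ w v := by
  rw [robinL_apply, robinL_apply, real_inner_comm, real_inner_comm (trace v)]

lemma isCoercive_robinL {n : ℕ} {Ω : Set (Eucl (n + 1))} (hΩ : IsBoundedSmoothOpen Ω) {γ : ℝ}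
    (hγ : 0 < γ) : IsCoercive (robinL hΩ γ) := by
  -- `m (‖∇v‖² + ‖v|_Γ‖²) ≤ a(v, v)`, and the Friedrichs inequality gives `‖v‖_V² ≤ D (…)`.
  obtain ⟨C, hC⟩ := hΩ.norm_toLp_le
  set m := min 1 γ with hm
  have hm0 : 0 < m := lt_min one_pos hγ
  set D := 2 * C ^ 2 + 1 with hD
  have hD0 : 0 < D := by positivity
  refine ⟨m / D, by positivity, fun v => ?_⟩
  have h1 : robinL hΩ γ v v = ‖W1p.grad v‖ ^ 2 + γ * ‖trace v‖ ^ 2 := by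
    rw [robinL_apply, real_inner_self_eq_norm_sq, real_inner_self_eq_norm_sq]
  have h2 : m * (‖W1p.grad v‖ ^ 2 + ‖trace v‖ ^ 2) ≤ robinL hΩ γ v v := by
    rw [h1]
    have h3 : m ≤ 1 := min_le_left _ _
    have h4 : m ≤ γ := min_le_right _ _
    nlinarith [sq_nonneg ‖W1p.grad v‖, sq_nonneg ‖trace v‖]
  have h5 : ‖W1p.toLp v‖ ^ 2 ≤ 2 * C ^ 2 * (‖W1p.grad v‖ ^ 2 + ‖trace v‖ ^ 2) := by
    have h6 : ‖W1p.toLp v‖ ^ 2 ≤ (C * (‖W1p.grad v‖ + ‖trace v‖)) ^ 2 :=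
      pow_le_pow_left₀ (norm_nonneg _) (hC v) 2
    rw [mul_pow] at h6
    nlinarith [sq_nonneg C, mul_nonneg (sq_nonneg C) (sq_nonneg (‖W1p.grad v‖ - ‖trace v‖))]
  have h7 : ‖v‖ ^ 2 ≤ D * (‖W1p.grad v‖ ^ 2 + ‖trace v‖ ^ 2) := by
    rw [SpaceV.norm_sq_eq, hD]
    nlinarith [sq_nonneg ‖trace v‖]
  calc m / D * ‖v‖ * ‖v‖ = m / D * ‖v‖ ^ 2 := by ring
    _ ≤ m / D * (D * (‖W1p.grad v‖ ^ 2 + ‖trace v‖ ^ 2)) := by gcongr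
    _ = m * (‖W1p.grad v‖ ^ 2 + ‖trace v‖ ^ 2) := by field_simp
    _ ≤ _ := h2

/-! ### Decay for an abstract degenerate evolution equation -/

/-- Some time of a set of full measure realizes a value not above the mean. -/
lemma exists_mem_Ioo_le_integral {G : Set ℝ} (hG : ∀ᵐ t ∂(volume.restrict (Ioi (0 : ℝ))), t ∈ G)
    {a b : ℝ} (ha : 0 ≤ a) (hab : a < b) {f : ℝ → ℝ} (hf : IntervalIntegrable f volume a b) :
    ∃ x ∈ Ioo a b, x ∈ G ∧ (b - a) * f x ≤ ∫ t in a..b, f t := by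
  have hμ : volume.restrict (Ioo a b) ≠ 0 := by
    rw [Ne, Measure.restrict_eq_zero, Real.volume_Ioo]
    simpa using hab
  have hfi : IntegrableOn f (Ioo a b) :=
    ((intervalIntegrable_iff_integrableOn_Ioo_of_le hab.le).1 hf)
  have hN : volume.restrict (Ioo a b) {x | ¬ (x ∈ G ∧ x ∈ Ioo a b)} = 0 := by
    have h1 : ∀ᵐ t ∂(volume.restrict (Ioo a b)), t ∈ G :=
      ae_restrict_of_ae_restrict_of_subset (fun t ht => ha.trans_lt ht.1) hG
    exact ae_iff.1 (h1.and (ae_restrict_mem measurableSet_Ioo))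
  obtain ⟨x, hx, hle⟩ := exists_notMem_null_le_average hμ hfi hN
  have hx' : x ∈ G ∧ x ∈ Ioo a b := not_not.1 hx
  refine ⟨x, hx'.2, hx'.1, ?_⟩
  rw [setAverage_eq, Real.volume_real_Ioo_of_le hab.le, smul_eq_mul, inv_mul_eq_div,
    le_div_iff₀ (sub_pos.2 hab), mul_comm] at hle
  rwa [intervalIntegral.integral_of_le hab.le, integral_Ioc_eq_integral_Ioo]

lemma exists_mem_Ioo_of_ae {G : Set ℝ} (hG : ∀ᵐ t ∂(volume.restrict (Ioi (0 : ℝ))), t ∈ G)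
    {a b : ℝ} (ha : 0 ≤ a) (hab : a < b) : ∃ x ∈ Ioo a b, x ∈ G := by
  obtain ⟨x, hx, hxG, _⟩ := exists_mem_Ioo_le_integral hG ha hab (f := fun _ => 0) (by simp)
  exact ⟨x, hx, hxG⟩

lemma nhdsWithin_inter_Ioi_neBot {G : Set ℝ}
    (hG : ∀ᵐ t ∂(volume.restrict (Ioi (0 : ℝ))), t ∈ G) {s : ℝ} (hs : 0 ≤ s) :
    (𝓝[G ∩ Ioi s] s).NeBot := by
  rw [← mem_closure_iff_nhdsWithin_neBot, Metric.mem_closure_iff]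
  intro ε hε
  obtain ⟨x, hx, hxG⟩ := exists_mem_Ioo_of_ae hG hs (lt_add_of_pos_right s hε)
  refine ⟨x, ⟨hxG, hx.1⟩, ?_⟩
  rw [dist_comm, Real.dist_eq, abs_of_pos (sub_pos.2 hx.1)]
  linarith [hx.2]

lemma MeasureTheory.MemLp.intervalIntegrable_of_timeMeasure {H : Type*} [NormedAddCommGroup H]
    {f : ℝ → H} (hf : ∀ T, MemLp f 2 (timeMeasure T)) {a b : ℝ} (ha : 0 ≤ a) (hb : 0 ≤ b) :
    IntervalIntegrable f volume a b := by
  have h : ∀ b, 0 ≤ b → IntervalIntegrable f volume 0 b := fun b hb => by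
    rw [intervalIntegrable_iff_integrableOn_Ioo_of_le hb]
    exact (hf b).integrable one_le_two
  exact (h a ha).symm.trans (h b hb)

lemma MeasureTheory.MemLp.intervalIntegrable_norm_sq {H : Type*} [NormedAddCommGroup H]
    {f : ℝ → H} (hf : ∀ T, MemLp f 2 (timeMeasure T)) {a b : ℝ} (ha : 0 ≤ a) (hb : 0 ≤ b) :
    IntervalIntegrable (fun t => ‖f t‖ ^ 2) volume a b := by
  have h : ∀ b, 0 ≤ b → IntervalIntegrable (fun t => ‖f t‖ ^ 2) volume 0 b := fun b hb => by
    rw [intervalIntegrable_iff_integrableOn_Ioo_of_le hb]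
    exact (memLp_two_iff_integrable_sq_norm (hf b).1).1 (hf b)
  exact (h a ha).symm.trans (h b hb)

section Evolution

variable {V H : Type*} [NormedAddCommGroup V] [InnerProductSpace ℝ V]
  [NormedAddCommGroup H] [InnerProductSpace ℝ H]

/-- The data of the evolution equation `u' + A p = 0`, `p ≥ u ≥ 0`, integrated in time and inverted:
`a` is the form of `A`, and `W = A⁻¹ u` satisfies `W' = -p`. The equations hold for times in a set
`G ⊆ (0, ∞)` of full measure. -/
structure IsDissipativeFlow (a : V →L[ℝ] V →L[ℝ] ℝ) (j : V →L[ℝ] H) (G : Set ℝ) (W : ℝ → V)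
    (u p : ℝ → H) : Prop where
  symm : ∀ v w, a v w = a w v
  coercive : IsCoercive a
  injective : Function.Injective j
  subset_Ioi : G ⊆ Ioi 0
  ae_mem : ∀ᵐ t ∂(volume.restrict (Ioi 0)), t ∈ G
  u_mem : ∀ T, MemLp u 2 (timeMeasure T)
  p_mem : ∀ T, MemLp p 2 (timeMeasure T)
  inner_nonneg : ∀ s ∈ G, ∀ t ∈ G, 0 ≤ inner ℝ (u s) (p t)
  norm_sq_le : ∀ t ∈ G, ‖u t‖ ^ 2 ≤ inner ℝ (u t) (p t)
  elliptic : ∀ t ∈ G, ∀ w, a (W t) w = inner ℝ (u t) (j w)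
  evolution : ∀ t ∈ G, j (W t) = j (W 0) - ∫ r in (0 : ℝ)..t, p r

namespace IsDissipativeFlow

variable {a : V →L[ℝ] V →L[ℝ] ℝ} {j : V →L[ℝ] H} {G : Set ℝ} {W : ℝ → V} {u p : ℝ → H}

lemma intervalIntegrable_p (h : IsDissipativeFlow a j G W u p) {s t : ℝ} (hs : 0 ≤ s)
    (ht : 0 ≤ t) : IntervalIntegrable p volume s t :=
  MemLp.intervalIntegrable_of_timeMeasure h.p_mem hs ht

lemma neBot (h : IsDissipativeFlow a j G W u p) {s : ℝ} (hs : 0 ≤ s) : (𝓝[G] s).NeBot :=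
  (nhdsWithin_inter_Ioi_neBot h.ae_mem hs).mono (nhdsWithin_mono _ inter_subset_left)

lemma neBot_insert (h : IsDissipativeFlow a j G W u p) {s : ℝ} (hs : 0 ≤ s) :
    (𝓝[insert 0 G] s).NeBot :=
  (h.neBot hs).mono (nhdsWithin_mono _ (subset_insert _ _))

/-- The energy is equivalent to a dual norm of `u`, which the norm of `H` dominates. -/
lemma energy_le_norm_sq (h : IsDissipativeFlow a j G W u p) :
    ∃ K : ℝ, 0 < K ∧ ∀ t ∈ G, a (W t) (W t) ≤ K * ‖u t‖ ^ 2 := by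
  obtain ⟨c, hc, hcoe⟩ := h.coercive
  refine ⟨‖j‖ ^ 2 / c + 1, by positivity, fun t ht => ?_⟩
  set y := a (W t) (W t) with hy
  have h1 : y ≤ ‖u t‖ * (‖j‖ * ‖W t‖) := by
    rw [hy, h.elliptic t ht]
    exact (real_inner_le_norm _ _).trans (by gcongr; exact j.le_opNorm _)
  have h2 := hcoe (W t)
  have h3 : c * y ≤ ‖j‖ ^ 2 * ‖u t‖ ^ 2 := by
    nlinarith [sq_nonneg (c * ‖W t‖ - ‖j‖ * ‖u t‖), norm_nonneg (W t), hc]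
  have h4 : y ≤ ‖j‖ ^ 2 / c * ‖u t‖ ^ 2 := by
    rw [div_mul_eq_mul_div, le_div_iff₀ hc]
    linarith
  nlinarith [sq_nonneg ‖u t‖]

lemma j_sub (h : IsDissipativeFlow a j G W u p) {s t : ℝ} (hs : s ∈ insert 0 G) (ht : t ∈ G) :
    j (W s - W t) = ∫ r in s..t, p r := by
  have ht0 : 0 ≤ t := le_of_lt (h.subset_Ioi ht)
  rcases hs with rfl | hs
  · rw [map_sub, h.evolution t ht, sub_sub_cancel]
  · have hs0 : 0 ≤ s := le_of_lt (h.subset_Ioi hs)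
    rw [map_sub, h.evolution t ht, h.evolution s hs, sub_sub_sub_cancel_left,
      intervalIntegral.integral_interval_sub_left (h.intervalIntegrable_p le_rfl ht0)
        (h.intervalIntegrable_p le_rfl hs0)]

lemma energy_sub (h : IsDissipativeFlow a j G W u p) {s t : ℝ} (hs : s ∈ G) (ht : t ∈ G) :
    a (W s) (W s) - a (W t) (W t) = inner ℝ (u s) (∫ r in s..t, p r) +
      inner ℝ (u t) (∫ r in s..t, p r) := by
  rw [← h.j_sub (mem_insert_of_mem _ hs) ht, ← h.elliptic s hs, ← h.elliptic t ht]
  have h2 := h.symm (W s) (W t)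
  simp only [map_sub]
  linarith

variable [CompleteSpace H]

lemma inner_integral_nonneg (h : IsDissipativeFlow a j G W u p) {r s t : ℝ} (hr : r ∈ G)
    (hs : 0 ≤ s) (hst : s ≤ t) : 0 ≤ inner ℝ (u r) (∫ τ in s..t, p τ) := by
  have h1 := (innerSL ℝ (u r)).intervalIntegral_comp_comm
    (h.intervalIntegrable_p hs (hs.trans hst))
  rw [innerSL_apply_apply] at h1
  rw [← h1, intervalIntegral.integral_of_le hst]
  refine integral_nonneg_of_ae ?_
  have h2 : ∀ᵐ τ ∂(volume.restrict (Ioc s t)), τ ∈ G :=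
    ae_restrict_of_ae_restrict_of_subset (fun τ hτ => hs.trans_lt hτ.1) h.ae_mem
  filter_upwards [h2] with τ hτ using h.inner_nonneg r hr τ hτ

/-- Since `u ≥ 0` and `p ≥ 0`, the energy `y = a(W, W)` is nonincreasing, and its decrease controls
the increments of `W`. -/
lemma form_sub_le (h : IsDissipativeFlow a j G W u p) {s t : ℝ} (hs : s ∈ insert 0 G)
    (ht : t ∈ insert 0 G) (hst : s ≤ t) :
    a (W s - W t) (W s - W t) ≤ a (W s) (W s) - a (W t) (W t) := by
  have hs0 : 0 ≤ s := by
    rcases hs with rfl | hs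
    · exact le_rfl
    · exact le_of_lt (h.subset_Ioi hs)
  rcases ht with rfl | ht
  · obtain rfl : s = 0 := le_antisymm hst hs0
    simp
  · have h1 : 0 ≤ a (W t) (W s - W t) := by
      rw [h.elliptic t ht, h.j_sub hs ht]
      exact h.inner_integral_nonneg ht hs0 hst
    have h2 := h.symm (W s) (W t)
    simp only [map_sub, sub_apply] at h1 ⊢
    linarith

lemma energy_sub_le (h : IsDissipativeFlow a j G W u p) {s t : ℝ} (hs : s ∈ G) (ht : t ∈ G)
    (hst : s ≤ t) : a (W s) (W s) - a (W t) (W t) ≤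
      (t - s) * (‖u s‖ ^ 2 + ‖u t‖ ^ 2) / 2 + ∫ r in s..t, ‖p r‖ ^ 2 := by
  have hs0 : 0 ≤ s := le_of_lt (h.subset_Ioi hs)
  have ht0 : 0 ≤ t := hs0.trans hst
  have key : ∀ r ∈ G, inner ℝ (u r) (∫ τ in s..t, p τ) ≤
      (t - s) * ‖u r‖ ^ 2 / 2 + (∫ τ in s..t, ‖p τ‖ ^ 2) / 2 := by
    intro r _
    have h1 := (innerSL ℝ (u r)).intervalIntegral_comp_comm (h.intervalIntegrable_p hs0 ht0)
    rw [innerSL_apply_apply] at h1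
    rw [← h1]
    have hi : IntervalIntegrable (fun τ => innerSL ℝ (u r) (p τ)) volume s t := by
      rw [intervalIntegrable_iff]
      exact (innerSL ℝ (u r)).integrable_comp
        (intervalIntegrable_iff.1 (h.intervalIntegrable_p hs0 ht0))
    have hp2 := MemLp.intervalIntegrable_norm_sq h.p_mem hs0 ht0
    have h2 : ∫ τ in s..t, innerSL ℝ (u r) (p τ) ≤
        ∫ τ in s..t, (‖u r‖ ^ 2 / 2 + ‖p τ‖ ^ 2 / 2) := by
      refine intervalIntegral.integral_mono_on hst hi
        (intervalIntegrable_const.add (hp2.div_const 2)) fun τ _ => ?_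
      have h3 := real_inner_le_norm (u r) (p τ)
      rw [innerSL_apply_apply]
      nlinarith [sq_nonneg (‖u r‖ - ‖p τ‖)]
    rw [intervalIntegral.integral_add intervalIntegrable_const (hp2.div_const 2),
      intervalIntegral.integral_const, intervalIntegral.integral_div, smul_eq_mul] at h2
    linarith
  rw [h.energy_sub hs ht]
  have h1 := key s hs
  have h2 := key t ht
  linarith

/-- The energy has no jump at a positive time: on both sides one can choose times at which `‖u‖²`
does not exceed its mean. -/
lemma exists_energy_sub_lt (h : IsDissipativeFlow a j G W u p) {t₀ ε : ℝ} (ht₀ : 0 < t₀)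
    (hε : 0 < ε) : ∃ s ∈ G, ∃ t ∈ G, s < t₀ ∧ t₀ < t ∧
      a (W s) (W s) - a (W t) (W t) < ε := by
  set m : ℝ → ℝ := fun r => ‖u r‖ ^ 2 + ‖p r‖ ^ 2 with hm
  have hmi : ∀ {s t : ℝ}, 0 ≤ s → 0 ≤ t → IntervalIntegrable m volume s t := fun hs ht =>
    (MemLp.intervalIntegrable_norm_sq h.u_mem hs ht).add
      (MemLp.intervalIntegrable_norm_sq h.p_mem hs ht)
  set F : ℝ → ℝ := fun t => ∫ r in (0 : ℝ)..t, m r with hF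
  have hFc : ContinuousAt F t₀ := by
    have h1 := intervalIntegral.continuousOn_primitive_interval' (a := 0)
      (hmi le_rfl (by linarith : 0 ≤ t₀ + 1)) left_mem_uIcc
    rw [uIcc_of_le (by linarith)] at h1
    exact h1.continuousAt (Icc_mem_nhds ht₀ (by linarith))
  obtain ⟨δ', hδ', hδ⟩ := Metric.continuousAt_iff.1 hFc (ε / 8) (by positivity)
  set δ := min (δ' / 2) (t₀ / 2) with hδdef
  have hδ0 : 0 < δ := by positivity
  have hδ1 : δ < δ' := (min_le_left _ _).trans_lt (half_lt_self hδ')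
  have hδ2 : δ < t₀ := (min_le_right _ _).trans_lt (half_lt_self ht₀)
  have hl : |F (t₀ - δ) - F t₀| < ε / 8 := by
    have := hδ (x := t₀ - δ) (by rw [Real.dist_eq]; simpa [abs_of_pos hδ0] using hδ1)
    rwa [Real.dist_eq] at this
  have hr : |F (t₀ + δ) - F t₀| < ε / 8 := by
    have := hδ (x := t₀ + δ) (by rw [Real.dist_eq]; simpa [abs_of_pos hδ0] using hδ1)
    rwa [Real.dist_eq] at this
  have e1 : ∫ r in (t₀ - δ)..t₀, m r = F t₀ - F (t₀ - δ) :=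
    (intervalIntegral.integral_interval_sub_left (hmi le_rfl ht₀.le)
      (hmi le_rfl (by linarith))).symm
  have e2 : ∫ r in t₀..(t₀ + δ), m r = F (t₀ + δ) - F t₀ :=
    (intervalIntegral.integral_interval_sub_left (hmi le_rfl (by linarith))
      (hmi le_rfl ht₀.le)).symm
  have i1 : ∫ r in (t₀ - δ)..t₀, m r < ε / 8 := by rw [e1]; linarith [(abs_lt.1 hl).1]
  have i2 : ∫ r in t₀..(t₀ + δ), m r < ε / 8 := by rw [e2]; linarith [(abs_lt.1 hr).2]
  obtain ⟨s, hs, hsG, hsm⟩ := exists_mem_Ioo_le_integral h.ae_mem (a := t₀ - δ) (b := t₀)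
    (by linarith) (by linarith) (hmi (by linarith) ht₀.le)
  obtain ⟨t, ht, htG, htm⟩ := exists_mem_Ioo_le_integral h.ae_mem (a := t₀) (b := t₀ + δ)
    ht₀.le (by linarith) (hmi ht₀.le (by linarith))
  refine ⟨s, hsG, t, htG, hs.2, ht.1, ?_⟩
  have hs1 := hs.1
  have ht2 := ht.2
  have hst : s ≤ t := (hs.2.trans ht.1).le
  have h1 := h.energy_sub_le hsG htG hst
  have hm0 : ∀ r, 0 ≤ m r := fun r => by positivity
  have h2 : ∫ r in s..t, ‖p r‖ ^ 2 ≤ ∫ r in (t₀ - δ)..(t₀ + δ), m r := by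
    calc ∫ r in s..t, ‖p r‖ ^ 2 ≤ ∫ r in s..t, m r :=
          intervalIntegral.integral_mono_on hst
            (MemLp.intervalIntegrable_norm_sq h.p_mem (by linarith) (by linarith))
            (hmi (by linarith) (by linarith)) fun r _ => le_add_of_nonneg_left (by positivity)
      _ ≤ _ := intervalIntegral.integral_mono_interval hs1.le hst ht2.le
          (ae_of_all _ hm0) (hmi (by linarith) (by linarith))
  have h3 : ∫ r in (t₀ - δ)..(t₀ + δ), m r < ε / 4 := by
    rw [← intervalIntegral.integral_add_adjacent_intervals (b := t₀)
      (hmi (by linarith) ht₀.le) (hmi ht₀.le (by linarith))]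
    linarith
  have h4 : δ * ‖u s‖ ^ 2 < ε / 8 := by
    have : δ * ‖u s‖ ^ 2 ≤ δ * m s := by
      gcongr; exact le_add_of_nonneg_right (by positivity)
    rw [sub_sub_cancel] at hsm
    linarith
  have h5 : δ * ‖u t‖ ^ 2 < ε / 8 := by
    have : δ * ‖u t‖ ^ 2 ≤ δ * m t := by
      gcongr; exact le_add_of_nonneg_right (by positivity)
    rw [add_sub_cancel_left] at htm
    linarith
  have h6 : (t - s) * (‖u s‖ ^ 2 + ‖u t‖ ^ 2) / 2 ≤ δ * (‖u s‖ ^ 2 + ‖u t‖ ^ 2) := by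
    have : (t - s) * (‖u s‖ ^ 2 + ‖u t‖ ^ 2) ≤ (2 * δ) * (‖u s‖ ^ 2 + ‖u t‖ ^ 2) := by
      gcongr; linarith
    linarith
  linarith

/-- If the energy has small oscillation along a filter, then `W` converges along it. -/
lemma cauchy_of_energy [CompleteSpace V] (h : IsDissipativeFlow a j G W u p) {l : Filter ℝ}
    [l.NeBot]
    (hl : ∀ ε > 0, ∃ S ∈ l, S ⊆ insert 0 G ∧ ∀ s ∈ S, ∀ t ∈ S, s ≤ t →
      a (W s) (W s) - a (W t) (W t) < ε) : ∃ w, Tendsto W l (𝓝 w) := by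
  obtain ⟨c, hc, hcoe⟩ := h.coercive
  rw [← cauchy_map_iff_exists_tendsto, Metric.cauchy_iff]
  refine ⟨inferInstance, fun ε hε => ?_⟩
  obtain ⟨S, hS, hSG, hlt⟩ := hl (c * ε ^ 2) (by positivity)
  have key : ∀ s ∈ S, ∀ t ∈ S, s ≤ t → dist (W s) (W t) < ε := by
    intro s hs t ht hst
    have h1 := h.form_sub_le (hSG hs) (hSG ht) hst
    have h2 := hcoe (W s - W t)
    have h3 := hlt s hs t ht hst
    rw [dist_eq_norm]
    have h4 : ‖W s - W t‖ ^ 2 < ε ^ 2 := by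
      have : c * ‖W s - W t‖ ^ 2 < c * ε ^ 2 := by
        calc c * ‖W s - W t‖ ^ 2 = c * ‖W s - W t‖ * ‖W s - W t‖ := by ring
          _ < c * ε ^ 2 := by linarith
      exact lt_of_mul_lt_mul_left this hc.le
    exact lt_of_pow_lt_pow_left₀ 2 hε.le h4
  refine ⟨W '' S, image_mem_map hS, ?_⟩
  rintro _ ⟨s, hs, rfl⟩ _ ⟨t, ht, rfl⟩
  rcases le_total s t with hst | hst
  · exact key s hs t ht hst
  · rw [dist_comm]; exact key t ht s hs hst

/-- Continuity at time `0`. The energy decides only that a limit exists; it is `W 0` because `j ∘ W`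
is continuous and `j` is injective. -/
lemma tendsto_zero [CompleteSpace V] (h : IsDissipativeFlow a j G W u p) :
    Tendsto W (𝓝[G] 0) (𝓝 (W 0)) := by
  have := h.neBot le_rfl
  have hmono : ∀ s ∈ insert 0 G, ∀ t ∈ insert 0 G, s ≤ t → a (W t) (W t) ≤ a (W s) (W s) := by
    intro s hs t ht hst
    obtain ⟨c, hc, hcoe⟩ := h.coercive
    have h1 := h.form_sub_le hs ht hst
    have h2 := hcoe (W s - W t)
    have h3 : 0 ≤ c * ‖W s - W t‖ * ‖W s - W t‖ := by positivity
    linarith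
  have hbdd : BddAbove ((fun t => a (W t) (W t)) '' G) := by
    refine ⟨a (W 0) (W 0), ?_⟩
    rintro _ ⟨t, ht, rfl⟩
    exact hmono 0 (mem_insert _ _) t (mem_insert_of_mem _ ht) (le_of_lt (h.subset_Ioi ht))
  have hne : ((fun t => a (W t) (W t)) '' G).Nonempty := by
    obtain ⟨x, _, hx⟩ := exists_mem_Ioo_of_ae h.ae_mem le_rfl one_pos
    exact ⟨_, x, hx, rfl⟩
  obtain ⟨w, hw⟩ := h.cauchy_of_energy (l := 𝓝[G] 0) fun ε hε => by
    obtain ⟨_, ⟨s₁, hs₁, rfl⟩, hlt⟩ :=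
      exists_lt_of_lt_csSup hne (sub_lt_self (sSup ((fun t => a (W t) (W t)) '' G)) hε)
    refine ⟨G ∩ Iio s₁, inter_mem_nhdsWithin _ (Iio_mem_nhds (h.subset_Ioi hs₁)),
      fun t ht => mem_insert_of_mem _ ht.1, fun s hs t ht hst => ?_⟩
    have h1 : a (W s) (W s) ≤ sSup ((fun t => a (W t) (W t)) '' G) :=
      le_csSup hbdd ⟨s, hs.1, rfl⟩
    have h2 := hmono t (mem_insert_of_mem _ ht.1) s₁ (mem_insert_of_mem _ hs₁) (le_of_lt ht.2)
    simp only at hlt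
    linarith
  have hlim : Tendsto (fun t => j (W t)) (𝓝[G] 0) (𝓝 (j (W 0))) := by
    have h1 : ContinuousWithinAt (fun t => ∫ r in (0 : ℝ)..t, p r) (Icc 0 1) 0 := by
      have := intervalIntegral.continuousOn_primitive_interval' (a := 0)
        (h.intervalIntegrable_p le_rfl zero_le_one) left_mem_uIcc
      rw [uIcc_of_le zero_le_one] at this
      exact this 0 ⟨le_rfl, zero_le_one⟩
    have h2 : Tendsto (fun t => ∫ r in (0 : ℝ)..t, p r) (𝓝[G] 0) (𝓝 0) := by
      have h3 : Tendsto (fun t => ∫ r in (0 : ℝ)..t, p r) (𝓝[Icc 0 1] 0) (𝓝 0) := by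
        simpa using h1.tendsto
      refine h3.mono_left ?_
      refine le_inf inf_le_left (le_principal_iff.2 ?_)
      filter_upwards [self_mem_nhdsWithin, mem_nhdsWithin_of_mem_nhds (Iio_mem_nhds one_pos)]
        with t ht ht1 using ⟨le_of_lt (h.subset_Ioi ht), le_of_lt ht1⟩
    have h4 := h2.const_sub (j (W 0))
    rw [sub_zero] at h4
    refine h4.congr' ?_
    filter_upwards [self_mem_nhdsWithin] with t ht using (h.evolution t ht).symm
  have hjw : j w = j (W 0) := tendsto_nhds_unique ((j.continuous.tendsto w).comp hw) hlim
  rwa [h.injective hjw] at hw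

lemma exists_tendsto [CompleteSpace V] (h : IsDissipativeFlow a j G W u p) {t₀ : ℝ} (ht₀ : 0 ≤ t₀) :
    ∃ w, Tendsto W (𝓝[insert 0 G] t₀) (𝓝 w) := by
  rcases ht₀.eq_or_lt with rfl | hpos
  · exact ⟨W 0, continuousWithinAt_insert_self.2 h.tendsto_zero⟩
  · have := h.neBot_insert ht₀
    refine h.cauchy_of_energy fun ε hε => ?_
    obtain ⟨s₁, hs₁, t₁, ht₁, hs, ht, hlt⟩ := h.exists_energy_sub_lt hpos hε
    refine ⟨insert 0 G ∩ Ioo s₁ t₁, inter_mem_nhdsWithin _ (Ioo_mem_nhds hs ht),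
      inter_subset_left, fun s hs t ht hst => ?_⟩
    obtain ⟨c, hc, hcoe⟩ := h.coercive
    have h1 := h.form_sub_le (mem_insert_of_mem _ hs₁) hs.1 hs.2.1.le
    have h2 := h.form_sub_le ht.1 (mem_insert_of_mem _ ht₁) ht.2.2.le
    have h3 := hcoe (W s₁ - W s)
    have h4 := hcoe (W t - W t₁)
    have h5 : 0 ≤ c * ‖W s₁ - W s‖ * ‖W s₁ - W s‖ := by positivity
    have h6 : 0 ≤ c * ‖W t - W t₁‖ * ‖W t - W t₁‖ := by positivity
    linarith

/-- `W` has a continuous extension to `[0, ∞)` along which the energy is nonincreasing. -/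
lemma exists_continuous_extension [CompleteSpace V] (h : IsDissipativeFlow a j G W u p) :
    ∃ W' : ℝ → V, ContinuousOn W' (Ici 0) ∧ (∀ t ∈ insert 0 G, W' t = W t) ∧
      AntitoneOn (fun t => a (W' t) (W' t)) (Ici 0) := by
  have hcl : Ici (0 : ℝ) ⊆ closure (insert 0 G) := fun s hs =>
    mem_closure_iff_nhdsWithin_neBot.2 (h.neBot_insert hs)
  have hcont : ContinuousOn (extendFrom (insert 0 G) W) (Ici 0) :=
    continuousOn_extendFrom hcl fun t ht => h.exists_tendsto ht
  have hA : insert 0 G ⊆ Ici (0 : ℝ) := by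
    rintro t (rfl | ht)
    · exact self_mem_Ici
    · exact (show (0 : ℝ) < t from h.subset_Ioi ht).le
  have heq : ∀ t ∈ insert 0 G, extendFrom (insert 0 G) W t = W t := by
    intro t ht
    obtain ⟨w, hw⟩ := h.exists_tendsto (hA ht)
    rw [extendFrom_eq (hcl (hA ht)) hw]
    exact tendsto_nhds_unique (hw.mono_left (pure_le_nhdsWithin ht)) (tendsto_pure_nhds W t)
  refine ⟨_, hcont, heq, ?_⟩
  set W' := extendFrom (insert 0 G) W
  have hlim : ∀ t, 0 ≤ t → Tendsto (fun s => a (W s) (W s)) (𝓝[insert 0 G] t)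
      (𝓝 (a (W' t) (W' t))) := by
    intro t ht
    have h1 : Tendsto W' (𝓝[insert 0 G] t) (𝓝 (W' t)) := (hcont t ht).mono hA
    have h2 : Tendsto (fun s => a (W' s) (W' s)) (𝓝[insert 0 G] t) (𝓝 (a (W' t) (W' t))) :=
      (a.continuous₂.tendsto (W' t, W' t)).comp (h1.prodMk_nhds h1)
    refine h2.congr' ?_
    filter_upwards [self_mem_nhdsWithin] with s hs
    rw [heq s hs]
  intro s hs t ht hst
  rcases hst.eq_or_lt with rfl | hlt
  · exact le_rfl
  have := h.neBot_insert hs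
  have := h.neBot_insert ht
  have hs' := (hlim s hs).comp (tendsto_fst (g := 𝓝[insert 0 G] t))
  have ht' := (hlim t ht).comp (tendsto_snd (f := 𝓝[insert 0 G] s))
  refine le_of_tendsto_of_tendsto ht' hs' ?_
  have e1 : ∀ᶠ z : ℝ × ℝ in 𝓝[insert 0 G] s ×ˢ 𝓝[insert 0 G] t,
      z.1 ∈ insert 0 G ∧ z.1 < (s + t) / 2 :=
    tendsto_fst.eventually (inter_mem self_mem_nhdsWithin
      (mem_nhdsWithin_of_mem_nhds (Iio_mem_nhds (by linarith))))
  have e2 : ∀ᶠ z : ℝ × ℝ in 𝓝[insert 0 G] s ×ˢ 𝓝[insert 0 G] t,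
      z.2 ∈ insert 0 G ∧ (s + t) / 2 < z.2 :=
    tendsto_snd.eventually (inter_mem self_mem_nhdsWithin
      (mem_nhdsWithin_of_mem_nhds (Ioi_mem_nhds (by linarith))))
  filter_upwards [e1, e2] with z h1 h2
  obtain ⟨c, hc, hcoe⟩ := h.coercive
  have h3 := h.form_sub_le h1.1 h2.1 (h1.2.trans h2.2).le
  have h4 := hcoe (W z.1 - W z.2)
  have h5 : 0 ≤ c * ‖W z.1 - W z.2‖ * ‖W z.1 - W z.2‖ := by positivity
  simp only [Function.comp_apply]
  linarith

/-- The dissipation inequality. Almost everywhere `-y' ≥ (u, p) ≥ ‖u‖²`, because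
`y(s) - y(t) ≥ (u(s), ∫_s^t p)`; a monotone function decreases at least by the integral of its
derivative. -/
lemma integral_norm_sq_le (h : IsDissipativeFlow a j G W u p) {W' : ℝ → V}
    (heq : ∀ t ∈ insert 0 G, W' t = W t) (hanti : AntitoneOn (fun t => a (W' t) (W' t)) (Ici 0))
    {s t : ℝ} (hs : 0 ≤ s) (hst : s ≤ t) :
    ∫ r in s..t, ‖u r‖ ^ 2 ≤ a (W' s) (W' s) - a (W' t) (W' t) := by
  have ht : 0 ≤ t := hs.trans hst
  set f : ℝ → ℝ := fun r => -a (W' r) (W' r) with hf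
  have hsub : uIcc s t ⊆ Ici 0 := by
    rw [uIcc_of_le hst]; exact fun r hr => hs.trans hr.1
  have hmono : MonotoneOn f (uIcc s t) := (hanti.mono hsub).neg
  have hfts : f s ≤ f t := hmono left_mem_uIcc right_mem_uIcc hst
  have h1 := hmono.intervalIntegral_deriv_mem_uIcc
  rw [uIcc_of_le (sub_nonneg.2 hfts)] at h1
  have hdiff : ∀ᵐ r ∂(volume.restrict (uIcc s t)), DifferentiableWithinAt ℝ f (uIcc s t) r :=
    hmono.ae_differentiableWithinAt measurableSet_uIcc
  have hleb := (h.intervalIntegrable_p hs ht).ae_hasDerivAt_integral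
  have hGae : ∀ᵐ r ∂(volume.restrict (Ioo s t)), r ∈ G :=
    ae_restrict_of_ae_restrict_of_subset (fun τ hτ => hs.trans_lt hτ.1) h.ae_mem
  have hle : ∫ r in s..t, ‖u r‖ ^ 2 ≤ ∫ r in s..t, deriv f r := by
    rw [intervalIntegral.integral_of_le hst, intervalIntegral.integral_of_le hst,
      integral_Ioc_eq_integral_Ioo, integral_Ioc_eq_integral_Ioo]
    refine integral_mono_ae ?_ ?_ ?_
    · exact (intervalIntegrable_iff_integrableOn_Ioo_of_le hst).1
        (MemLp.intervalIntegrable_norm_sq h.u_mem hs ht)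
    · exact (intervalIntegrable_iff_integrableOn_Ioo_of_le hst).1 hmono.intervalIntegrable_deriv
    · have hdiff' : ∀ᵐ r ∂(volume.restrict (Ioo s t)),
          DifferentiableWithinAt ℝ f (uIcc s t) r :=
        ae_restrict_of_ae_restrict_of_subset
          (by rw [uIcc_of_le hst]; exact Ioo_subset_Icc_self) hdiff
      filter_upwards [hdiff', ae_restrict_of_ae hleb, hGae, ae_restrict_mem measurableSet_Ioo]
        with r hr1 hr2 hrG hrI
      rw [uIcc_of_le hst] at hr1 hr2
      have hrd : HasDerivAt f (deriv f r) r :=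
        (hr1.differentiableAt (Icc_mem_nhds hrI.1 hrI.2)).hasDerivAt
      -- `r` is a Lebesgue point of `p`, so that the mean of `p` over `[r, x]` tends to `p r`.
      have hpd := hr2 (Ioo_subset_Icc_self hrI) r (Ioo_subset_Icc_self hrI)
      have hr0 : 0 < r := h.subset_Ioi hrG
      have := nhdsWithin_inter_Ioi_neBot h.ae_mem hr0.le
      have hsubf : 𝓝[G ∩ Ioi r] r ≤ 𝓝[≠] r :=
        nhdsWithin_mono _ fun x hx => ne_of_gt (show r < x from hx.2)
      have l1 := (hasDerivAt_iff_tendsto_slope.1 hrd).mono_left hsubf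
      have l2 := (hasDerivAt_iff_tendsto_slope.1 hpd).mono_left hsubf
      have l3 := (tendsto_const_nhds (x := u r)).inner (𝕜 := ℝ) l2
      refine (h.norm_sq_le r hrG).trans (le_of_tendsto_of_tendsto l3 l1 ?_)
      filter_upwards [self_mem_nhdsWithin] with x hx
      have hx1 : r < x := hx.2
      have e1 := h.energy_sub hrG hx.1
      have e2 := h.inner_integral_nonneg hx.1 hr0.le hx1.le
      simp only [slope_def_module, hf, heq r (mem_insert_of_mem _ hrG),
        heq x (mem_insert_of_mem _ hx.1), intervalIntegral.integral_same, sub_zero,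
        inner_smul_right, smul_eq_mul]
      refine mul_le_mul_of_nonneg_left ?_ (by simpa using hx1.le)
      linarith
  have h2 := h1.2
  simp only [hf] at h2
  linarith

/-- Integrating `‖u‖² ≥ y / K` over `[t, t + 1]`, where `y` is at least `y(t + 1)`, turns the
dissipation inequality into `y(t + 1) / K ≤ y(t) - y(t + 1)`. -/
lemma energy_succ_le (h : IsDissipativeFlow a j G W u p) {W' : ℝ → V}
    (heq : ∀ t ∈ insert 0 G, W' t = W t) (hanti : AntitoneOn (fun t => a (W' t) (W' t)) (Ici 0)) :
    ∃ q : ℝ, 0 < q ∧ q < 1 ∧ ∀ t, 0 ≤ t → a (W' (t + 1)) (W' (t + 1)) ≤ q * a (W' t) (W' t) := by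
  obtain ⟨K, hK, hle⟩ := h.energy_le_norm_sq
  refine ⟨K / (1 + K), by positivity, by rw [div_lt_one (by positivity)]; linarith,
    fun t ht => ?_⟩
  have h1 := h.integral_norm_sq_le heq hanti ht (le_add_of_nonneg_right zero_le_one)
  have ht1 : (0 : ℝ) ≤ t + 1 := by linarith
  have hst : t ≤ t + 1 := by linarith
  have h2 : ∫ _ in t..(t + 1), a (W' (t + 1)) (W' (t + 1)) ≤
      ∫ r in t..(t + 1), K * ‖u r‖ ^ 2 := by
    rw [intervalIntegral.integral_of_le hst, intervalIntegral.integral_of_le hst,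
      integral_Ioc_eq_integral_Ioo, integral_Ioc_eq_integral_Ioo]
    refine integral_mono_ae (by simp) ?_ ?_
    · exact (intervalIntegrable_iff_integrableOn_Ioo_of_le hst).1
        ((MemLp.intervalIntegrable_norm_sq h.u_mem ht ht1).const_mul K)
    · have hGae : ∀ᵐ r ∂(volume.restrict (Ioo t (t + 1))), r ∈ G :=
        ae_restrict_of_ae_restrict_of_subset (fun τ hτ => ht.trans_lt hτ.1) h.ae_mem
      filter_upwards [hGae, ae_restrict_mem measurableSet_Ioo] with r hr hrI
      refine le_trans ?_ (hle r hr)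
      rw [← heq r (mem_insert_of_mem _ hr)]
      exact hanti (show (0 : ℝ) ≤ r from ht.trans hrI.1.le) ht1 hrI.2.le
  rw [intervalIntegral.integral_const, intervalIntegral.integral_const_mul, add_sub_cancel_left,
    one_smul] at h2
  rw [div_mul_eq_mul_div, le_div_iff₀ (by positivity)]
  nlinarith

lemma exists_exp_decay (h : IsDissipativeFlow a j G W u p) {W' : ℝ → V}
    (heq : ∀ t ∈ insert 0 G, W' t = W t) (hanti : AntitoneOn (fun t => a (W' t) (W' t)) (Ici 0)) :
    ∃ C α : ℝ, 0 ≤ C ∧ 0 < α ∧ ∀ t, 0 ≤ t → ‖W' t‖ ≤ C * Real.exp (-α * t) := by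
  obtain ⟨q, hq0, hq1, hstep⟩ := h.energy_succ_le heq hanti
  obtain ⟨c, hc, hcoe⟩ := h.coercive
  set y : ℝ → ℝ := fun t => a (W' t) (W' t) with hy
  have hy0 : ∀ t, 0 ≤ y t := fun t =>
    le_trans (by positivity : 0 ≤ c * ‖W' t‖ * ‖W' t‖) (hcoe (W' t))
  have hnat : ∀ n : ℕ, y n ≤ q ^ n * y 0 := by
    intro n
    induction n with
    | zero => simp
    | succ n ih =>
      have h1 := hstep n n.cast_nonneg
      push_cast
      calc y (n + 1) ≤ q * y n := h1
        _ ≤ q * (q ^ n * y 0) := by gcongr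
        _ = q ^ (n + 1) * y 0 := by ring
  -- The rate for the norm is half of the rate `-log q` for the energy.
  set α := -Real.log q / 2 with hα
  have hlog : Real.log q < 0 := Real.log_neg hq0 hq1
  have hdecay : ∀ t, 0 ≤ t → y t ≤ q⁻¹ * y 0 * Real.exp (-α * t) ^ 2 := by
    intro t ht
    have h1 : y t ≤ y (⌊t⌋₊ : ℕ) :=
      hanti (show (0 : ℝ) ≤ (⌊t⌋₊ : ℕ) from Nat.cast_nonneg _) ht (Nat.floor_le ht)
    have h2 : q ^ (⌊t⌋₊ : ℕ) ≤ q⁻¹ * Real.exp (-α * t) ^ 2 := by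
      have h3 : Real.exp (-α * t) ^ 2 = q ^ t := by
        rw [← Real.exp_nat_mul, Real.rpow_def_of_pos hq0, hα]
        congr 1; push_cast; ring
      rw [h3, ← Real.rpow_natCast, ← Real.rpow_neg_one, ← Real.rpow_add hq0]
      exact Real.rpow_le_rpow_of_exponent_ge hq0 hq1.le (by linarith [Nat.lt_floor_add_one t])
    calc y t ≤ q ^ (⌊t⌋₊ : ℕ) * y 0 := h1.trans (hnat _)
      _ ≤ (q⁻¹ * Real.exp (-α * t) ^ 2) * y 0 := by
          gcongr; exact hy0 0
      _ = _ := by ring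
  refine ⟨Real.sqrt (q⁻¹ * y 0 / c), α, Real.sqrt_nonneg _, by rw [hα]; linarith, fun t ht => ?_⟩
  have h1 := hdecay t ht
  have h2 : c * ‖W' t‖ * ‖W' t‖ ≤ y t := hcoe (W' t)
  have hnn : 0 ≤ q⁻¹ * y 0 / c := by have := hy0 0; positivity
  refine abs_le_of_sq_le_sq' (a := ‖W' t‖) ?_ (by positivity) |>.2
  rw [mul_pow, Real.sq_sqrt hnn, div_mul_eq_mul_div, le_div_iff₀ hc]
  linarith

lemma exists_form_exp_decay (h : IsDissipativeFlow a j G W u p) {W' : ℝ → V}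
    (heq : ∀ t ∈ insert 0 G, W' t = W t) (hanti : AntitoneOn (fun t => a (W' t) (W' t)) (Ici 0)) :
    ∃ C α : ℝ, 0 < α ∧ ∀ t, 0 ≤ t → ‖a (W' t)‖ ≤ C * Real.exp (-α * t) := by
  obtain ⟨C, α, hC, hα, hdecay⟩ := h.exists_exp_decay heq hanti
  refine ⟨‖a‖ * C, α, hα, fun t ht => ?_⟩
  calc ‖a (W' t)‖ ≤ ‖a‖ * ‖W' t‖ := a.le_opNorm _
    _ ≤ ‖a‖ * (C * Real.exp (-α * t)) := by gcongr; exact hdecay t ht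
    _ = ‖a‖ * C * Real.exp (-α * t) := by ring

lemma memLp_u (h : IsDissipativeFlow a j G W u p) {W' : ℝ → V}
    (heq : ∀ t ∈ insert 0 G, W' t = W t) (hanti : AntitoneOn (fun t => a (W' t) (W' t)) (Ici 0)) :
    MemLp u 2 (volume.restrict (Ioi 0)) := by
  obtain ⟨c, hc, hcoe⟩ := h.coercive
  have hunion : Ioi (0 : ℝ) = ⋃ n : ℕ, Ioo 0 (n : ℝ) := by
    ext t
    simp only [mem_Ioi, mem_iUnion, mem_Ioo]
    exact ⟨fun ht => (exists_nat_gt t).imp fun n hn => ⟨ht, hn⟩, fun ⟨_, ht, _⟩ => ht⟩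
  have hm : AEStronglyMeasurable u (volume.restrict (Ioi 0)) := by
    rw [hunion, aestronglyMeasurable_iUnion_iff]
    exact fun n => (h.u_mem n).1
  rw [memLp_two_iff_integrable_sq_norm hm]
  refine integrableOn_Ioi_of_intervalIntegral_norm_bounded (l := atTop) (b := fun n : ℕ => (n : ℝ))
    (a (W' 0) (W' 0)) 0 (fun n => ?_) tendsto_natCast_atTop_atTop
    (Eventually.of_forall fun n => ?_)
  · exact (intervalIntegrable_iff_integrableOn_Ioc_of_le n.cast_nonneg).1
      (MemLp.intervalIntegrable_norm_sq h.u_mem le_rfl n.cast_nonneg)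
  · simp only [norm_pow, norm_norm]
    have h1 := h.integral_norm_sq_le heq hanti le_rfl n.cast_nonneg
    have h2 := hcoe (W' n)
    have h3 : 0 ≤ c * ‖W' n‖ * ‖W' n‖ := by positivity
    linarith

end IsDissipativeFlow

end Evolution

/-! ### The weak solution as a dissipative flow -/

/-- If `J(v)` is finite then `0 ≤ v ≤ 1`. -/
lemma ae_mem_Icc_of_funJ_ne_top {N : ℕ} {Ω : Set (Eucl N)} {v : SpaceV Ω} (hv : funJ v ≠ ⊤) :
    ∀ᵐ x ∂(volume.restrict Ω), W1p.toLp v x ∈ Icc (0 : ℝ) 1 := by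
  have hm : Measurable (W1p.toLp v : Eucl N → ℝ) := (Lp.stronglyMeasurable _).measurable
  have hS : MeasurableSet {x | W1p.toLp v x ∉ Icc (0 : ℝ) 1} := (hm measurableSet_Icc).compl
  rw [ae_iff]
  by_contra hne
  refine hv (top_unique ?_)
  calc (⊤ : ℝ≥0∞) = ⊤ * (volume.restrict Ω) {x | W1p.toLp v x ∉ Icc (0 : ℝ) 1} :=
        (ENNReal.top_mul hne).symm
    _ = ∫⁻ x in Ω, {x | W1p.toLp v x ∉ Icc (0 : ℝ) 1}.indicator (fun _ => ⊤) x := by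
        rw [lintegral_indicator_const hS]
    _ ≤ funJ v := by
        refine lintegral_mono (indicator_le fun x hx => ?_)
        rw [betaHat, if_neg (show ¬ (0 ≤ W1p.toLp v x ∧ W1p.toLp v x ≤ 1) from hx)]

lemma embHV'_apply {N : ℕ} {Ω : Set (Eucl N)} (u : SpaceH Ω) (w : SpaceV Ω) :
    embHV' u w = inner ℝ u (W1p.toLp w) := rfl

/-- What is needed of a weak solution at the time `t`: the bounds `0 ≤ u ≤ p`, which follow from
`p = u (1 + χ)` and `0 ≤ χ`, and the equation `u + A_γ (1 * p) = u₀`. -/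
structure IsRegularTime {N : ℕ} {Ω : Set (Eucl N)} (γ : ℝ) (u₀ : DualV Ω) (u p : ℝ → SpaceH Ω)
    (t : ℝ) : Prop where
  pos : 0 < t
  u_nonneg : ∀ᵐ x ∂(volume.restrict Ω), 0 ≤ u t x
  u_le_p : ∀ᵐ x ∂(volume.restrict Ω), u t x ≤ p t x
  exists_primitive : ∃ P : SpaceV Ω, W1p.toLp P = ∫ s in (0 : ℝ)..t, p s ∧
    ∀ w, embHV' (u t) w + robinForm γ P w = u₀ w

lemma IsWeakSolution.ae_isRegularTime {N : ℕ} {Ω : Set (Eucl N)} {μ γ : ℝ} {h : ℝ → ℝ}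
    {e₀ : LpOn Ω 1} {χ₀ : SpaceV Ω} {u₀ : DualV Ω} {T : ℝ} {e θ : ℝ → LpOn Ω 1}
    {χ : ℝ → SpaceH Ω} {ξ : ℝ → DualV Ω} {u p : ℝ → SpaceH Ω}
    (hsol : IsWeakSolution μ γ h e₀ χ₀ u₀ T e θ χ ξ u p) :
    ∀ᵐ t ∂(timeMeasure T), IsRegularTime γ u₀ u p t := by
  obtain ⟨q, q', _, _, E, Θ, E', dE, X, χc, dχ, Λ, P, hs⟩ := hsol
  filter_upwards [hs.u_pos, hs.eq_p, hs.eq_ξ, hs.χ_memV.2, hs.p_conv.2, hs.eq_u,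
    ae_restrict_mem measurableSet_Ioo] with t hu hp hξ hχ hP heq ht
  refine ⟨ht.1, hu.mono fun x hx => hx.le, ?_, P t, Lp.ext hP, heq⟩
  filter_upwards [hu, hp, hχ, ae_mem_Icc_of_funJ_ne_top hξ.1] with x h1 h2 h3 h4
  rw [h3] at h4
  rw [h2]
  nlinarith [mul_nonneg h1.le h4.1]

lemma IsWeakSolution.memLp_u {N : ℕ} {Ω : Set (Eucl N)} {μ γ : ℝ} {h : ℝ → ℝ}
    {e₀ : LpOn Ω 1} {χ₀ : SpaceV Ω} {u₀ : DualV Ω} {T : ℝ} {e θ : ℝ → LpOn Ω 1}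
    {χ : ℝ → SpaceH Ω} {ξ : ℝ → DualV Ω} {u p : ℝ → SpaceH Ω}
    (hsol : IsWeakSolution μ γ h e₀ χ₀ u₀ T e θ χ ξ u p) : MemLp u 2 (timeMeasure T) := by
  obtain ⟨q, q', _, _, E, Θ, E', dE, X, χc, dχ, Λ, P, hs⟩ := hsol
  exact hs.u_mem

lemma IsWeakSolution.memLp_p {N : ℕ} {Ω : Set (Eucl N)} {μ γ : ℝ} {h : ℝ → ℝ}
    {e₀ : LpOn Ω 1} {χ₀ : SpaceV Ω} {u₀ : DualV Ω} {T : ℝ} {e θ : ℝ → LpOn Ω 1}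
    {χ : ℝ → SpaceH Ω} {ξ : ℝ → DualV Ω} {u p : ℝ → SpaceH Ω}
    (hsol : IsWeakSolution μ γ h e₀ χ₀ u₀ T e θ χ ξ u p) : MemLp p 2 (timeMeasure T) := by
  obtain ⟨q, q', _, _, E, Θ, E', dE, X, χc, dχ, Λ, P, hs⟩ := hsol
  exact hs.p_mem

lemma ae_restrict_Ioi_of_timeMeasure {P : ℝ → Prop} (h : ∀ T, 0 < T → ∀ᵐ t ∂(timeMeasure T), P t) :
    ∀ᵐ t ∂(volume.restrict (Ioi (0 : ℝ))), P t := by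
  have hU : Ioi (0 : ℝ) = ⋃ n : ℕ, Ioo (0 : ℝ) (n + 1) := by
    ext t
    simp only [mem_Ioi, mem_iUnion, mem_Ioo]
    refine ⟨fun ht => ?_, fun ⟨_, ht, _⟩ => ht⟩
    obtain ⟨n, hn⟩ := exists_nat_gt t
    exact ⟨n, ht, by linarith⟩
  rw [hU, ae_restrict_iUnion_iff]
  exact fun n => h _ (by positivity)

lemma MeasureTheory.Lp.inner_le_inner_of_ae_le {α : Type*} [MeasurableSpace α] {μ : Measure α}
    {f g k : Lp ℝ 2 μ} (hf : ∀ᵐ x ∂μ, 0 ≤ f x) (hgk : ∀ᵐ x ∂μ, g x ≤ k x) :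
    inner ℝ f g ≤ inner ℝ f k := by
  rw [L2.inner_def, L2.inner_def]
  refine integral_mono_ae (L2.integrable_inner f g) (L2.integrable_inner f k) ?_
  filter_upwards [hf, hgk] with x h1 h2
  simpa using mul_le_mul_of_nonneg_right h2 h1

open Classical in
/-- The solution `W(t) ∈ V` of `A_γ W(t) = u(t)` is `w₀ - (1 * p)(t)`, where `A_γ w₀ = u₀`; this
makes the weak solution a dissipative flow. -/
lemma exists_isDissipativeFlow {n : ℕ} {Ω : Set (Eucl (n + 1))} (hΩ : IsBoundedSmoothOpen Ω)
    {γ : ℝ} (hγ : 0 < γ) {u₀ : DualV Ω} {u p : ℝ → SpaceH Ω}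
    (hu : ∀ T, MemLp u 2 (timeMeasure T)) (hp : ∀ T, MemLp p 2 (timeMeasure T))
    (hreg : ∀ᵐ t ∂(volume.restrict (Ioi (0 : ℝ))), IsRegularTime γ u₀ u p t) :
    ∃ W : ℝ → SpaceV Ω, IsDissipativeFlow (robinL hΩ γ) W1p.toLp
      {t | IsRegularTime γ u₀ u p t} W u p := by
  have hcoe := isCoercive_robinL hΩ hγ
  have hP : ∀ t, ∃ P : SpaceV Ω, IsRegularTime γ u₀ u p t →
      W1p.toLp P = ∫ s in (0 : ℝ)..t, p s ∧ ∀ w, embHV' (u t) w + robinForm γ P w = u₀ w := by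
    intro t
    by_cases ht : IsRegularTime γ u₀ u p t
    · obtain ⟨P, hP⟩ := ht.exists_primitive
      exact ⟨P, fun _ => hP⟩
    · exact ⟨0, fun h => absurd h ht⟩
  choose P hP using hP
  set w₀ : SpaceV Ω := hcoe.continuousLinearEquivOfBilin.symm
    ((InnerProductSpace.toDual ℝ (SpaceV Ω)).symm u₀) with hw₀
  have hw₀_apply : ∀ w, robinL hΩ γ w₀ w = u₀ w := by
    intro w
    rw [← hcoe.continuousLinearEquivOfBilin_apply, hw₀, ContinuousLinearEquiv.apply_symm_apply,
      InnerProductSpace.toDual_symm_apply]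
  -- The time `0` is not regular, so that `W 0 = w₀`; the values at other irregular times are
  -- arbitrary.
  have h0 : ¬ IsRegularTime γ u₀ u p 0 := fun h => lt_irrefl _ h.pos
  refine ⟨fun t => if IsRegularTime γ u₀ u p t then w₀ - P t else w₀, ?_⟩
  exact
    { symm := robinL_symm hΩ γ
      coercive := hcoe
      injective := SpaceV.toLp_injective hΩ.isOpen
      subset_Ioi := fun t ht => ht.pos
      ae_mem := hreg
      u_mem := hu
      p_mem := hp
      inner_nonneg := fun s hs t ht => by
        have h1 : ∀ᵐ x ∂(volume.restrict Ω), (0 : SpaceH Ω) x ≤ p t x := by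
          filter_upwards [ht.u_nonneg, ht.u_le_p, Lp.coeFn_zero ℝ 2 (volume.restrict Ω)]
            with x h1 h2 h3
          rw [h3]
          exact h1.trans h2
        simpa using Lp.inner_le_inner_of_ae_le hs.u_nonneg h1
      norm_sq_le := fun t ht => by
        rw [← real_inner_self_eq_norm_sq]
        exact Lp.inner_le_inner_of_ae_le ht.u_nonneg ht.u_le_p
      elliptic := fun t ht w => by
        have h1 := (hP t ht).2 w
        rw [robinForm_eq_robinL hΩ, embHV'_apply] at h1
        simp only [if_pos (show IsRegularTime γ u₀ u p t from ht), map_sub,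
          sub_apply, hw₀_apply]
        linarith
      evolution := fun t ht => by
        simp only [if_pos (show IsRegularTime γ u₀ u p t from ht), if_neg h0, map_sub,
          (hP t ht).1] }

end

/-- Let `γ > 0` and let the assumptions of the existence theorem hold. If `(e, θ, χ, ξ, u, p)` is a
weak solution on `(0, T)` for every `T > 0`, then `u ∈ L²(0, ∞; L²(Ω))`, and `u`, which has a
representative in `C⁰([0, ∞); V')`, decays to zero exponentially in `V'`. -/
theorem theorem2p4 {N : ℕ} (hN₁ : 1 ≤ N) (hN₃ : N ≤ 3) (Ω : Set (Eucl N))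
    (hΩ : IsBoundedSmoothOpen Ω) (μ γ : ℝ) (hμ : 0 < μ) (hγ : 0 < γ)
    (h : ℝ → ℝ) (c_h : ℝ) (hh : IsAdmissible h c_h)
    (e₀ : LpOn Ω 1)
    (χ₀ : SpaceV Ω) (hχ₀ : funJ χ₀ ≠ ⊤)
    (u₀ : LpOn Ω 1) (hu₀_pos : ∀ᵐ x ∂(volume.restrict Ω), 0 < u₀ x)
    (hu₀_log : IntegrableOn (fun x => Real.log (u₀ x)) Ω)
    (u₀' : DualV Ω) (hu₀' : IsFunctionalOf u₀ u₀')
    (e θ : ℝ → LpOn Ω 1) (χ : ℝ → SpaceH Ω) (ξ : ℝ → DualV Ω) (u p : ℝ → SpaceH Ω)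
    (hsol : ∀ T : ℝ, 0 < T → IsWeakSolution μ γ h e₀ χ₀ u₀' T e θ χ ξ u p) :
    MemLp u 2 (volume.restrict (Ioi 0)) ∧
    ∃ U : ℝ → DualV Ω, ContinuousOn U (Ici 0) ∧
      (∀ᵐ t ∂(volume.restrict (Ioi 0)), U t = embHV' (u t)) ∧
      ∃ C α : ℝ, 0 < α ∧ ∀ t : ℝ, 0 ≤ t → ‖U t‖ ≤ C * Real.exp (-α * t) := by
  obtain ⟨n, rfl⟩ := Nat.exists_eq_add_of_le' hN₁
  have hle : ∀ T : ℝ, timeMeasure T ≤ timeMeasure (max T 1) := fun T =>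
    Measure.restrict_mono (Ioo_subset_Ioo_right (le_max_left _ _)) le_rfl
  have hmax : ∀ T : ℝ, 0 < max T 1 := fun T => zero_lt_one.trans_le (le_max_right _ _)
  obtain ⟨W, hW⟩ := exists_isDissipativeFlow hΩ hγ
    (fun T => (hsol _ (hmax T)).memLp_u.mono_measure (hle T))
    (fun T => (hsol _ (hmax T)).memLp_p.mono_measure (hle T))
    (ae_restrict_Ioi_of_timeMeasure fun T hT => (hsol T hT).ae_isRegularTime)
  obtain ⟨W', hcont, heq, hanti⟩ := hW.exists_continuous_extension
  refine ⟨hW.memLp_u heq hanti, fun t => robinL hΩ γ (W' t),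
    (robinL hΩ γ).continuous.comp_continuousOn hcont, ?_,
    hW.exists_form_exp_decay heq hanti⟩
  filter_upwards [hW.ae_mem] with t ht
  ext w
  rw [heq t (mem_insert_of_mem _ ht), hW.elliptic t ht, embHV'_apply]
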